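/- Let $n,m\ge 0$ be integers, $\theta_i=0$ for $0\le i\le n$, $\theta_i=1$ for $n<i\le n+m$. Let $h$ be an indeterminate, $q=e^h\in\mathbb C[[h]]$, $\bar q=q^{-1}$, $q_i=q^{1-2\theta_i}$, $\bar q_i=q_i^{-1}$. Write $$[a,b]_x=ab-x\,ba,\quad \{a,b\}_x=ab+x\,ba,\quad [\![a,b]\!]_x=ab-(-1)^{\deg a\,\deg b}x\,ba,$$ omitting the index $x$ when $x=1$. By "the $\mathbb C[[h]]$-algebra with generators $G$ and relations $R$" we mean the quotient of the $h$-adically completed free unital associative $\mathbb C[[h]]$-algebra on $G$ by the $h$-adic closure of the two-sided ideal generated by $R$; there $q^{x}=\sum_k h^kx^k/k!$, and $(q^x-q^{-x})/(q-\bar q)$ is the unique element whose product with $q-\bar q$ is $q^x-q^{-x}$. A $\mathbb C[[h]]$-module is topologically free if it is isomorphic to the $h$-adic completion of a free $\mathbb C[[h]]$-module. All indices below run over those values in $\{1,\dots,n+m\}$ for which every generator in the relation is defined. Let $\alpha_{ij}=(1+(-1)^{\theta_{i-1}+\theta_i})\delta_{ij}-(-1)^{\theta_{i-1}+\theta_i}\delta_{i,j-1}-\delta_{i-1,j}$.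 The algebra $U_q[sl(n+1|m)]$ is the $\mathbb C[[h]]$-algebra with (Chevalley) generators $h_i,e_i,f_i$ ($1\le i\le n+m$), where $\deg h_i=0$, $\deg e_i=\deg f_i=\theta_{i-1}+\theta_i$, and relations $$[h_i,h_j]=0,\quad [h_i,e_j]=\alpha_{ij}e_j,\quad [h_i,f_j]=-\alpha_{ij}f_j,\quad [\![e_i,f_j]\!]=\delta_{ij}\frac{q^{h_i}-q^{-h_i}}{q-\bar q},$$ $$[e_i,e_j]=0\ (|i-j|\ne1),\qquad e_{n+1}^2=0,\qquad [e_i,[e_i,e_{i\pm1}]_{\bar q}]_q=[e_i,[e_i,e_{i\pm1}]_q]_{\bar q}=0\ (i\ne n+1),$$ $$\{e_{n+1},[[e_n,e_{n+1}]_q,e_{n+2}]_{\bar q}\}=\{e_{n+1},[[e_n,e_{n+1}]_{\bar q},e_{n+2}]_q\}=0,$$ together with the last two lines with every $e$ replaced by $f$. **Theorem.** $U_q[sl(n+1|m)]$ is a topologically free $\mathbb C[[h]]$-module, and it has the following presentation. Let $U'$ be the $\mathbb C[[h]]$-algebra with generators $H_i,a_i^+,a_i^-$ ($1\le i\le n+m$),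 where $\deg H_i=0$, $\deg a_i^\pm=\theta_i$, and, with $L_i=q^{H_i}$, $\bar L_i=q^{-H_i}$ and $\xi,\eta\in\{+1,-1\}$ (written also $\pm$), relations $$[H_i,H_j]=0,\qquad [H_i,a_j^\pm]=\mp(1+(-1)^{\theta_i}\delta_{ij})a_j^\pm,\qquad [\![a_i^-,a_i^+]\!]=\frac{L_i-\bar L_i}{q-\bar q},$$ $$[\![\,[\![a_i^\eta,a_{i+\xi}^{-\eta}]\!],\,a_k^\eta\,]\!]_{q^{\xi(1+(-1)^{\theta_i}\delta_{ik})}}=\eta^{\theta_k}\,\delta_{k,i+\xi}\,L_k^{-\xi\eta}\,a_i^\eta,$$ $$[\![a_1^\xi,a_2^\xi]\!]_q=0,\qquad [\![a_1^\xi,a_1^\xi]\!]=0 .$$ Then there is an isomorphism of $\mathbb C[[h]]$-algebras $\Phi:U'\to U_q[sl(n+1|m)]$ which sends the generators $H_i$, $a_i^\pm$ to the elements of $U_q[sl(n+1|m)]$ denoted by the same letters and defined by $$H_i=\sum_{p=1}^i(-1)^{\theta_{p-1}}h_p,\qquad a_1^-=e_1,\quad a_i^-=[a_{i-1}^-,e_i]_{\bar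 q_{i-1}},\qquad a_1^+=f_1,\quad a_i^+=[f_i,a_{i-1}^+]_{q_{i-1}}\quad(i\ge2),$$ and whose inverse is given on the Chevalley generators by $h_1\mapsto H_1$, $e_1\mapsto a_1^-$, $f_1\mapsto a_1^+$ and, for $1\le i\le n+m-1$, $$h_{i+1}\mapsto(-1)^{\theta_i}(H_{i+1}-H_i),\quad e_{i+1}\mapsto-(-1)^{\theta_i}[\![a_{i+1}^-,a_i^+]\!]L_i,\quad f_{i+1}\mapsto-(-1)^{\theta_i}\bar L_i[\![a_i^-,a_{i+1}^+]\!].$$ -/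

import Mathlib

open scoped PowerSeries Nat

noncomputable section

namespace UqSl

/-! ### Algebras over `ℂ[[h]]` given by topological generators and relations

The indeterminate `h` is `PowerSeries.X`, and `ℂ[[h]]` is `ℂ⟦X⟧`. -/

/-- The `h`-adically completed free associative unital `ℂ[[h]]`-algebra on the set `G`: formal power
series in a central indeterminate `h` with coefficients in the free `ℂ`-algebra `ℂ⟨G⟩`. -/
def HFree (G : Type) : Type := PowerSeries (FreeAlgebra ℂ G)

namespace HFree

variable {G : Type}

instance : Ring (HFree G) := inferInstanceAs (Ring (PowerSeries (FreeAlgebra ℂ G)))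

/-- A power series with complex coefficients, as a (central) element of `HFree G`. -/
def scalar : ℂ⟦X⟧ →+* HFree G := PowerSeries.map (algebraMap ℂ (FreeAlgebra ℂ G))

theorem scalar_mul_comm (c : ℂ⟦X⟧) (x : HFree G) : scalar c * x = x * scalar c := by
  refine PowerSeries.ext fun k => ?_
  refine (PowerSeries.coeff_mul k _ _).trans (Eq.trans ?_ (PowerSeries.coeff_mul k _ _).symm)
  rw [← Finset.Nat.sum_antidiagonal_swap]
  refine Finset.sum_congr rfl fun p _ => ?_
  have h1 : ∀ j, PowerSeries.coeff j (scalar c : PowerSeries (FreeAlgebra ℂ G))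
      = algebraMap ℂ (FreeAlgebra ℂ G) (PowerSeries.coeff j c) := fun j =>
    PowerSeries.coeff_map _ _ _
  simp only [Prod.fst_swap, Prod.snd_swap, h1]
  exact Algebra.commutes _ _

instance : Algebra ℂ⟦X⟧ (HFree G) := RingHom.toAlgebra' scalar scalar_mul_comm

/-- An element of the free algebra `ℂ⟨G⟩`, as an element of `HFree G` that is constant in `h`. -/
def const (x : FreeAlgebra ℂ G) : HFree G := PowerSeries.C x

/-- The generator attached to `g`. -/
def gen (g : G) : HFree G := const (FreeAlgebra.ι ℂ g)

end HFree

/-- The two-sided ideal generated by the differences `a - b` with `R a b`, and by `h ^ k`. -/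
def idealMod {G : Type} (R : HFree G → HFree G → Prop) (k : ℕ) : TwoSidedIdeal (HFree G) :=
  TwoSidedIdeal.span
    ({x | ∃ a b, R a b ∧ x = a - b} ∪ {algebraMap ℂ⟦X⟧ (HFree G) (PowerSeries.X ^ k)})

/-- The `h`-adic closure `⋂ₖ (I + hᵏ F)` of the two-sided ideal `I` of `F = HFree G` generated by
the relations `a = b`, `R a b`. -/
def closedIdeal {G : Type} (R : HFree G → HFree G → Prop) : TwoSidedIdeal (HFree G) :=
  ⨅ k : ℕ, idealMod R k

/-- The `h`-adically complete `ℂ[[h]]`-algebra with topological generators `G` and defining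
relations `a = b`, `R a b`. -/
abbrev HPresented {G : Type} (R : HFree G → HFree G → Prop) : Type :=
  (closedIdeal R).ringCon.Quotient

/-- The class in `HPresented R` of an element of the completed free algebra. -/
def cls {G : Type} (R : HFree G → HFree G → Prop) : HFree G →ₐ[ℂ⟦X⟧] HPresented R :=
  (closedIdeal R).ringCon.mkₐ ℂ⟦X⟧

/-- A `ℂ[[h]]`-module is topologically free if it is isomorphic to the `h`-adic completion of a free
`ℂ[[h]]`-module. -/
def IsTopologicallyFree (M : Type) [AddCommGroup M] [Module ℂ⟦X⟧ M] : Prop :=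
  ∃ ι : Type, Nonempty
    (M ≃ₗ[ℂ⟦X⟧] AdicCompletion (Ideal.span {(PowerSeries.X : ℂ⟦X⟧)}) (ι →₀ ℂ⟦X⟧))

/-! ### Powers of `q = exp h`, and brackets -/

/-- `q ^ a = exp (a h)` in `ℂ[[h]]`, for an integer `a`. -/
def qpow (a : ℤ) : ℂ⟦X⟧ := PowerSeries.mk fun k => (a : ℂ) ^ k / (k ! : ℂ)

/-- `q ^ x = exp (h x) = ∑ₖ hᵏ xᵏ / k!`, for `x` in the free algebra. -/
def qexp {G : Type} (x : FreeAlgebra ℂ G) : HFree G :=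
  PowerSeries.mk fun k => ((k ! : ℂ)⁻¹) • x ^ k

/-- Division by `h` of a power series over `A` without constant term. -/
def divh {A : Type} [Semiring A] (f : PowerSeries A) : PowerSeries A :=
  PowerSeries.mk fun k => PowerSeries.coeff (k + 1) f

/-- `(q ^ x - q ^ (-x)) / (q - q⁻¹)`, for `x` in the free algebra. Numerator and denominator are both
divisible by `h`, and `(q - q⁻¹) / h = 2 + ⋯` is invertible in `ℂ[[h]]`. -/
def qnum {G : Type} (x : FreeAlgebra ℂ G) : HFree G :=
  ((divh (qpow 1 - qpow (-1)))⁻¹ : ℂ⟦X⟧) • (show HFree G from divh (qexp x - qexp (-x)))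

theorem X_mul_divh {A : Type} [Semiring A] (f : PowerSeries A)
    (hf : PowerSeries.coeff 0 f = 0) : PowerSeries.X * divh f = f := by
  refine PowerSeries.ext fun k => ?_
  cases k with
  | zero => simpa using hf.symm
  | succ k => rw [PowerSeries.coeff_succ_X_mul, divh, PowerSeries.coeff_mk]

/-- `qnum x` is indeed the quotient of `q ^ x - q ^ (-x)` by `q - q⁻¹`. -/
theorem qnum_spec {G : Type} (x : FreeAlgebra ℂ G) :
    (qpow 1 - qpow (-1)) • qnum x = qexp x - qexp (-x) := by
  have h0 : PowerSeries.coeff 0 (qpow 1 - qpow (-1)) = 0 := by simp [qpow]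
  have h1 : PowerSeries.constantCoeff (divh (qpow 1 - qpow (-1))) ≠ 0 := by
    rw [← PowerSeries.coeff_zero_eq_constantCoeff_apply, divh, PowerSeries.coeff_mk]
    simp [qpow]
  have h2 : PowerSeries.coeff 0
      (qexp x - qexp (-x) : PowerSeries (FreeAlgebra ℂ G)) = 0 := by
    refine (map_sub (PowerSeries.coeff (R := FreeAlgebra ℂ G) 0) (qexp x) (qexp (-x))).trans ?_
    refine sub_eq_zero.2 ((PowerSeries.coeff_mk 0 _).trans (Eq.trans ?_ (PowerSeries.coeff_mk 0 _).symm))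
    simp
  have h3 : HFree.scalar (G := G) PowerSeries.X
      = (PowerSeries.X : PowerSeries (FreeAlgebra ℂ G)) := PowerSeries.map_X _
  rw [qnum, smul_smul]
  nth_rewrite 1 [← X_mul_divh _ h0]
  rw [mul_assoc, PowerSeries.mul_inv_cancel _ h1, mul_one, Algebra.smul_def]
  refine Eq.trans ?_ (X_mul_divh _ h2)
  exact congrArg (· * _) h3

section Brackets

variable {G : Type}

/-- `[a, b]_x = a b - x b a`. -/
def br (x : ℂ⟦X⟧) (a b : HFree G) : HFree G := a * b - x • (b * a)

/-- `{a, b}_x = a b + x b a`. -/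
def abr (x : ℂ⟦X⟧) (a b : HFree G) : HFree G := a * b + x • (b * a)

/-- `⟦a, b⟧_x = a b - (-1) ^ (da * db) x b a`, for homogeneous `a`, `b` of degrees `da`, `db`
(given by natural numbers, of which only the parity matters). -/
def sbr (x : ℂ⟦X⟧) (da db : ℕ) (a b : HFree G) : HFree G :=
  a * b - ((-1) ^ (da * db) * x) • (b * a)

end Brackets

/-! ### Combinatorial data of `sl(n+1|m)` -/

/-- The index set `[1; n+m]`. -/
abbrev Idx (n m : ℕ) : Type := {i : ℕ // 1 ≤ i ∧ i ≤ n + m}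

/-- `θ_i = 0` for `i ≤ n` and `θ_i = 1` for `i > n`. -/
def theta (n i : ℕ) : ℕ := if i ≤ n then 0 else 1

/-- The Cartan matrix `α_{ij} = (1 + s) δ_{ij} - s δ_{i,j-1} - δ_{i-1,j}`, where
`s = (-1) ^ (θ_{i-1} + θ_i)`, for `i, j ≥ 1`. -/
def cartan (n i j : ℕ) : ℤ :=
  (1 + (-1) ^ (theta n (i - 1) + theta n i)) * (if i = j then 1 else 0)
    - (-1) ^ (theta n (i - 1) + theta n i) * (if i + 1 = j then 1 else 0)
    - (if i = j + 1 then 1 else 0)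

/-! ### The Chevalley presentation -/

/-- The Chevalley generators `h_i, e_i, f_i`, `i ∈ [1; n+m]`. -/
inductive ChevGen (n m : ℕ) : Type
  | h (i : Idx n m)
  | e (i : Idx n m)
  | f (i : Idx n m)

/-- The generator `h_i` in the free algebra, for `i ∈ [1; n+m]` (and `0` for other `i`). -/
def chevh0 (n m i : ℕ) : FreeAlgebra ℂ (ChevGen n m) :=
  if hi : 1 ≤ i ∧ i ≤ n + m then FreeAlgebra.ι ℂ (.h ⟨i, hi⟩) else 0

/-- The generator `h_i`, for `i ∈ [1; n+m]` (and `0` for other `i`). -/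
def chevh (n m i : ℕ) : HFree (ChevGen n m) := HFree.const (chevh0 n m i)

/-- The generator `e_i`, for `i ∈ [1; n+m]` (and `0` for other `i`). -/
def cheve (n m i : ℕ) : HFree (ChevGen n m) :=
  if hi : 1 ≤ i ∧ i ≤ n + m then HFree.gen (.e ⟨i, hi⟩) else 0

/-- The generator `f_i`, for `i ∈ [1; n+m]` (and `0` for other `i`). -/
def chevf (n m i : ℕ) : HFree (ChevGen n m) :=
  if hi : 1 ≤ i ∧ i ≤ n + m then HFree.gen (.f ⟨i, hi⟩) else 0

/-- The degree `θ_{i-1} + θ_i` of `e_i` and of `f_i`, for `i ≥ 1`. -/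
def chevDeg (n i : ℕ) : ℕ := theta n (i - 1) + theta n i

/-- The Serre relations for a family `x_1, …, x_{n+m}` (to be used for `x = e` and `x = f`). -/
inductive SerreRel (n m : ℕ) {G : Type} (x : ℕ → HFree G) : HFree G → HFree G → Prop
  | comm (i j : ℕ) (hi : 1 ≤ i ∧ i ≤ n + m) (hj : 1 ≤ j ∧ j ≤ n + m)
      (hij : i ≠ j + 1 ∧ j ≠ i + 1) :
      SerreRel n m x (br 1 (x i) (x j)) 0
  | sq (hm : 1 ≤ m) : SerreRel n m x (x (n + 1) ^ 2) 0
  | triple (i j : ℕ) (hi : 1 ≤ i ∧ i ≤ n + m) (hj : 1 ≤ j ∧ j ≤ n + m)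
      (hij : i = j + 1 ∨ j = i + 1) (hin : i ≠ n + 1) :
      SerreRel n m x (br (qpow 1) (x i) (br (qpow (-1)) (x i) (x j))) 0
  | triple' (i j : ℕ) (hi : 1 ≤ i ∧ i ≤ n + m) (hj : 1 ≤ j ∧ j ≤ n + m)
      (hij : i = j + 1 ∨ j = i + 1) (hin : i ≠ n + 1) :
      SerreRel n m x (br (qpow (-1)) (x i) (br (qpow 1) (x i) (x j))) 0
  | additional (hn : 1 ≤ n) (hm : 2 ≤ m) :
      SerreRel n m x
        (abr 1 (x (n + 1)) (br (qpow (-1)) (br (qpow 1) (x n) (x (n + 1))) (x (n + 2)))) 0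
  | additional' (hn : 1 ≤ n) (hm : 2 ≤ m) :
      SerreRel n m x
        (abr 1 (x (n + 1)) (br (qpow 1) (br (qpow (-1)) (x n) (x (n + 1))) (x (n + 2)))) 0

/-- The Cartan–Kac relations and the `e`- and `f`-Serre relations. -/
inductive ChevRel (n m : ℕ) : HFree (ChevGen n m) → HFree (ChevGen n m) → Prop
  | hh (i j : ℕ) (hi : 1 ≤ i ∧ i ≤ n + m) (hj : 1 ≤ j ∧ j ≤ n + m) :
      ChevRel n m (br 1 (chevh n m i) (chevh n m j)) 0
  | he (i j : ℕ) (hi : 1 ≤ i ∧ i ≤ n + m) (hj : 1 ≤ j ∧ j ≤ n + m) :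
      ChevRel n m (br 1 (chevh n m i) (cheve n m j)) (cartan n i j • cheve n m j)
  | hf (i j : ℕ) (hi : 1 ≤ i ∧ i ≤ n + m) (hj : 1 ≤ j ∧ j ≤ n + m) :
      ChevRel n m (br 1 (chevh n m i) (chevf n m j)) (-(cartan n i j) • chevf n m j)
  | ef (i j : ℕ) (hi : 1 ≤ i ∧ i ≤ n + m) (hj : 1 ≤ j ∧ j ≤ n + m) :
      ChevRel n m (sbr 1 (chevDeg n i) (chevDeg n j) (cheve n m i) (chevf n m j))
        (if i = j then qnum (chevh0 n m i) else 0)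
  | serre_e (a b : HFree (ChevGen n m)) (hab : SerreRel n m (cheve n m) a b) : ChevRel n m a b
  | serre_f (a b : HFree (ChevGen n m)) (hab : SerreRel n m (chevf n m) a b) : ChevRel n m a b

/-- `U_q[sl(n+1|m)]`, in its definition by Chevalley generators. -/
abbrev Uq (n m : ℕ) : Type := HPresented (ChevRel n m)

/-- `q_i = q ^ (1 - 2 θ_i)`. -/
def qi (n i : ℕ) : ℂ⟦X⟧ := qpow (1 - 2 * (theta n i : ℤ))

/-- `q_i⁻¹`. -/
def qiInv (n i : ℕ) : ℂ⟦X⟧ := qpow (-(1 - 2 * (theta n i : ℤ)))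

/-- `a_1^- = e_1`, `a_i^- = [a_{i-1}^-, e_i]_{q_{i-1}⁻¹}`. -/
def chevaMinus (n m : ℕ) : ℕ → HFree (ChevGen n m)
  | 0 => 0
  | 1 => cheve n m 1
  | (i + 2) => br (qiInv n (i + 1)) (chevaMinus n m (i + 1)) (cheve n m (i + 2))

/-- `a_1^+ = f_1`, `a_i^+ = [f_i, a_{i-1}^+]_{q_{i-1}}`. -/
def chevaPlus (n m : ℕ) : ℕ → HFree (ChevGen n m)
  | 0 => 0
  | 1 => chevf n m 1
  | (i + 2) => br (qi n (i + 1)) (chevf n m (i + 2)) (chevaPlus n m (i + 1))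

/-- `H_i = ∑_{p=1}^{i} (-1) ^ θ_{p-1} h_p`. -/
def chevH (n m i : ℕ) : HFree (ChevGen n m) :=
  ∑ p ∈ Finset.Icc 1 i, ((-1 : ℤ) ^ theta n (p - 1)) • chevh n m p

/-! ### The presentation by creation and annihilation generators -/

/-- The generators `H_i, a_i^ξ`, `i ∈ [1; n+m]`, `ξ = ±`; the sign is `1` or `-1` in `ℤˣ`. -/
inductive CagGen (n m : ℕ) : Type
  | H (i : Idx n m)
  | a (ξ : ℤˣ) (i : Idx n m)

/-- The generator `H_i` in the free algebra, for `i ∈ [1; n+m]` (and `0` for other `i`). -/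
def cagH0 (n m i : ℕ) : FreeAlgebra ℂ (CagGen n m) :=
  if hi : 1 ≤ i ∧ i ≤ n + m then FreeAlgebra.ι ℂ (.H ⟨i, hi⟩) else 0

/-- The generator `H_i`, for `i ∈ [1; n+m]` (and `0` for other `i`). -/
def cagH (n m i : ℕ) : HFree (CagGen n m) := HFree.const (cagH0 n m i)

/-- `L_i ^ c = q ^ (c H_i)`, for an integer `c`. -/
def cagL (n m : ℕ) (c : ℤ) (i : ℕ) : HFree (CagGen n m) := qexp (c • cagH0 n m i)

/-- The generator `a_i^ξ`, for `i ∈ [1; n+m]` (and `0` for other `i`). -/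
def caga (n m : ℕ) (ξ : ℤˣ) (i : ℕ) : HFree (CagGen n m) :=
  if hi : 1 ≤ i ∧ i ≤ n + m then HFree.gen (.a ξ ⟨i, hi⟩) else 0

/-- The supercommutator `⟦a_i^ξ, a_j^η⟧`. -/
def cagsbr (n m : ℕ) (ξ η : ℤˣ) (i j : ℕ) : HFree (CagGen n m) :=
  sbr 1 (theta n i) (theta n j) (caga n m ξ i) (caga n m η j)

/-- `1 + (-1) ^ θ_i δ_{ij}`. -/
def cagWt (n i j : ℕ) : ℤ := 1 + (-1) ^ theta n i * (if i = j then 1 else 0)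

/-- The defining relations of the deformed creation and annihilation generators. -/
inductive CagRel (n m : ℕ) : HFree (CagGen n m) → HFree (CagGen n m) → Prop
  | HH (i j : ℕ) (hi : 1 ≤ i ∧ i ≤ n + m) (hj : 1 ≤ j ∧ j ≤ n + m) :
      CagRel n m (br 1 (cagH n m i) (cagH n m j)) 0
  | Ha (ξ : ℤˣ) (i j : ℕ) (hi : 1 ≤ i ∧ i ≤ n + m) (hj : 1 ≤ j ∧ j ≤ n + m) :
      CagRel n m (br 1 (cagH n m i) (caga n m ξ j)) (-((ξ : ℤ) * cagWt n i j) • caga n m ξ j)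
  | aa (i : ℕ) (hi : 1 ≤ i ∧ i ≤ n + m) :
      CagRel n m (cagsbr n m (-1) 1 i i) (qnum (cagH0 n m i))
  | triple (ξ η : ℤˣ) (i j k : ℕ) (hi : 1 ≤ i ∧ i ≤ n + m) (hj : 1 ≤ j ∧ j ≤ n + m)
      (hk : 1 ≤ k ∧ k ≤ n + m) (hij : (j : ℤ) = (i : ℤ) + (ξ : ℤ)) :
      CagRel n m
        (sbr (qpow ((ξ : ℤ) * cagWt n i k)) (theta n i + theta n j) (theta n k)
          (cagsbr n m η (-η) i j) (caga n m η k))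
        (if k = j then
          ((η : ℤ) ^ theta n k) • (cagL n m (-((ξ : ℤ) * (η : ℤ))) k * caga n m η i) else 0)
  | a12 (ξ : ℤˣ) (hnm : 2 ≤ n + m) :
      CagRel n m (sbr (qpow 1) (theta n 1) (theta n 2) (caga n m ξ 1) (caga n m ξ 2)) 0
  | a11 (ξ : ℤˣ) (hnm : 1 ≤ n + m) : CagRel n m (cagsbr n m ξ ξ 1 1) 0

/-- The `h`-adically complete `ℂ[[h]]`-algebra presented by the generators `H_i, a_i^±`. -/
abbrev UqCag (n m : ℕ) : Type := HPresented (CagRel n m)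

end UqSl

end

/-! Both algebras are h-adically separated and complete, and algebra homomorphisms over ℂ[[h]] are
automatically continuous. A homomorphism from either of them to a complete algebra is therefore the
same as a family of elements satisfying the relations (`IsChev.exists_lift`, `IsCag.exists_lift`).

Existence of Φ. The elements H_i, a_i^± of U_q[sl(n+1|m)] have to satisfy the relations of U'
(`IsChev.isCag`). The core is a list of commutation rules between the root vectors a_i^- and the
e_j, f_j, derived from the Serre relations (`IsSerre.comm_rootN`, `IsHalfChev.rootN_mul_f`,
`IsHalfChev.f_mul_rootN`). The same rules in the opposite algebra, with q replaced by its inverse,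
serve a_i^+. They give ⟦a_i^-, a_i^+⟧ = [H_i] (`IsChev.N_mul_P_self`) and identify the brackets of
neighbouring a_l^±, a_{l+1}^∓ with e_{l+1} or f_{l+1} times a power of q^{H_l}; the triple relations
are then the commutation rules again. Solving these identities for e_{l+1} and f_{l+1} gives
surjectivity and the formulas for the inverse.

Injectivity. The Serre relations are not derived inside U'; a Poincaré–Birkhoff–Witt argument
replaces this. Modulo h, the relations of U' make the span of the vectors x_{i0} = a_i^+, x_{0j} =
a_j^-, x_{ij} = ⟦a_i^+, a_j^-⟧ closed under superbrackets, so ordered monomials in them span U'/hU'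
(`IsClassicalCag.exists_isPBW`).

On the other side, let Z be the space of linear relations between words in the x_{ij} that hold at h
= 0 in every representation of U_q[sl(n+1|m)] in a complete torsion-free algebra (`limitRelations`).
Tensoring with the vector representation shows that Z is stable under taking matrix entries of the
resulting coaction, and the trivial representation shows that 1 is not in Z. A suitable matrix entry
removes one chosen letter from a word, to leading order, so a relation between ordered monomials of
degree D yields one of degree D − 1 with coefficients multiplied by nonzero numbers. In degree 0
this contradicts 1 ∉ Z, so Z contains no nonzero combination of ordered monomials
(`eq_zero_of_mem_span_isPBW`).

If x in U' is killed by all these representations, its class modulo h is represented by such a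
combination in Z, hence x = hy. Torsion-freeness of the targets makes y killed as well, and
separatedness gives x = 0 (`eq_zero_of_forall_hom`). Injectivity of Φ and torsion-freeness of U'
both follow. A complete separated torsion-free module is topologically free: a basis modulo h lifts
(`isTopologicallyFree_of_torsionFree`). -/

set_option linter.unusedSimpArgs false

noncomputable section

namespace UqSl

/-! ### Complete algebras over `ℂ[[h]]` -/

/-- A `ℂ[[h]]`-algebra which is `h`-adically separated and complete. -/
class HComplete (B : Type*) [Ring B] [Algebra ℂ⟦X⟧ B] : Prop where
  eq_zero : ∀ x : B, (∀ k : ℕ, ∃ y : B, x = (PowerSeries.X ^ k : ℂ⟦X⟧) • y) → x = 0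
  exists_sum : ∀ f : ℕ → B, ∃ s : B, ∀ k : ℕ, ∃ y : B,
    s = ∑ i ∈ Finset.range k, (PowerSeries.X ^ i : ℂ⟦X⟧) • f i + (PowerSeries.X ^ k : ℂ⟦X⟧) • y

section HComplete

variable {B : Type*} [Ring B] [Algebra ℂ⟦X⟧ B] [HComplete B]

/-- By iteration `S i` is divisible by every power of h, so separatedness applies. In later uses `S`
is the defect of an identity, as a function of the power series involved; splitting off constant
terms shows that each defect is h times another one. -/
theorem eq_zero_of_forall_eq_X_smul {ι : Type*} (S : ι → B)
    (hS : ∀ i, ∃ j, S i = (PowerSeries.X : ℂ⟦X⟧) • S j) (i : ι) : S i = 0 := by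
  refine HComplete.eq_zero _ fun k => ?_
  suffices ∃ j, S i = (PowerSeries.X ^ k : ℂ⟦X⟧) • S j from let ⟨j, hj⟩ := this; ⟨_, hj⟩
  induction k with
  | zero => exact ⟨i, by simp⟩
  | succ k ih =>
    obtain ⟨j, hj⟩ := ih
    obtain ⟨l, hl⟩ := hS j
    exact ⟨l, by rw [hj, hl, smul_smul, pow_succ]⟩

/-- The `h`-adically convergent sum `∑ₖ hᵏ f k`. -/
def hsum (f : ℕ → B) : B := (HComplete.exists_sum f).choose

theorem hsum_spec (f : ℕ → B) (k : ℕ) : ∃ y : B, hsum f =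
    ∑ i ∈ Finset.range k, (PowerSeries.X ^ i : ℂ⟦X⟧) • f i + (PowerSeries.X ^ k : ℂ⟦X⟧) • y :=
  (HComplete.exists_sum f).choose_spec k

theorem hsum_unique {f : ℕ → B} {s : B} (hs : ∀ k : ℕ, ∃ y : B, s =
    ∑ i ∈ Finset.range k, (PowerSeries.X ^ i : ℂ⟦X⟧) • f i + (PowerSeries.X ^ k : ℂ⟦X⟧) • y) :
    s = hsum f := by
  rw [← sub_eq_zero]
  refine HComplete.eq_zero _ fun k => ?_
  obtain ⟨y, hy⟩ := hs k
  obtain ⟨z, hz⟩ := hsum_spec f k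
  exact ⟨y - z, by rw [hy, hz, smul_sub]; abel⟩

theorem hsum_succ (f : ℕ → B) :
    hsum f = f 0 + (PowerSeries.X : ℂ⟦X⟧) • hsum fun k => f (k + 1) := by
  refine (hsum_unique fun k => ?_).symm
  cases k with
  | zero => exact ⟨_, by rw [Finset.range_zero, Finset.sum_empty, pow_zero, one_smul, zero_add]⟩
  | succ k =>
    obtain ⟨y, hy⟩ := hsum_spec (fun k => f (k + 1)) k
    refine ⟨y, ?_⟩
    rw [hy, Finset.sum_range_succ', smul_add, Finset.smul_sum, pow_zero, one_smul]
    simp only [smul_smul, ← pow_succ']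
    abel

/-- Linearity over ℂ[[h]] sends remainders divisible by h^k to such remainders. This is the
automatic continuity of algebra homomorphisms. -/
theorem map_hsum {B' : Type*} [Ring B'] [Algebra ℂ⟦X⟧ B'] [HComplete B'] (Φ : B →ₐ[ℂ⟦X⟧] B')
    (f : ℕ → B) : Φ (hsum f) = hsum fun k => Φ (f k) := by
  refine hsum_unique fun k => ?_
  obtain ⟨y, hy⟩ := hsum_spec f k
  exact ⟨Φ y, by rw [hy]; simp only [map_add, map_sum, map_smul]⟩

variable {A : Type} [Ring A]

/-- The value at `h` of a power series, whose coefficients are mapped to `B` by `ψ`. -/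
def ext (ψ : A →+* B) (f : A⟦X⟧) : B := hsum fun k => ψ (PowerSeries.coeff k f)

theorem ext_eq (ψ : A →+* B) (f : A⟦X⟧) :
    ext ψ f = ψ (PowerSeries.coeff 0 f) + (PowerSeries.X : ℂ⟦X⟧) • ext ψ (divh f) := by
  rw [ext, hsum_succ, ext]
  simp only [divh, PowerSeries.coeff_mk]

theorem ext_of_coeff_zero (ψ : A →+* B) {f : A⟦X⟧} (hf : ∀ k, PowerSeries.coeff (k + 1) f = 0) :
    ext ψ f = ψ (PowerSeries.coeff 0 f) := by
  rw [ext, hsum_succ]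
  simp only [hf, map_zero]
  have : hsum (fun _ : ℕ => (0 : B)) = 0 :=
    (hsum_unique fun k => ⟨0, by simp⟩).symm
  rw [this, smul_zero, add_zero]

theorem ext_C (ψ : A →+* B) (a : A) : ext ψ (PowerSeries.C a) = ψ a := by
  rw [ext_of_coeff_zero]
  · simp
  · intro k
    rw [PowerSeries.coeff_C, if_neg (Nat.succ_ne_zero k)]

theorem ext_add (ψ : A →+* B) (f g : A⟦X⟧) : ext ψ (f + g) = ext ψ f + ext ψ g := by
  rw [← sub_eq_zero]
  refine eq_zero_of_forall_eq_X_smul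
    (fun p : A⟦X⟧ × A⟦X⟧ => ext ψ (p.1 + p.2) - (ext ψ p.1 + ext ψ p.2))
    (fun p => ⟨(divh p.1, divh p.2), ?_⟩) (f, g)
  have : divh (p.1 + p.2) = divh p.1 + divh p.2 := by ext; simp [divh]
  rw [ext_eq ψ (p.1 + p.2), ext_eq ψ p.1, ext_eq ψ p.2, this, map_add, map_add, smul_sub, smul_add]
  abel

theorem eq_C_add_X_mul (f : A⟦X⟧) :
    f = PowerSeries.C (PowerSeries.coeff 0 f) + PowerSeries.X * divh f := by
  ext k
  cases k with
  | zero => simp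
  | succ k => simp [divh, PowerSeries.coeff_succ_X_mul]

/-- The series f is its constant term plus h times `divh f`; dividing the product by h, up to its
constant term, follows this splitting. It is the recursion behind `ext_mul`. -/
theorem divh_mul (f g : A⟦X⟧) :
    divh (f * g) = PowerSeries.C (PowerSeries.coeff 0 f) * divh g + divh f * g := by
  ext k
  conv_lhs => rw [divh, PowerSeries.coeff_mk, eq_C_add_X_mul f, add_mul, map_add, mul_assoc,
    PowerSeries.coeff_succ_X_mul, PowerSeries.coeff_C_mul]
  simp [divh, PowerSeries.coeff_C_mul]

theorem ext_C_mul (ψ : A →+* B) (a : A) (g : A⟦X⟧) :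
    ext ψ (PowerSeries.C a * g) = ψ a * ext ψ g := by
  rw [← sub_eq_zero]
  refine eq_zero_of_forall_eq_X_smul
    (fun g : A⟦X⟧ => ext ψ (PowerSeries.C a * g) - ψ a * ext ψ g) (fun g => ⟨divh g, ?_⟩) g
  have : divh (PowerSeries.C a * g) = PowerSeries.C a * divh g := by ext; simp [divh]
  rw [ext_eq ψ (PowerSeries.C a * g), ext_eq ψ g, this, PowerSeries.coeff_C_mul, map_mul, smul_sub,
    mul_add, mul_smul_comm]
  abel

theorem ext_mul (ψ : A →+* B) (f g : A⟦X⟧) : ext ψ (f * g) = ext ψ f * ext ψ g := by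
  rw [← sub_eq_zero]
  refine eq_zero_of_forall_eq_X_smul
    (fun f : A⟦X⟧ => ext ψ (f * g) - ext ψ f * ext ψ g) (fun f => ⟨divh f, ?_⟩) f
  have h0 : PowerSeries.coeff 0 (f * g) = PowerSeries.coeff 0 f * PowerSeries.coeff 0 g := by
    simp [PowerSeries.coeff_mul]
  rw [ext_eq ψ (f * g), divh_mul, h0, ext_add, ext_C_mul, map_mul, ext_eq ψ f, smul_sub, smul_add,
    add_mul, smul_mul_assoc, sub_add_eq_sub_sub, ← add_assoc, ← mul_smul_comm, ← mul_add, ← ext_eq]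
  abel

/-- `ext` as a ring homomorphism. -/
def extHom (ψ : A →+* B) : A⟦X⟧ →+* B where
  toFun := ext ψ
  map_one' := by rw [← map_one PowerSeries.C, ext_C, map_one]
  map_mul' := ext_mul ψ
  map_zero' := by rw [← map_zero PowerSeries.C, ext_C, map_zero]
  map_add' := ext_add ψ

theorem extHom_apply (ψ : A →+* B) (f : A⟦X⟧) : extHom ψ f = ext ψ f := rfl

theorem ext_scalar [Algebra ℂ A] (ψ : A →+* B)
    (hψ : ∀ c : ℂ, ψ (algebraMap ℂ A c) = algebraMap ℂ⟦X⟧ B (PowerSeries.C c)) (c : ℂ⟦X⟧) :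
    ext ψ (PowerSeries.map (algebraMap ℂ A) c) = algebraMap ℂ⟦X⟧ B c := by
  rw [← sub_eq_zero]
  refine eq_zero_of_forall_eq_X_smul
    (fun c : ℂ⟦X⟧ => ext ψ (PowerSeries.map (algebraMap ℂ A) c) - algebraMap ℂ⟦X⟧ B c)
    (fun c => ⟨divh c, ?_⟩) c
  have : divh (PowerSeries.map (algebraMap ℂ A) c) = PowerSeries.map (algebraMap ℂ A) (divh c) := by
    ext; simp [divh]
  conv_lhs => rw [ext_eq, this, PowerSeries.coeff_map, hψ]
  conv_lhs =>
    arg 2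
    rw [eq_C_add_X_mul c, map_add, map_mul, ← Algebra.smul_def]
  rw [smul_sub]
  abel

end HComplete

/-! ### The completed free algebra and its quotients -/

namespace HFree

variable {G : Type}

/-- `HFree G` is the ring of formal power series over the free algebra. -/
def ser : HFree G ≃+* (FreeAlgebra ℂ G)⟦X⟧ := RingEquiv.refl _

theorem ser_algebraMap (c : ℂ⟦X⟧) :
    ser (algebraMap ℂ⟦X⟧ (HFree G) c) = PowerSeries.map (algebraMap ℂ (FreeAlgebra ℂ G)) c := rfl

theorem ser_const (x : FreeAlgebra ℂ G) : ser (const x) = PowerSeries.C x := rfl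

theorem ser_smul (c : ℂ⟦X⟧) (x : HFree G) :
    ser (c • x) = PowerSeries.map (algebraMap ℂ (FreeAlgebra ℂ G)) c * ser x := by
  rw [Algebra.smul_def, map_mul, ser_algebraMap]

theorem ser_X_smul (x : HFree G) :
    ser ((PowerSeries.X : ℂ⟦X⟧) • x) = PowerSeries.X * ser x := by
  rw [ser_smul, PowerSeries.map_X]

theorem ser_X_pow_smul (k : ℕ) (x : HFree G) :
    ser ((PowerSeries.X ^ k : ℂ⟦X⟧) • x) = PowerSeries.X ^ k * ser x := by
  rw [ser_smul, map_pow, PowerSeries.map_X]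

instance : HComplete (HFree G) where
  eq_zero x hx := by
    refine ser.injective (PowerSeries.ext fun k => ?_)
    obtain ⟨y, hy⟩ := hx (k + 1)
    rw [hy, ser_X_pow_smul, PowerSeries.coeff_X_pow_mul', if_neg (by omega), map_zero, map_zero]
  exists_sum f := by
    -- `S n` is the tail sum of hⁱ f(n + i), computed coefficientwise. Keeping all tails makes the
    -- remainder after k terms explicit: it is h^k times `S k`.
    let S : ℕ → HFree G := fun n => ser.symm <|
      PowerSeries.mk fun k => ∑ i ∈ Finset.range (k + 1), PowerSeries.coeff (k - i) (ser (f (n + i)))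
    have hS : ∀ n, S n = f n + (PowerSeries.X : ℂ⟦X⟧) • S (n + 1) := by
      intro n
      refine ser.injective (PowerSeries.ext fun k => ?_)
      rw [map_add, map_add, ser_X_smul, RingEquiv.apply_symm_apply, RingEquiv.apply_symm_apply]
      cases k with
      | zero => simp
      | succ k =>
        rw [PowerSeries.coeff_succ_X_mul]
        simp only [PowerSeries.coeff_mk]
        rw [Finset.sum_range_succ', add_comm]
        simp [Nat.add_assoc, Nat.add_comm 1]
    refine ⟨S 0, fun k => ⟨S k, ?_⟩⟩
    induction k with
    | zero => rw [pow_zero, one_smul, Finset.range_zero, Finset.sum_empty, zero_add]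
    | succ k ih =>
      rw [ih, hS k, Finset.sum_range_succ, smul_add, smul_smul, ← pow_succ, add_assoc]

/-- `const` as a ring homomorphism. -/
def constHom : FreeAlgebra ℂ G →+* HFree G := PowerSeries.C (R := FreeAlgebra ℂ G)

theorem constHom_apply (x : FreeAlgebra ℂ G) : constHom x = const x := rfl

theorem const_algebraMap (c : ℂ) :
    (const (algebraMap ℂ (FreeAlgebra ℂ G) c) : HFree G)
      = algebraMap ℂ⟦X⟧ (HFree G) (PowerSeries.C c) :=
  (PowerSeries.map_C _ _).symm

/-- Elements of `HFree G` decompose into the constant term and a multiple of `h`. -/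
theorem eq_const_add (x : HFree G) :
    x = const (PowerSeries.coeff 0 (ser x))
      + (PowerSeries.X : ℂ⟦X⟧) • ser.symm (divh (ser x)) := by
  apply ser.injective
  rw [map_add, ser_X_smul, ser_const, RingEquiv.apply_symm_apply]
  exact eq_C_add_X_mul (ser x)

theorem eq_hsum (x : HFree G) :
    x = hsum fun k => const (PowerSeries.coeff k (ser x)) := by
  have : ∀ x : HFree G, x - ext constHom (ser x) = 0 := by
    refine eq_zero_of_forall_eq_X_smul _ (fun x => ⟨ser.symm (divh (ser x)), ?_⟩)
    conv_lhs => rw [ext_eq, constHom_apply]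
    conv_lhs =>
      arg 1
      rw [eq_const_add x]
    rw [smul_sub, RingEquiv.apply_symm_apply]
    abel
  exact sub_eq_zero.1 (this x)

variable {B : Type*} [Ring B] [Algebra ℂ⟦X⟧ B]

/-- Phrased with a ring homomorphism, so that the ℂ-algebra structure on B restricted from ℂ[[h]]
stays local to the proof. -/
theorem exists_freeAlgebra_ringHom (g : G → B) : ∃ ψ : FreeAlgebra ℂ G →+* B,
    (∀ x, ψ (FreeAlgebra.ι ℂ x) = g x) ∧
    ∀ c : ℂ, ψ (algebraMap ℂ _ c) = algebraMap ℂ⟦X⟧ B (PowerSeries.C c) := by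
  let _ : Algebra ℂ B := Algebra.compHom B (PowerSeries.C : ℂ →+* ℂ⟦X⟧)
  exact ⟨(FreeAlgebra.lift ℂ g).toRingHom, fun x => FreeAlgebra.lift_ι_apply g x,
    fun c => (FreeAlgebra.lift ℂ g).commutes c⟩

variable [HComplete B]

theorem exists_lift (g : G → B) : ∃ Φ : HFree G →ₐ[ℂ⟦X⟧] B, ∀ x, Φ (gen x) = g x := by
  obtain ⟨ψ, h1, h2⟩ := exists_freeAlgebra_ringHom g
  have hc : ∀ c : ℂ⟦X⟧, (extHom ψ).comp (ser : HFree G ≃+* _).toRingHom (algebraMap ℂ⟦X⟧ _ c)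
      = algebraMap ℂ⟦X⟧ B c := by
    intro c
    rw [RingHom.comp_apply, extHom_apply]
    exact ext_scalar ψ h2 c
  refine ⟨⟨(extHom ψ).comp (ser : HFree G ≃+* _).toRingHom, hc⟩, fun x => ?_⟩
  exact (ext_C ψ (FreeAlgebra.ι ℂ x)).trans (h1 x)

/-- Every element is the convergent sum of its constant coefficients, and homomorphisms commute with
such sums; no continuity hypothesis is needed. -/
theorem hom_ext {Φ Φ' : HFree G →ₐ[ℂ⟦X⟧] B} (h : ∀ x, Φ (gen x) = Φ' (gen x)) : Φ = Φ' := by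
  have hc : ∀ x, Φ (const x) = Φ' (const x) := by
    intro x
    induction x using FreeAlgebra.induction with
    | grade0 c => rw [const_algebraMap, AlgHom.commutes, AlgHom.commutes]
    | grade1 x => exact h x
    | mul a b ha hb =>
      rw [← constHom_apply, map_mul, map_mul, map_mul, constHom_apply, constHom_apply, ha, hb]
    | add a b ha hb =>
      rw [← constHom_apply, map_add, map_add, map_add, constHom_apply, constHom_apply, ha, hb]
  refine AlgHom.ext fun x => ?_
  conv_lhs => rw [eq_hsum x]
  conv_rhs => rw [eq_hsum x]
  rw [map_hsum, map_hsum]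
  simp only [hc]

end HFree

/-! ### Completeness and universal property of topological presentations. -/

section HPresented

variable {G : Type} {R : HFree G → HFree G → Prop}

theorem cls_eq_iff (x y : HFree G) : cls R x = cls R y ↔ x - y ∈ closedIdeal R :=
  ((closedIdeal R).ringCon.eq).trans (TwoSidedIdeal.rel_iff _ _ _)

theorem cls_surjective : Function.Surjective (cls R) := RingCon.mkₐ_surjective (closedIdeal R).ringCon

theorem mem_closedIdeal (x : HFree G) : x ∈ closedIdeal R ↔ ∀ k, x ∈ idealMod R k :=
  TwoSidedIdeal.mem_iInf _

theorem X_pow_smul_mem_idealMod (k : ℕ) (x : HFree G) :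
    (PowerSeries.X ^ k : ℂ⟦X⟧) • x ∈ idealMod R k := by
  rw [Algebra.smul_def]
  exact (idealMod R k).mul_mem_right _ _ (TwoSidedIdeal.subset_span (Or.inr rfl))

theorem cls_rel {a b : HFree G} (h : R a b) : cls R a = cls R b := by
  rw [cls_eq_iff, mem_closedIdeal]
  exact fun k => TwoSidedIdeal.subset_span (Or.inl ⟨a, b, h, rfl⟩)

/-- Separatedness is the reason for dividing by the closure of the ideal: a class divisible by every
h^k is represented by an element of I + h^k F for all k. Convergent sums are lifted to the completed
free algebra. -/
instance : HComplete (HPresented R) where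
  eq_zero x hx := by
    obtain ⟨u, rfl⟩ := cls_surjective x
    rw [← map_zero (cls R), cls_eq_iff, sub_zero, mem_closedIdeal]
    intro k
    obtain ⟨y, hy⟩ := hx k
    obtain ⟨v, rfl⟩ := cls_surjective y
    rw [← map_smul, cls_eq_iff, mem_closedIdeal] at hy
    simpa using (idealMod R k).add_mem (hy k) (X_pow_smul_mem_idealMod k v)
  exists_sum f := by
    choose g hg using fun k => cls_surjective (R := R) (f k)
    refine ⟨cls R (hsum g), fun k => ?_⟩
    obtain ⟨y, hy⟩ := hsum_spec g k
    exact ⟨cls R y, by rw [hy]; simp only [map_add, map_sum, map_smul, hg]⟩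

variable {B : Type*} [Ring B] [Algebra ℂ⟦X⟧ B] [HComplete B]

/-- An element of I + h^k F is sent to a multiple of h^k, for each k; separatedness of B finishes.
So closing the ideal costs nothing in the universal property. -/
theorem map_closedIdeal (Φ : HFree G →ₐ[ℂ⟦X⟧] B) (hΦ : ∀ a b, R a b → Φ a = Φ b)
    {x : HFree G} (hx : x ∈ closedIdeal R) : Φ x = 0 := by
  refine HComplete.eq_zero _ fun k => ?_
  have h := (mem_closedIdeal x).1 hx k
  refine TwoSidedIdeal.span_induction (p := fun x _ => ∃ y, Φ x = (PowerSeries.X ^ k : ℂ⟦X⟧) • y)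
    ?_ ?_ ?_ ?_ ?_ ?_ h
  · rintro x (⟨a, b, hab, rfl⟩ | hx)
    · exact ⟨0, by rw [map_sub, hΦ a b hab, sub_self, smul_zero]⟩
    · rw [Set.mem_singleton_iff.1 hx]
      exact ⟨1, by rw [AlgHom.commutes, Algebra.algebraMap_eq_smul_one]⟩
  · exact ⟨0, by simp⟩
  · rintro x y - - ⟨u, hu⟩ ⟨v, hv⟩
    exact ⟨u + v, by rw [map_add, hu, hv, smul_add]⟩
  · rintro x - ⟨u, hu⟩
    exact ⟨-u, by rw [map_neg, hu, smul_neg]⟩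
  · rintro a x - ⟨u, hu⟩
    exact ⟨Φ a * u, by rw [map_mul, hu, mul_smul_comm]⟩
  · rintro a x - ⟨u, hu⟩
    exact ⟨u * Φ a, by rw [map_mul, hu, smul_mul_assoc]⟩

theorem HPresented.exists_lift (Φ : HFree G →ₐ[ℂ⟦X⟧] B) (hΦ : ∀ a b, R a b → Φ a = Φ b) :
    ∃ Φ' : HPresented R →ₐ[ℂ⟦X⟧] B, ∀ x, Φ' (cls R x) = Φ x := by
  have H : (closedIdeal R).ringCon ≤ RingCon.ker (Φ : HFree G →+* B) := by
    intro x y hxy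
    have := map_closedIdeal Φ hΦ ((TwoSidedIdeal.rel_iff _ _ _).1 hxy)
    rw [map_sub, sub_eq_zero] at this
    exact this
  exact ⟨{ (closedIdeal R).ringCon.lift (Φ : HFree G →+* B) H with
    commutes' := fun c => Φ.commutes c }, fun x => rfl⟩

end HPresented

end UqSl
end

noncomputable section

namespace UqSl

/-! ### `q`-exponentials and `q`-numbers in complete algebras -/

section QFunctions

variable {B : Type} [Ring B] [Algebra ℂ⟦X⟧ B]

/-- The power series `∑ₖ xᵏ tᵏ / k!`. -/
def qs (x : B) : B⟦X⟧ :=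
  PowerSeries.mk fun k => (PowerSeries.C ((k ! : ℂ)⁻¹) : ℂ⟦X⟧) • x ^ k

theorem coeff_qs (x : B) (k : ℕ) :
    PowerSeries.coeff k (qs x) = (PowerSeries.C ((k ! : ℂ)⁻¹) : ℂ⟦X⟧) • x ^ k :=
  PowerSeries.coeff_mk _ _

theorem qs_add {x y : B} (h : Commute x y) : qs (x + y) = qs x * qs y := by
  ext k
  rw [coeff_qs, PowerSeries.coeff_mul, h.add_pow', Finset.smul_sum]
  refine Finset.sum_congr rfl fun p hp => ?_
  rw [coeff_qs, coeff_qs, smul_mul_smul_comm, ← map_mul, ← Nat.cast_smul_eq_nsmul ℂ⟦X⟧, smul_smul]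
  congr 1
  have hk := Finset.HasAntidiagonal.mem_antidiagonal.1 hp
  have h1 : ((k.choose p.1 : ℕ) : ℂ⟦X⟧) = PowerSeries.C ((k.choose p.1 : ℕ) : ℂ) := by simp
  rw [h1, ← map_mul, ← hk, Nat.cast_add_choose]
  congr 1
  have ha : ((p.1 + p.2)! : ℂ) ≠ 0 := Nat.cast_ne_zero.2 (Nat.factorial_ne_zero _)
  have hb : ((p.1)! : ℂ) ≠ 0 := Nat.cast_ne_zero.2 (Nat.factorial_ne_zero _)
  have hc : ((p.2)! : ℂ) ≠ 0 := Nat.cast_ne_zero.2 (Nat.factorial_ne_zero _)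
  field_simp

theorem qs_zero : qs (0 : B) = 1 := by
  ext k
  rw [coeff_qs, PowerSeries.coeff_one]
  split_ifs with h
  · simp [h]
  · simp [h]

/-- The hypothesis gives x^k y = y z^k for all k. With z = x + a it moves q^x past an element y of
weight a. -/
theorem qs_mul_C {x y z : B} (h : x * y = y * z) :
    qs x * PowerSeries.C y = PowerSeries.C y * qs z := by
  have hk : ∀ k : ℕ, x ^ k * y = y * z ^ k := by
    intro k
    induction k with
    | zero => simp
    | succ k ih => rw [pow_succ, mul_assoc, h, ← mul_assoc, ih, mul_assoc, pow_succ]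
  ext k
  rw [PowerSeries.coeff_mul_C, PowerSeries.coeff_C_mul, coeff_qs, coeff_qs, smul_mul_assoc, hk,
    mul_smul_comm]

theorem X_mul_divh_qs (x : B) : PowerSeries.X * divh (qs x - qs (-x)) = qs x - qs (-x) :=
  X_mul_divh _ (by rw [map_sub, coeff_qs, coeff_qs]; simp)

theorem X_mul_injective {A : Type} [Ring A] {f g : A⟦X⟧} (h : PowerSeries.X * f = PowerSeries.X * g) : f = g := by
  ext k
  rw [← PowerSeries.coeff_succ_X_mul, h, PowerSeries.coeff_succ_X_mul]

/-- After clearing the division: q^{x+y} − q^{−x−y} = (q^x − q^{−x}) q^y + q^{−x} (q^y − q^{−y}). -/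
theorem divh_qs_add {x y : B} (h : Commute x y) :
    divh (qs (x + y) - qs (-(x + y)))
      = divh (qs x - qs (-x)) * qs y + qs (-x) * divh (qs y - qs (-y)) := by
  apply X_mul_injective
  rw [X_mul_divh_qs, mul_add, ← mul_assoc, X_mul_divh_qs, ← mul_assoc,
    (PowerSeries.commute_X (qs (-x))).symm.eq, mul_assoc, X_mul_divh_qs, neg_add, qs_add h,
    qs_add h.neg_left.neg_right]
  noncomm_ring

theorem divh_qs_mul_C {x y z : B} (h : x * y = y * z) :
    divh (qs x - qs (-x)) * PowerSeries.C y = PowerSeries.C y * divh (qs z - qs (-z)) := by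
  apply X_mul_injective
  rw [← mul_assoc, X_mul_divh_qs, ← mul_assoc, (PowerSeries.commute_X (PowerSeries.C y)).symm.eq,
    mul_assoc, X_mul_divh_qs, sub_mul, mul_sub, qs_mul_C h,
    qs_mul_C (show -x * y = y * -z by rw [neg_mul, h, mul_neg])]

theorem constantCoeff_divh_ne_zero :
    PowerSeries.constantCoeff (divh (qpow 1 - qpow (-1))) ≠ 0 := by
  rw [← PowerSeries.coeff_zero_eq_constantCoeff_apply, divh, PowerSeries.coeff_mk]
  simp [qpow]

variable [HComplete B]

/-- `q ^ x = ∑ₖ hᵏ xᵏ / k!`. -/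
def qE (x : B) : B := ext (RingHom.id B) (qs x)

/-- The `q`-number `(q ^ x - q ^ (-x)) / (q - q⁻¹)`. -/
def qN (x : B) : B :=
  ((divh (qpow 1 - qpow (-1)))⁻¹ : ℂ⟦X⟧) • ext (RingHom.id B) (divh (qs x - qs (-x)))

theorem qE_zero : qE (0 : B) = 1 := by
  rw [qE, qs_zero, ← map_one PowerSeries.C, ext_C, map_one]

theorem qE_add {x y : B} (h : Commute x y) : qE (x + y) = qE x * qE y := by
  rw [qE, qs_add h, ext_mul, qE, qE]

theorem qE_mul {x y z : B} (h : x * y = y * z) : qE x * y = y * qE z := by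
  have := congrArg (ext (RingHom.id B)) (qs_mul_C h)
  rwa [ext_mul, ext_mul, ext_C] at this

theorem qE_neg_mul_self (x : B) : qE (-x) * qE x = 1 := by
  rw [← qE_add (Commute.neg_left (Commute.refl x)), neg_add_cancel, qE_zero]

theorem qE_mul_neg_self (x : B) : qE x * qE (-x) = 1 := by
  rw [← qE_add (Commute.neg_right (Commute.refl x)), add_neg_cancel, qE_zero]

theorem qE_intCast (a : ℤ) : qE (a : B) = algebraMap ℂ⟦X⟧ B (qpow a) := by
  let _ : Algebra ℂ B := Algebra.compHom B (PowerSeries.C : ℂ →+* ℂ⟦X⟧)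
  have hc : ∀ c : ℂ, algebraMap ℂ B c = algebraMap ℂ⟦X⟧ B (PowerSeries.C c) := fun _ => rfl
  rw [← ext_scalar (RingHom.id B) hc, qE]
  congr 1
  ext k
  rw [coeff_qs, PowerSeries.coeff_map, qpow, PowerSeries.coeff_mk, hc, div_eq_inv_mul, map_mul,
    map_mul, ← Algebra.smul_def, map_pow, map_pow, map_intCast, map_intCast]

theorem qN_add {x y : B} (h : Commute x y) : qN (x + y) = qN x * qE y + qE (-x) * qN y := by
  rw [qN, divh_qs_add h, ext_add, ext_mul, ext_mul, qN, qN, qE, qE, smul_add, smul_mul_assoc,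
    mul_smul_comm]

theorem qN_mul {x y z : B} (h : x * y = y * z) : qN x * y = y * qN z := by
  have := congrArg (ext (RingHom.id B)) (divh_qs_mul_C h)
  rw [ext_mul, ext_mul, ext_C, RingHom.id_apply] at this
  rw [qN, qN, smul_mul_assoc, this, mul_smul_comm]

/-- All odd powers of x equal x and the even powers cancel, so q^x − q^{−x} = (q − q⁻¹) x. This
applies to operators with eigenvalues 0, 1, −1, and is why the vector representation needs no
deformation. -/
theorem qN_of_cube {x : B} (h : x ^ 3 = x) : qN x = x := by
  let _ : Algebra ℂ B := Algebra.compHom B (PowerSeries.C : ℂ →+* ℂ⟦X⟧)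
  have hc : ∀ c : ℂ, algebraMap ℂ B c = algebraMap ℂ⟦X⟧ B (PowerSeries.C c) := fun _ => rfl
  have hodd : ∀ k : ℕ, x ^ (2 * k + 1) = x := by
    intro k
    induction k with
    | zero => simp
    | succ k ih =>
      rw [show 2 * (k + 1) + 1 = (2 * k + 1) + 2 by ring, pow_add, ih, ← pow_succ', h]
  have key : divh (qs x - qs (-x))
      = PowerSeries.map (algebraMap ℂ B) (divh (qpow 1 - qpow (-1))) * PowerSeries.C x := by
    ext k
    rw [PowerSeries.coeff_mul_C, PowerSeries.coeff_map, divh, divh, PowerSeries.coeff_mk,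
      PowerSeries.coeff_mk, map_sub, map_sub, coeff_qs, coeff_qs, hc, ← Algebra.smul_def,
      qpow, qpow, PowerSeries.coeff_mk, PowerSeries.coeff_mk]
    rcases Nat.even_or_odd' (k + 1) with ⟨l, hl | hl⟩
    · rw [hl, neg_pow x, pow_mul (-1 : B)]
      simp
    · rw [hl, neg_pow x, hodd, pow_succ, pow_mul, pow_succ (((-1 : ℤ) : ℂ)), pow_mul]
      simp only [even_two, Even.neg_pow, one_pow, one_mul, neg_mul, smul_neg, sub_neg_eq_add,
        Int.cast_one, Int.cast_neg]
      rw [← add_smul, ← map_add]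
      congr 2
      ring
  rw [qN, key, ext_mul, ext_scalar (RingHom.id B) hc, ext_C, RingHom.id_apply, ← Algebra.smul_def,
    smul_smul, PowerSeries.inv_mul_cancel _ constantCoeff_divh_ne_zero, one_smul]

theorem qN_one : qN (1 : B) = 1 := qN_of_cube (by simp)

theorem qN_zero : qN (0 : B) = 0 := qN_of_cube (by simp)

theorem qN_neg (x : B) : qN (-x) = -qN x := by
  have : divh (qs (-x) - qs (- -x)) = -divh (qs x - qs (-x)) := by ext; simp [divh]
  rw [qN, this, ← extHom_apply, map_neg, extHom_apply, smul_neg, qN]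

/-- `[x] = q⁻¹ [x - 1] + q ^ (x - 1)`. -/
theorem qN_sub_one (x : B) : qN x - qpow (-1) • qN (x - 1) = qE (x - 1) := by
  have h3 := qE_intCast (B := B) (-1)
  push_cast at h3
  have h2 := qN_add (x := (1 : B)) (y := x - 1) (by simp)
  rw [add_sub_cancel, h3, ← Algebra.smul_def, qN_one, one_mul] at h2
  rw [h2]
  abel

/-- `[x] = q [x - 1] + q ^ (1 - x)`. -/
theorem qN_sub_one' (x : B) : qN x - qpow 1 • qN (x - 1) = qE (1 - x) := by
  have h1 := qN_add (x := x - 1) (y := (1 : B)) (by simp)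
  have h3 := qE_intCast (B := B) 1
  push_cast at h3
  rw [sub_add_cancel, h3, ← Algebra.commutes, ← Algebra.smul_def, qN_one, mul_one, neg_sub] at h1
  rw [h1]
  abel

theorem map_qE {B' : Type} [Ring B'] [Algebra ℂ⟦X⟧ B'] [HComplete B'] (Φ : B →ₐ[ℂ⟦X⟧] B')
    (x : B) : Φ (qE x) = qE (Φ x) := by
  rw [qE, ext, map_hsum, qE, ext]
  congr 1
  ext k
  simp [coeff_qs]

theorem map_qN {B' : Type} [Ring B'] [Algebra ℂ⟦X⟧ B'] [HComplete B'] (Φ : B →ₐ[ℂ⟦X⟧] B')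
    (x : B) : Φ (qN x) = qN (Φ x) := by
  rw [qN, ext, map_smul, map_hsum, qN, ext]
  congr 2
  ext k
  simp [coeff_qs, divh]

end QFunctions

section

variable {G : Type}

theorem coeff_ser_qexp (x : FreeAlgebra ℂ G) (k : ℕ) :
    PowerSeries.coeff k (HFree.ser (qexp x)) = ((k ! : ℂ)⁻¹) • x ^ k := by
  rw [show HFree.ser (qexp x) = PowerSeries.mk fun k => ((k ! : ℂ)⁻¹) • x ^ k from rfl,
    PowerSeries.coeff_mk]

theorem const_smul (c : ℂ) (x : FreeAlgebra ℂ G) :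
    HFree.const (c • x) = (PowerSeries.C c : ℂ⟦X⟧) • HFree.const x := by
  rw [← HFree.constHom_apply, Algebra.smul_def, map_mul, HFree.constHom_apply,
    HFree.const_algebraMap, ← Algebra.smul_def, HFree.constHom_apply]

theorem const_coeff_qexp (x : FreeAlgebra ℂ G) (k : ℕ) :
    HFree.const (PowerSeries.coeff k (HFree.ser (qexp x)))
      = PowerSeries.coeff k (qs (HFree.const x)) := by
  rw [coeff_ser_qexp, coeff_qs, const_smul, ← HFree.constHom_apply, map_pow, HFree.constHom_apply]

theorem qexp_eq_qE (x : FreeAlgebra ℂ G) : qexp x = qE (HFree.const x) := by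
  conv_lhs => rw [HFree.eq_hsum (qexp x)]
  rw [qE, ext]
  simp only [const_coeff_qexp, RingHom.id_apply]

theorem qnum_eq_qN (x : FreeAlgebra ℂ G) : qnum x = qN (HFree.const x) := by
  have h : ∀ k, PowerSeries.coeff k (HFree.ser (HFree.ser.symm
      (divh (HFree.ser (qexp x) - HFree.ser (qexp (-x))))))
      = PowerSeries.coeff (k + 1) (HFree.ser (qexp x))
        - PowerSeries.coeff (k + 1) (HFree.ser (qexp (-x))) := by
    intro k
    rw [RingEquiv.apply_symm_apply, divh, PowerSeries.coeff_mk, map_sub]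
  refine (show qnum x = ((divh (qpow 1 - qpow (-1)))⁻¹ : ℂ⟦X⟧) • HFree.ser.symm
      (divh (HFree.ser (qexp x) - HFree.ser (qexp (-x)))) from rfl).trans ?_
  rw [qN]
  congr 1
  rw [HFree.eq_hsum (HFree.ser.symm _), ext]
  congr 1
  ext1 k
  rw [h, ← HFree.constHom_apply, map_sub, HFree.constHom_apply, HFree.constHom_apply,
    const_coeff_qexp, const_coeff_qexp, divh, PowerSeries.coeff_mk, map_sub, RingHom.id_apply]
  congr 4
  exact map_neg HFree.constHom x

theorem cls_qnum (R : HFree G → HFree G → Prop) (x : FreeAlgebra ℂ G) :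
    cls R (qnum x) = qN (cls R (HFree.const x)) := by
  rw [qnum_eq_qN, map_qN]

end

theorem qpow_add (a b : ℤ) : qpow (a + b) = qpow a * qpow b := by
  ext k
  simp only [qpow, PowerSeries.coeff_mul, PowerSeries.coeff_mk]
  push_cast
  rw [(Commute.all (a : ℂ) b).add_pow', Finset.sum_div]
  refine Finset.sum_congr rfl fun p hp => ?_
  have hk := Finset.HasAntidiagonal.mem_antidiagonal.1 hp
  rw [← hk, nsmul_eq_mul, Nat.cast_add_choose]
  have ha : ((p.1 + p.2)! : ℂ) ≠ 0 := Nat.cast_ne_zero.2 (Nat.factorial_ne_zero _)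
  have hb : ((p.1)! : ℂ) ≠ 0 := Nat.cast_ne_zero.2 (Nat.factorial_ne_zero _)
  have hc : ((p.2)! : ℂ) ≠ 0 := Nat.cast_ne_zero.2 (Nat.factorial_ne_zero _)
  field_simp

theorem qpow_zero : qpow 0 = 1 := by
  ext k
  rw [qpow, PowerSeries.coeff_mk, PowerSeries.coeff_one]
  split_ifs with h <;> simp [h]

end UqSl
end

noncomputable section

namespace UqSl

/-! ### Quantum root vectors attached to one half of the Chevalley generators -/

/-- `(-1) ^ θ_i`. -/
def sg (n i : ℕ) : ℤ := 1 - 2 * (theta n i : ℤ)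

theorem sg_eq (n i : ℕ) : sg n i = if i ≤ n then 1 else -1 := by
  unfold sg theta; split_ifs <;> simp

theorem sg_eq_pow (n i : ℕ) : sg n i = (-1) ^ theta n i := by
  unfold sg theta; split_ifs <;> simp

theorem chevDeg_eq (n j : ℕ) (hj : 1 ≤ j) :
    chevDeg n j = if j ≤ n then 0 else if j = n + 1 then 1 else 2 := by
  unfold chevDeg theta; split_ifs <;> omega

section Half

variable {K B : Type} [CommRing K] [Ring B] [Algebra K B]

/-- The sign `(-1) ^ (deg e_j * θ_i)`. -/
def tau (K : Type) [CommRing K] (n j i : ℕ) : K := (-1) ^ (chevDeg n j * theta n i)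

theorem tau_eq (n j i : ℕ) (hj : 1 ≤ j) :
    tau K n j i = if j = n + 1 ∧ n < i then -1 else 1 := by
  rw [tau, chevDeg_eq n j hj, theta]; split_ifs <;> first | omega | simp

theorem tau_mul_self (n j i : ℕ) : tau K n j i * tau K n j i = 1 := by
  rw [tau, ← mul_pow]; simp

/-- An abstract version of the homomorphism `a ↦ q ^ a`. -/
structure IsQPow (p : ℤ → K) : Prop where
  zero : p 0 = 1
  add : ∀ a b, p (a + b) = p a * p b
  unit : IsUnit (p 1 + p (-1))

theorem IsQPow.mul_neg {p : ℤ → K} (hp : IsQPow p) (a : ℤ) : p a * p (-a) = 1 := by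
  rw [← hp.add, add_neg_cancel, hp.zero]

/-- The f-side lives in the opposite algebra with q replaced by its inverse; this is the reason for
working with an abstract `p`. -/
theorem IsQPow.neg {p : ℤ → K} (hp : IsQPow p) : IsQPow fun a => p (-a) :=
  ⟨by simpa using hp.zero, fun a b => by rw [neg_add, hp.add], by
    have := hp.unit
    rwa [add_comm, neg_neg]⟩

/-- Both p(1) and p(−1) are roots of a² − (p(1) + p(−1)) a + 1. -/
theorem IsQPow.mul_sg {p : ℤ → K} (hp : IsQPow p) (n i : ℕ) :
    p (-sg n i) * (p 1 + p (-1)) = p (-sg n i) * p (-sg n i) + 1 := by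
  have h1 := hp.mul_neg 1
  rw [sg_eq]; split_ifs
  · linear_combination h1
  · rw [neg_neg]; linear_combination h1

/-- The Serre relations, for families which vanish outside `[1; n+m]`. -/
structure IsSerre (n : ℕ) (p : ℤ → K) (x : ℕ → B) : Prop where
  comm : ∀ i j, i ≠ j + 1 → j ≠ i + 1 → x i * x j = x j * x i
  sq : x (n + 1) * x (n + 1) = 0
  triple : ∀ i j, (i = j + 1 ∨ j = i + 1) → i ≠ n + 1 →
    x i * x i * x j - (p 1 + p (-1)) • (x i * x j * x i) + x j * x i * x i = 0
  additional :
    x (n + 1) * x n * x (n + 1) * x (n + 2) + x (n + 1) * x (n + 2) * x (n + 1) * x n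
      + x n * x (n + 1) * x (n + 2) * x (n + 1) + x (n + 2) * x (n + 1) * x n * x (n + 1)
      - (p 1 + p (-1)) • (x (n + 1) * x n * x (n + 2) * x (n + 1)) = 0

/-- The root vectors `N_1 = e_1`, `N_{i+1} = [N_i, e_{i+1}]_{p (-s_i)}`. -/
def rootN (n : ℕ) (p : ℤ → K) (e : ℕ → B) : ℕ → B
  | 0 => 0
  | 1 => e 1
  | (i + 2) => rootN n p e (i + 1) * e (i + 2)
      - p (-sg n (i + 1)) • (e (i + 2) * rootN n p e (i + 1))

theorem rootN_succ (n : ℕ) (p : ℤ → K) (e : ℕ → B) (i : ℕ) (hi : 1 ≤ i) :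
    rootN n p e (i + 1) = rootN n p e i * e (i + 1) - p (-sg n i) • (e (i + 1) * rootN n p e i) := by
  obtain ⟨i, rfl⟩ := Nat.exists_eq_succ_of_ne_zero (Nat.one_le_iff_ne_zero.1 hi)
  rfl

/-- For even y the two cubic Serre relations of y with x and with z imply that y commutes with the
iterated bracket of x, y, z. They only control t times the middle terms, so the identity is first
multiplied by t = q + q⁻¹, a unit. -/
theorem serre_sq_comm {x y z : B} {a t : K} (hat : a * t = a * a + 1) (ht : IsUnit t)
    (hxz : x * z = z * x) (hx : y * y * x - t • (y * x * y) + x * y * y = 0)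
    (hz : y * y * z - t • (y * z * y) + z * y * y = 0) :
    y * ((x * y - a • (y * x)) * z - a • (z * (x * y - a • (y * x))))
      = ((x * y - a • (y * x)) * z - a • (z * (x * y - a • (y * x)))) * y := by
  rw [← ht.smul_left_cancel]
  linear_combination (norm := (simp only [mul_sub, sub_mul, mul_add, add_mul, smul_mul_assoc, mul_smul_comm, smul_sub,
      smul_add, smul_smul, mul_assoc, zero_mul, mul_zero, smul_zero]; module))
    -(hx * z) - (a * a) • (hz * x) + x * hz + (a * a) • (z * hx) - hat • (y * y * x * z)
    + hat • (z * x * y * y) - (a * a) • (y * y * hxz) + (a * t) • (y * hxz * y) - hxz * y * y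

/-- The odd counterpart of `serre_sq_comm`. The bracket parameters a and b are mutually inverse
because the sign s_i changes at the odd node, and the anticommutation is then the additional Serre
relation modulo y² = 0 and xz = zx. -/
theorem additional_anticomm {x y z : B} {a b t : K} (hab : a * b = 1) (ht : t = a + b)
    (hxz : x * z = z * x)
    (h : y * x * y * z + y * z * y * x + x * y * z * y + z * y * x * y
      - t • (y * x * z * y) = 0) (hy : y * y = 0) :
    y * ((x * y - a • (y * x)) * z - b • (z * (x * y - a • (y * x))))
      = -(((x * y - a • (y * x)) * z - b • (z * (x * y - a • (y * x)))) * y) := by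
  subst ht
  linear_combination (norm := (simp only [mul_sub, sub_mul, mul_add, add_mul, smul_mul_assoc, mul_smul_comm, smul_sub,
      smul_add, smul_smul, mul_assoc, zero_mul, mul_zero, smul_zero]; module))
    h - a • (hy * x * z) - b • (z * x * hy) + b • (y * hxz * y) + hab • (y * z * y * x)
    + hab • (z * y * x * y)

/-- The expression is linear in x, and u commutes with y, so it can be q-bracketed with u. With u =
N_{i−1}, x = e_i, y = e_{i+1} this puts N_i in place of e_i. -/
theorem serre_transfer {x y u : B} {c t : K} (hu : u * y = y * u)
    (hx : y * y * x - t • (y * x * y) + x * y * y = 0) :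
    y * y * (u * x - c • (x * u)) - t • (y * (u * x - c • (x * u)) * y)
      + (u * x - c • (x * u)) * y * y = 0 := by
  linear_combination (norm := (simp only [mul_sub, sub_mul, mul_add, add_mul, smul_mul_assoc, mul_smul_comm, smul_sub,
      smul_add, smul_smul, mul_assoc, zero_mul, mul_zero, smul_zero]; module))
    u * hx - c • (hx * u) - y * hu * x - hu * y * x + t • (hu * x * y)
    - c • (x * y * hu) - c • (x * hu * y) + (c * t) • (y * x * hu)

/-- As in `serre_transfer`: the additional relation is linear in x, and u commutes with y and z. -/
theorem additional_transfer {x y z u : B} {c t : K} (hu : u * y = y * u) (huz : u * z = z * u)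
    (h : y * x * y * z + y * z * y * x + x * y * z * y + z * y * x * y
      - t • (y * x * z * y) = 0) :
    y * (u * x - c • (x * u)) * y * z + y * z * y * (u * x - c • (x * u))
      + (u * x - c • (x * u)) * y * z * y + z * y * (u * x - c • (x * u)) * y
      - t • (y * (u * x - c • (x * u)) * z * y) = 0 := by
  have h1 : ∀ b : B, y * (u * b) = u * (y * b) := fun b => by rw [← mul_assoc, ← hu, mul_assoc]
  have h2 : ∀ b : B, z * (u * b) = u * (z * b) := fun b => by rw [← mul_assoc, ← huz, mul_assoc]
  linear_combination (norm := (simp only [mul_sub, sub_mul, mul_add, add_mul, smul_mul_assoc,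
      mul_smul_comm, smul_sub, smul_add, smul_smul, mul_assoc, zero_mul, mul_zero,
      smul_zero, h1, h2, ← hu, ← huz]; module))
    u * h - c • (h * u)

/-- The properties of the generators `e_i` and their interaction with `f_i`, `n_i = [h_i]_q`
and `Q_i = q ^ (± h_i)` from which the commutation rules of the root vectors follow. -/
structure IsHalfChev (n r : ℕ) (p : ℤ → K) (e f Q N : ℕ → B) : Prop where
  serre : IsSerre n p e
  ef_ne : ∀ i j, i ≠ j → e i * f j = f j * e i
  ef_eq : ∀ i, 1 ≤ i → e i * f i = tau K n i i • (f i * e i) + N i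
  Q_comm : ∀ i j, 1 ≤ i → i + 1 < j → j ≤ r → Commute (Q j) (e i)
  N_comm : ∀ i j, 1 ≤ i → i + 1 < j → j ≤ r → Commute (N j) (e i)
  Q_succ : ∀ i, 1 ≤ i → i + 1 ≤ r → Q i * e (i + 1) = p (-sg n i) • (e (i + 1) * Q i)
  N_succ : ∀ i, 1 ≤ i → i + 1 ≤ r → e i * N (i + 1) - p (-sg n i) • (N (i + 1) * e i) = Q (i + 1) * e i

section rootN

variable {n r : ℕ} {p : ℤ → K} {e f Q N : ℕ → B}

theorem IsSerre.far (he : IsSerre n p e) {i j : ℕ} (hij : i + 2 ≤ j) :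
    rootN n p e i * e j = e j * rootN n p e i := by
  induction i with
  | zero => simp [rootN]
  | succ i ih =>
    rcases Nat.eq_zero_or_pos i with rfl | hi
    · exact he.comm _ _ (by omega) (by omega)
    · have h1 := ih (by omega)
      have h2 := he.comm (i + 1) j (by omega) (by omega)
      rw [rootN_succ _ _ _ _ hi]
      linear_combination (norm := (simp only [mul_sub, sub_mul, mul_add, add_mul, smul_mul_assoc, mul_smul_comm, smul_sub,
      smul_add, smul_smul, mul_assoc, zero_mul, mul_zero, smul_zero]; module))
        rootN n p e i * h2 + h1 * e (i + 1) - p (-sg n i) • (e (i + 1) * h1)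
        - p (-sg n i) • (h2 * rootN n p e i)

theorem IsSerre.triple_rootN (he : IsSerre n p e) {i : ℕ} (hi : 1 ≤ i) (hin : i ≠ n) :
    e (i + 1) * e (i + 1) * rootN n p e i
      - (p 1 + p (-1)) • (e (i + 1) * rootN n p e i * e (i + 1))
      + rootN n p e i * e (i + 1) * e (i + 1) = 0 := by
  obtain ⟨i, rfl⟩ := Nat.exists_eq_succ_of_ne_zero (Nat.one_le_iff_ne_zero.1 hi)
  rcases Nat.eq_zero_or_pos i with rfl | hi
  · exact he.triple _ _ (by omega) (by omega)
  · rw [Nat.succ_eq_add_one, rootN_succ _ _ _ _ hi]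
    exact serre_transfer (he.far (by omega)) (he.triple _ _ (by omega) (by omega))

/-- For i ≠ n the cubic relation factors as a q-commutator of e_{i+1} with the q-commutator N_{i+1},
since t = p(s_i) + p(−s_i). For i = n both sides reduce to multiples of e N e because e_{n+1}
squares to zero. -/
theorem IsSerre.rootN_succ_mul (hp : IsQPow p) (he : IsSerre n p e) {i : ℕ} (hi : 1 ≤ i) :
    rootN n p e (i + 1) * e (i + 1)
      = (tau K n (i + 1) (i + 1) * p (sg n (i + 1))) • (e (i + 1) * rootN n p e (i + 1)) := by
  rw [rootN_succ _ _ _ _ hi, tau_eq _ _ _ (by omega)]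
  by_cases hin : i = n
  · subst hin
    rw [if_pos (by omega), sg_eq, if_pos le_rfl, sg_eq, if_neg (by omega)]
    have h := he.sq
    linear_combination (norm := (simp only [mul_sub, sub_mul, mul_add, add_mul, smul_mul_assoc, mul_smul_comm, smul_sub,
      smul_add, smul_smul, mul_assoc, zero_mul, mul_zero, smul_zero]; module)) rootN i p e i * h - (p (-1) * p (-1)) • (h * rootN i p e i)
  · have h := he.triple_rootN hi hin
    have hs : sg n (i + 1) = sg n i := by rw [sg_eq, sg_eq]; split_ifs <;> omega
    have h1 : p 1 + p (-1) = p (sg n i) + p (-sg n i) := by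
      rw [sg_eq]; split_ifs
      · rfl
      · rw [neg_neg, add_comm]
    have h2 := hp.mul_neg (sg n i)
    rw [if_neg (by omega), hs, one_mul]
    rw [h1] at h
    linear_combination (norm := (simp only [mul_sub, sub_mul, mul_add, add_mul, smul_mul_assoc, mul_smul_comm, smul_sub,
      smul_add, smul_smul, mul_assoc, zero_mul, mul_zero, smul_zero]; module)) h + h2 • (e (i + 1) * e (i + 1) * rootN n p e i)

/-- Only the case i = j + 1 has content: N_{j+1} is a double bracket of N_{j−1}, e_j, e_{j+1},
covered by `serre_sq_comm`, or by `additional_anticomm` when j = n + 1. Larger i only bring in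
letters commuting with e_j. The bound 2 ≤ j is needed to have N_{j−1} to the left. -/
theorem IsSerre.comm_rootN (hp : IsQPow p) (he : IsSerre n p e) {i j : ℕ} (hj : 2 ≤ j) (hij : j < i) :
    e j * rootN n p e i = tau K n j i • (rootN n p e i * e j) := by
  induction i, hij using Nat.le_induction with
  | base =>
    obtain ⟨j, rfl⟩ := Nat.exists_eq_add_of_le' (show 1 ≤ j by omega)
    have hfar : rootN n p e j * e (j + 2) = e (j + 2) * rootN n p e j := he.far (by omega)
    rw [Nat.succ_eq_add_one, rootN_succ _ _ _ (j + 1) (by omega), rootN_succ _ _ _ j (by omega),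
      tau_eq _ _ _ (by omega)]
    by_cases hjn : j = n
    · subst hjn
      rw [if_pos (by omega), neg_smul, one_smul, sg_eq, if_pos le_rfl, sg_eq, if_neg (by omega),
        neg_neg]
      refine additional_anticomm (t := p 1 + p (-1)) ?_ (add_comm _ _) hfar ?_ he.sq
      · rw [mul_comm]; exact hp.mul_neg 1
      · obtain ⟨j, rfl⟩ := Nat.exists_eq_add_of_le' (show 1 ≤ j by omega)
        rcases Nat.eq_zero_or_pos j with rfl | hj0
        · exact he.additional
        · rw [rootN_succ _ _ _ _ hj0]
          exact additional_transfer (he.far (by omega)) (he.far (by omega)) he.additional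
    · have hs : sg n (j + 1) = sg n j := by rw [sg_eq, sg_eq]; split_ifs <;> omega
      rw [if_neg (by omega), one_smul, hs]
      exact serre_sq_comm (hp.mul_sg n j) hp.unit hfar (he.triple_rootN (by omega) hjn)
        (he.triple _ _ (by omega) (by omega))
  | succ i hi ih =>
    have h1 := he.comm j (i + 1) (by omega) (by omega)
    have h2 : tau K n j (i + 1) = tau K n j i := by
      rw [tau_eq _ _ _ (by omega), tau_eq _ _ _ (by omega)]
      congr 1
      simp only [eq_iff_iff, and_congr_right_iff]
      omega
    rw [rootN_succ _ _ _ _ (by omega), h2]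
    linear_combination (norm := (simp only [mul_sub, sub_mul, mul_add, add_mul, smul_mul_assoc, mul_smul_comm, smul_sub,
      smul_add, smul_smul, mul_assoc, zero_mul, mul_zero, smul_zero]; module)) ih * e (i + 1) + tau K n j i • (rootN n p e i * h1)
          - p (-sg n i) • (h1 * rootN n p e i) - p (-sg n i) • (e (i + 1) * ih)

theorem IsHalfChev.comm_f (h : IsHalfChev n r p e f Q N) {i j : ℕ} (hij : i < j) :
    rootN n p e i * f j = f j * rootN n p e i := by
  induction i with
  | zero => simp [rootN]
  | succ i ih =>
    rcases Nat.eq_zero_or_pos i with rfl | hi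
    · exact h.ef_ne _ _ (by omega)
    · have h1 := ih (by omega)
      have h2 := h.ef_ne (i + 1) j (by omega)
      rw [rootN_succ _ _ _ _ hi]
      linear_combination (norm := (simp only [mul_sub, sub_mul, mul_add, add_mul, smul_mul_assoc, mul_smul_comm, smul_sub,
      smul_add, smul_smul, mul_assoc, zero_mul, mul_zero, smul_zero]; module))
        rootN n p e i * h2 + h1 * e (i + 1) - p (-sg n i) • (e (i + 1) * h1)
        - p (-sg n i) • (h2 * rootN n p e i)

theorem commute_rootN {x : B} {i : ℕ} (h : ∀ j, 1 ≤ j → j ≤ i → Commute x (e j)) :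
    Commute x (rootN n p e i) := by
  induction i with
  | zero => exact Commute.zero_right x
  | succ i ih =>
    rcases Nat.eq_zero_or_pos i with rfl | hi
    · exact h 1 le_rfl le_rfl
    · have h1 := ih fun j hj hji => h j hj (by omega)
      have h2 := h (i + 1) (by omega) le_rfl
      rw [rootN_succ _ _ _ _ hi]
      exact (h1.mul_right h2).sub_right ((h2.mul_right h1).smul_right _)

/-- Among the letters of N_i only the last one, e_i, fails to commute with h_{i+1}. -/
theorem IsHalfChev.N_rootN (h : IsHalfChev n r p e f Q N) {i : ℕ} (hi : 1 ≤ i) (hir : i + 1 ≤ r) :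
    rootN n p e i * N (i + 1) - p (-sg n i) • (N (i + 1) * rootN n p e i)
      = Q (i + 1) * rootN n p e i := by
  obtain ⟨i, rfl⟩ := Nat.exists_eq_add_of_le' hi
  have h0 := h.N_succ (i + 1) (by omega) hir
  rcases Nat.eq_zero_or_pos i with rfl | hi0
  · exact h0
  · have h1 : Commute (N (i + 1 + 1)) (rootN n p e i) :=
      commute_rootN fun j hj hji => h.N_comm j _ hj (by omega) hir
    have h2 : Commute (Q (i + 1 + 1)) (rootN n p e i) :=
      commute_rootN fun j hj hji => h.Q_comm j _ hj (by omega) hir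
    have h1 := h1.eq
    have h2 := h2.eq
    rw [rootN_succ _ _ _ _ hi0]
    linear_combination (norm := (simp only [mul_sub, sub_mul, mul_add, add_mul, smul_mul_assoc, mul_smul_comm, smul_sub,
      smul_add, smul_smul, mul_assoc, zero_mul, mul_zero, smul_zero]; module))
      rootN n p e i * h0 - p (-sg n i) • (h0 * rootN n p e i)
      + p (-sg n (i + 1)) • (-h1 * e (i + 1)) + p (-sg n i) • (e (i + 1) * h1) - h2 * e (i + 1)

/-- Bracketing with f_{i+1} replaces the last letter e_{i+1} of N_{i+1} by [h_{i+1}], and the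
q-bracket of N_i with [h_{i+1}] is a single q-power by `N_rootN`. -/
theorem IsHalfChev.rootN_mul_f (h : IsHalfChev n r p e f Q N) {i : ℕ} (hi : 1 ≤ i)
    (hir : i + 1 ≤ r) :
    rootN n p e (i + 1) * f (i + 1)
      = tau K n (i + 1) (i + 1) • (f (i + 1) * rootN n p e (i + 1)) + Q (i + 1) * rootN n p e i := by
  have h1 := h.comm_f (show i < i + 1 by omega)
  have h2 := h.ef_eq (i + 1) (by omega)
  have h3 := h.N_rootN hi hir
  rw [rootN_succ _ _ _ _ hi]
  linear_combination (norm := (simp only [mul_sub, sub_mul, mul_add, add_mul, smul_mul_assoc, mul_smul_comm, smul_sub,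
      smul_add, smul_smul, mul_assoc, zero_mul, mul_zero, smul_zero]; module))
    h3 + rootN n p e i * h2 - p (-sg n i) • (h2 * rootN n p e i)
    + tau K n (i + 1) (i + 1) • (h1 * e (i + 1)) - p (-sg n i) • (e (i + 1) * h1)

/-- For i = j + 1, removing e_j leaves Q_j N_{j−1}, still to be q-bracketed with e_{j+1}. That
bracket vanishes: N_{j−1} commutes with e_{j+1}, and the factor in `Q_succ` is the bracket
parameter. -/
theorem IsHalfChev.f_mul_rootN (h : IsHalfChev n r p e f Q N) {i j : ℕ} (hj : 2 ≤ j) (hij : j < i)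
    (hir : i ≤ r) : rootN n p e i * f j = tau K n j i • (f j * rootN n p e i) := by
  induction i, hij using Nat.le_induction with
  | base =>
    obtain ⟨j, rfl⟩ := Nat.exists_eq_add_of_le' (show 1 ≤ j by omega)
    have h1 := h.rootN_mul_f (i := j) (by omega) (by omega)
    have h2 := h.ef_ne (j + 2) (j + 1) (by omega)
    have h3 := h.Q_succ (j + 1) (by omega) (by omega)
    have h4 : rootN n p e j * e (j + 2) = e (j + 2) * rootN n p e j := h.serre.far (by omega)
    have h5 : tau K n (j + 1) (j + 2) = tau K n (j + 1) (j + 1) := by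
      rw [tau_eq _ _ _ (by omega), tau_eq _ _ _ (by omega)]
      congr 1
      simp only [eq_iff_iff, and_congr_right_iff]
      omega
    rw [Nat.succ_eq_add_one, rootN_succ _ _ _ (j + 1) (by omega), h5]
    linear_combination (norm := (simp only [mul_sub, sub_mul, mul_add, add_mul, smul_mul_assoc, mul_smul_comm, smul_sub,
      smul_add, smul_smul, mul_assoc, zero_mul, mul_zero, smul_zero]; module))
      rootN n p e (j + 1) * h2 + h1 * e (j + 2) - p (-sg n (j + 1)) • (e (j + 2) * h1)
      - (p (-sg n (j + 1)) * tau K n (j + 1) (j + 1)) • (h2 * rootN n p e (j + 1))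
      + Q (j + 1) * h4 + h3 * rootN n p e j
  | succ i hi ih =>
    have h1 := h.ef_ne (i + 1) j (by omega)
    have h2 : tau K n j (i + 1) = tau K n j i := by
      rw [tau_eq _ _ _ (by omega), tau_eq _ _ _ (by omega)]
      congr 1
      simp only [eq_iff_iff, and_congr_right_iff]
      omega
    have ih := ih (by omega)
    rw [rootN_succ _ _ _ _ (by omega), h2]
    linear_combination (norm := (simp only [mul_sub, sub_mul, mul_add, add_mul, smul_mul_assoc, mul_smul_comm, smul_sub,
      smul_add, smul_smul, mul_assoc, zero_mul, mul_zero, smul_zero]; module))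
      rootN n p e i * h1 + ih * e (i + 1) - p (-sg n i) • (e (i + 1) * ih)
      - (p (-sg n i) * tau K n j i) • (h1 * rootN n p e i)

end rootN
end Half

end UqSl
end

noncomputable section

namespace UqSl

/-- The usual `ℕ`-algebra structure, preferred to the coefficientwise one. -/
instance natAlgebraSeries : Algebra ℕ ℂ⟦X⟧ := Semiring.toNatAlgebra

/-- The usual `ℤ`-algebra structure, preferred to the coefficientwise one. -/
instance intAlgebraSeries : Algebra ℤ ℂ⟦X⟧ := Ring.toIntAlgebra _

/-! ### Families satisfying the Chevalley relations -/

section IsChev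

variable {B : Type} [Ring B] [Algebra ℂ⟦X⟧ B] [HComplete B]

/-- The relations of `Uq n m`, for families which vanish outside `[1; n+m]`. -/
structure IsChev (n m : ℕ) (h e f : ℕ → B) : Prop where
  h_zero : ∀ i, ¬(1 ≤ i ∧ i ≤ n + m) → h i = 0
  e_zero : ∀ i, ¬(1 ≤ i ∧ i ≤ n + m) → e i = 0
  f_zero : ∀ i, ¬(1 ≤ i ∧ i ≤ n + m) → f i = 0
  hh : ∀ i j, Commute (h i) (h j)
  he : ∀ i j, 1 ≤ i ∧ i ≤ n + m → 1 ≤ j ∧ j ≤ n + m →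
    h i * e j = e j * (h i + (cartan n i j : B))
  hf : ∀ i j, 1 ≤ i ∧ i ≤ n + m → 1 ≤ j ∧ j ≤ n + m →
    h i * f j = f j * (h i - (cartan n i j : B))
  ef_ne : ∀ i j, i ≠ j → e i * f j = f j * e i
  ef_eq : ∀ i, 1 ≤ i → e i * f i = tau ℂ⟦X⟧ n i i • (f i * e i) + qN (h i)
  serre_e : IsSerre n qpow e
  serre_f : IsSerre n qpow f

theorem isQPow_qpow : IsQPow qpow where
  zero := qpow_zero
  add := qpow_add
  unit := by
    rw [PowerSeries.isUnit_iff_constantCoeff, map_add,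
      ← PowerSeries.coeff_zero_eq_constantCoeff_apply, ← PowerSeries.coeff_zero_eq_constantCoeff_apply,
      qpow, qpow, PowerSeries.coeff_mk, PowerSeries.coeff_mk]
    simp

/-- The degrees are 0, 1, 2, and 1 occurs only at index n + 1, so two different indices never
produce a sign. -/
theorem chevDeg_mul_chevDeg {n i j : ℕ} (hi : 1 ≤ i) (hj : 1 ≤ j) (hij : i ≠ j) :
    ((-1 : ℂ⟦X⟧) ^ (chevDeg n i * chevDeg n j)) = 1 := by
  rw [chevDeg_eq n i hi, chevDeg_eq n j hj]
  split_ifs <;> first | omega | norm_num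

theorem chevDeg_mul_self {n i : ℕ} (hi : 1 ≤ i) :
    ((-1 : ℂ⟦X⟧) ^ (chevDeg n i * chevDeg n i)) = tau ℂ⟦X⟧ n i i := by
  rw [tau_eq _ _ _ hi, chevDeg_eq n i hi]
  split_ifs <;> first | omega | norm_num

omit [HComplete B] in
theorem serre_expand {q p : ℂ⟦X⟧} (h : q * p = 1) (x y : B) :
    x * (x * y - p • (y * x)) - q • ((x * y - p • (y * x)) * x)
      = x * x * y - (q + p) • (x * y * x) + y * x * x := by
  linear_combination (norm := (simp only [mul_sub, sub_mul, mul_add, add_mul, smul_mul_assoc, mul_smul_comm, smul_sub,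
      smul_add, smul_smul, mul_assoc, zero_mul, mul_zero, smul_zero]; module))
    h • (y * x * x)

-- The two cubic bracket relations have the same expansion, symmetric under q ↔ q⁻¹. The two
-- additional relations also reduce to one symmetric identity, once e_{n+1}² = 0 and the commutation
-- of e_n with e_{n+2} are used. Extending the families by zero makes every relation that touches an
-- index out of range trivial.
omit [HComplete B] in
theorem isSerre_iff {n m : ℕ} {x : ℕ → HFree (ChevGen n m)} (Φ : HFree (ChevGen n m) →ₐ[ℂ⟦X⟧] B)
    (hx : ∀ i, ¬(1 ≤ i ∧ i ≤ n + m) → Φ (x i) = 0) :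
    IsSerre n qpow (fun i => Φ (x i)) ↔ ∀ a b, SerreRel n m x a b → Φ a = Φ b := by
  have hq := isQPow_qpow.mul_neg 1
  have hq' : qpow (-1) * qpow 1 = 1 := by rw [mul_comm]; exact hq
  constructor
  · intro h a b hab
    cases hab with
    | comm i j hi hj hij =>
      simp [br, h.comm i j hij.1 hij.2]
    | sq hm => simpa [pow_two] using h.sq
    | triple i j hi hj hij hin =>
      simp only [br, map_sub, map_mul, map_smul, map_zero]
      rw [serre_expand hq]
      exact h.triple i j hij hin
    | triple' i j hi hj hij hin =>
      simp only [br, map_sub, map_mul, map_smul, map_zero]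
      rw [serre_expand hq', add_comm (qpow (-1))]
      exact h.triple i j hij hin
    | additional hn hm =>
      have h1 := h.comm n (n + 2) (by omega) (by omega)
      have h2 := h.additional
      simp only [br, abr, map_sub, map_mul, map_smul, map_zero, map_add]
      linear_combination (norm := (simp only [mul_sub, sub_mul, mul_add, add_mul, smul_mul_assoc, mul_smul_comm, smul_sub,
      smul_add, smul_smul, mul_assoc, zero_mul, mul_zero, smul_zero]; module))
        h2 + hq • (Φ (x (n + 1)) * Φ (x (n + 2)) * Φ (x (n + 1)) * Φ (x n))
        + hq • (Φ (x (n + 2)) * Φ (x (n + 1)) * Φ (x n) * Φ (x (n + 1)))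
        + qpow (-1) • (Φ (x (n + 1)) * h1 * Φ (x (n + 1)))
        - qpow 1 • (h.sq * Φ (x n) * Φ (x (n + 2))) - qpow (-1) • (Φ (x (n + 2)) * Φ (x n) * h.sq)
    | additional' hn hm =>
      have h1 := h.comm n (n + 2) (by omega) (by omega)
      have h2 := h.additional
      simp only [br, abr, map_sub, map_mul, map_smul, map_zero, map_add]
      linear_combination (norm := (simp only [mul_sub, sub_mul, mul_add, add_mul, smul_mul_assoc, mul_smul_comm, smul_sub,
      smul_add, smul_smul, mul_assoc, zero_mul, mul_zero, smul_zero]; module))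
        h2 + hq • (Φ (x (n + 1)) * Φ (x (n + 2)) * Φ (x (n + 1)) * Φ (x n))
        + hq • (Φ (x (n + 2)) * Φ (x (n + 1)) * Φ (x n) * Φ (x (n + 1)))
        + qpow 1 • (Φ (x (n + 1)) * h1 * Φ (x (n + 1)))
        - qpow (-1) • (h.sq * Φ (x n) * Φ (x (n + 2))) - qpow 1 • (Φ (x (n + 2)) * Φ (x n) * h.sq)
  · intro h
    have hc : ∀ i j, i ≠ j + 1 → j ≠ i + 1 → Φ (x i) * Φ (x j) = Φ (x j) * Φ (x i) := by
      intro i j hij hji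
      by_cases hi : 1 ≤ i ∧ i ≤ n + m
      · by_cases hj : 1 ≤ j ∧ j ≤ n + m
        · have := h _ _ (SerreRel.comm i j hi hj ⟨hij, hji⟩)
          simpa [br, sub_eq_zero] using this
        · rw [hx j hj]; simp
      · rw [hx i hi]; simp
    have hs : Φ (x (n + 1)) * Φ (x (n + 1)) = 0 := by
      by_cases hm : 1 ≤ m
      · simpa [pow_two] using h _ _ (SerreRel.sq hm)
      · rw [hx (n + 1) (by omega)]; simp
    refine ⟨hc, hs, ?_, ?_⟩
    · intro i j hij hin
      by_cases hi : 1 ≤ i ∧ i ≤ n + m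
      · by_cases hj : 1 ≤ j ∧ j ≤ n + m
        · have := h _ _ (SerreRel.triple i j hi hj hij hin)
          simp only [br, map_sub, map_mul, map_smul, map_zero] at this
          rwa [serre_expand hq] at this
        · rw [hx j hj]; simp
      · rw [hx i hi]; simp
    · by_cases hn : 1 ≤ n
      · by_cases hm : 2 ≤ m
        · have h1 := hc n (n + 2) (by omega) (by omega)
          have h2 := h _ _ (SerreRel.additional hn hm)
          simp only [br, abr, map_sub, map_mul, map_smul, map_zero, map_add] at h2
          linear_combination (norm := (simp only [mul_sub, sub_mul, mul_add, add_mul, smul_mul_assoc, mul_smul_comm, smul_sub,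
      smul_add, smul_smul, mul_assoc, zero_mul, mul_zero, smul_zero]; module))
            h2 - hq • (Φ (x (n + 1)) * Φ (x (n + 2)) * Φ (x (n + 1)) * Φ (x n))
            - hq • (Φ (x (n + 2)) * Φ (x (n + 1)) * Φ (x n) * Φ (x (n + 1)))
            - qpow (-1) • (Φ (x (n + 1)) * h1 * Φ (x (n + 1)))
            + qpow 1 • (hs * Φ (x n) * Φ (x (n + 2))) + qpow (-1) • (Φ (x (n + 2)) * Φ (x n) * hs)
        · rw [hx (n + 2) (by omega)]; simp
      · rw [hx n (by omega)]; simp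

end IsChev

/-! ### The universal property of U_q[sl(n+1|m)]. -/

section Uq

variable {n m : ℕ}

/-- The classes of the Chevalley generators. -/
def uh (n m i : ℕ) : Uq n m := cls (ChevRel n m) (chevh n m i)
/-- The classes of the Chevalley generators. -/
def ue (n m i : ℕ) : Uq n m := cls (ChevRel n m) (cheve n m i)
/-- The classes of the Chevalley generators. -/
def uf (n m i : ℕ) : Uq n m := cls (ChevRel n m) (chevf n m i)

theorem chevh_eq_zero {i : ℕ} (hi : ¬(1 ≤ i ∧ i ≤ n + m)) : chevh n m i = 0 := by
  rw [chevh, chevh0, dif_neg hi]; exact map_zero HFree.constHom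

theorem cheve_eq_zero {i : ℕ} (hi : ¬(1 ≤ i ∧ i ≤ n + m)) : cheve n m i = 0 := by
  rw [cheve, dif_neg hi]

theorem chevf_eq_zero {i : ℕ} (hi : ¬(1 ≤ i ∧ i ≤ n + m)) : chevf n m i = 0 := by
  rw [chevf, dif_neg hi]

theorem isChev_cls (n m : ℕ) : IsChev n m (uh n m) (ue n m) (uf n m) where
  h_zero i hi := by rw [uh, chevh_eq_zero hi, map_zero]
  e_zero i hi := by rw [ue, cheve_eq_zero hi, map_zero]
  f_zero i hi := by rw [uf, chevf_eq_zero hi, map_zero]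
  hh i j := by
    by_cases hi : 1 ≤ i ∧ i ≤ n + m
    · by_cases hj : 1 ≤ j ∧ j ≤ n + m
      · have := cls_rel (ChevRel.hh i j hi hj)
        rw [br, one_smul, map_sub, map_mul, map_mul, map_zero, sub_eq_zero] at this
        exact this
      · rw [uh, uh, chevh_eq_zero hj, map_zero]; exact Commute.zero_right _
    · rw [uh, uh, chevh_eq_zero hi, map_zero]; exact Commute.zero_left _
  he i j hi hj := by
    have := cls_rel (ChevRel.he i j hi hj)
    rw [br, one_smul, map_sub, map_mul, map_mul, map_zsmul, sub_eq_iff_eq_add] at this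
    rw [mul_add, add_comm]
    refine this.trans ?_
    rw [zsmul_eq_mul, Int.cast_comm]; rfl
  hf i j hi hj := by
    have := cls_rel (ChevRel.hf i j hi hj)
    rw [br, one_smul, map_sub, map_mul, map_mul, map_zsmul, sub_eq_iff_eq_add] at this
    rw [mul_sub, sub_eq_add_neg, add_comm]
    refine this.trans ?_
    rw [zsmul_eq_mul, Int.cast_comm, Int.cast_neg, mul_neg]; rfl
  ef_ne i j hij := by
    by_cases hi : 1 ≤ i ∧ i ≤ n + m
    · by_cases hj : 1 ≤ j ∧ j ≤ n + m
      · have := cls_rel (ChevRel.ef i j hi hj)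
        rw [sbr, if_neg hij, chevDeg_mul_chevDeg hi.1 hj.1 hij, one_mul, one_smul, map_sub, map_mul,
          map_mul, map_zero, sub_eq_zero] at this
        exact this
      · rw [uf, chevf_eq_zero hj]; simp
    · rw [ue, cheve_eq_zero hi]; simp
  ef_eq i hi := by
    by_cases hi' : 1 ≤ i ∧ i ≤ n + m
    · have := cls_rel (ChevRel.ef i i hi' hi')
      rw [sbr, if_pos rfl, chevDeg_mul_self hi, mul_one, map_sub, map_mul, map_smul,
        map_mul, cls_qnum, sub_eq_iff_eq_add'] at this
      exact this
    · rw [ue, uh, cheve_eq_zero hi', chevh_eq_zero hi', map_zero, qN_zero]; simp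
  serre_e := (isSerre_iff (cls (ChevRel n m)) (fun i hi => by rw [cheve_eq_zero hi, map_zero])).2
    fun a b hab => cls_rel (ChevRel.serre_e a b hab)
  serre_f := (isSerre_iff (cls (ChevRel n m)) (fun i hi => by rw [chevf_eq_zero hi, map_zero])).2
    fun a b hab => cls_rel (ChevRel.serre_f a b hab)

variable {B : Type} [Ring B] [Algebra ℂ⟦X⟧ B] [HComplete B]

theorem IsChev.map {B' : Type} [Ring B'] [Algebra ℂ⟦X⟧ B'] [HComplete B'] {h e f : ℕ → B}
    (H : IsChev n m h e f) (Φ : B →ₐ[ℂ⟦X⟧] B') :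
    IsChev n m (fun i => Φ (h i)) (fun i => Φ (e i)) (fun i => Φ (f i)) where
  h_zero i hi := by rw [H.h_zero i hi, map_zero]
  e_zero i hi := by rw [H.e_zero i hi, map_zero]
  f_zero i hi := by rw [H.f_zero i hi, map_zero]
  hh i j := (H.hh i j).map Φ
  he i j hi hj := by rw [← map_mul, H.he i j hi hj]; simp
  hf i j hi hj := by rw [← map_mul, H.hf i j hi hj]; simp
  ef_ne i j hij := by rw [← map_mul, H.ef_ne i j hij, map_mul]
  ef_eq i hi := by rw [← map_mul, H.ef_eq i hi, map_add, map_smul, map_mul, map_qN]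
  serre_e := by
    have h := H.serre_e
    refine ⟨fun i j hij hji => ?_, ?_, fun i j hij hin => ?_, ?_⟩
    · rw [← map_mul, h.comm i j hij hji, map_mul]
    · rw [← map_mul, h.sq, map_zero]
    · simpa using congrArg Φ (h.triple i j hij hin)
    · simpa using congrArg Φ h.additional
  serre_f := by
    have h := H.serre_f
    refine ⟨fun i j hij hji => ?_, ?_, fun i j hij hin => ?_, ?_⟩
    · rw [← map_mul, h.comm i j hij hji, map_mul]
    · rw [← map_mul, h.sq, map_zero]
    · simpa using congrArg Φ (h.triple i j hij hin)
    · simpa using congrArg Φ h.additional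

theorem IsChev.exists_lift {h e f : ℕ → B} (H : IsChev n m h e f) :
    ∃ Φ : Uq n m →ₐ[ℂ⟦X⟧] B, ∀ i, Φ (uh n m i) = h i ∧ Φ (ue n m i) = e i ∧ Φ (uf n m i) = f i := by
  obtain ⟨Φ, hΦ⟩ := HFree.exists_lift (G := ChevGen n m)
    (fun | .h i => h i | .e i => e i | .f i => f i)
  have hh : ∀ i, Φ (chevh n m i) = h i := by
    intro i
    by_cases hi : 1 ≤ i ∧ i ≤ n + m
    · rw [chevh, chevh0, dif_pos hi]; exact hΦ (.h ⟨i, hi⟩)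
    · rw [chevh_eq_zero hi, H.h_zero i hi, map_zero]
  have he : ∀ i, Φ (cheve n m i) = e i := by
    intro i
    by_cases hi : 1 ≤ i ∧ i ≤ n + m
    · rw [cheve, dif_pos hi]; exact hΦ (.e ⟨i, hi⟩)
    · rw [cheve_eq_zero hi, H.e_zero i hi, map_zero]
  have hf : ∀ i, Φ (chevf n m i) = f i := by
    intro i
    by_cases hi : 1 ≤ i ∧ i ≤ n + m
    · rw [chevf, dif_pos hi]; exact hΦ (.f ⟨i, hi⟩)
    · rw [chevf_eq_zero hi, H.f_zero i hi, map_zero]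
  have hR : ∀ a b, ChevRel n m a b → Φ a = Φ b := by
    intro a b hab
    cases hab with
    | hh i j hi hj => simp [br, hh, (H.hh i j).eq]
    | he i j hi hj =>
      simp only [br, one_smul, map_sub, map_mul, map_zsmul, hh, he]
      rw [H.he i j hi hj, mul_add, add_sub_cancel_left, zsmul_eq_mul, Int.cast_comm]
    | hf i j hi hj =>
      simp only [br, one_smul, map_sub, map_mul, map_zsmul, hh, hf]
      rw [H.hf i j hi hj, mul_sub, sub_sub_cancel_left, zsmul_eq_mul, Int.cast_neg, neg_mul,
        Int.cast_comm]
    | ef i j hi hj =>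
      simp only [sbr, map_sub, map_mul, map_smul, he, hf]
      split_ifs with hij
      · subst hij
        rw [H.ef_eq i hi.1, chevDeg_mul_self hi.1, mul_one, add_sub_cancel_left, qnum_eq_qN, map_qN]
        exact congrArg qN (hh i).symm
      · rw [H.ef_ne i j hij, chevDeg_mul_chevDeg hi.1 hj.1 hij, one_mul, one_smul, sub_self, map_zero]
    | serre_e _ _ hab =>
      refine (isSerre_iff Φ (fun i hi => by rw [cheve_eq_zero hi, map_zero])).1 ?_ a b hab
      simpa only [he] using H.serre_e
    | serre_f _ _ hab =>
      refine (isSerre_iff Φ (fun i hi => by rw [chevf_eq_zero hi, map_zero])).1 ?_ a b hab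
      simpa only [hf] using H.serre_f
  obtain ⟨Ψ, hΨ⟩ := HPresented.exists_lift Φ hR
  exact ⟨Ψ, fun i => ⟨(hΨ _).trans (hh i), (hΨ _).trans (he i), (hΨ _).trans (hf i)⟩⟩

end Uq

end UqSl
end

noncomputable section

namespace UqSl

/-! ### Weights -/

section Weights

variable {B : Type} [Ring B]

/-- `y` has weight `a` with respect to `x`. -/
def HasWt (x y : B) (a : ℤ) : Prop := x * y = y * (x + (a : B))

namespace HasWt

variable {x x' y z : B} {a b : ℤ}

theorem zero_left (y : B) : HasWt 0 y 0 := by simp [HasWt]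

theorem zsmul (h : HasWt x y a) (c : ℤ) : HasWt (c • x) y (c * a) := by
  rw [HasWt, smul_mul_assoc, h, ← mul_smul_comm, smul_add, zsmul_eq_mul (a : B), Int.cast_mul]

theorem neg (h : HasWt x y a) : HasWt (-x) y (-a) := by
  have := h.zsmul (-1)
  simpa using this

theorem add (h : HasWt x y a) (h' : HasWt x' y b) : HasWt (x + x') y (a + b) := by
  rw [HasWt, add_mul, h, h', ← mul_add, Int.cast_add]
  congr 1
  abel

theorem mul (h : HasWt x y a) (h' : HasWt x z b) : HasWt x (y * z) (a + b) := by
  unfold HasWt at *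
  rw [← mul_assoc, h, mul_assoc, add_mul, h', Int.cast_comm, ← mul_add, ← mul_assoc, Int.cast_add]
  congr 1
  abel

theorem sub (h : HasWt x y a) (h' : HasWt x z a) : HasWt x (y - z) a := by
  rw [HasWt, mul_sub, sub_mul, h, h']

theorem smul {K : Type} [CommRing K] [Algebra K B] (h : HasWt x y a) (c : K) :
    HasWt x (c • y) a := by
  rw [HasWt, mul_smul_comm, smul_mul_assoc, h]

theorem of_eq (h : HasWt x y a) (hab : a = b) : HasWt x y b := hab ▸ h

variable [Algebra ℂ⟦X⟧ B] [HComplete B]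

theorem qE (h : HasWt x y a) : qE x * y = qpow a • (y * qE x) := by
  rw [qE_mul h, qE_add (Int.cast_commute a x).symm, qE_intCast, ← Algebra.commutes,
    ← Algebra.smul_def, mul_smul_comm]

theorem qN (h : HasWt x y a) : qN x * y = y * qN (x + (a : B)) := qN_mul h

end HasWt

theorem sg_mul_self (n i : ℕ) : sg n i * sg n i = 1 := by rw [sg_eq]; split_ifs <;> norm_num

variable [Algebra ℂ⟦X⟧ B] [HComplete B]

/-- The two signs are exchanged by q ↔ q⁻¹, which fixes q-numbers. -/
theorem qN_sub_smul_qN (n i : ℕ) (x : B) :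
    qN x - qpow (-sg n i) • qN (x - 1) = qE (sg n i • (x - 1)) := by
  rw [sg_eq]; split_ifs
  · rw [qN_sub_one, one_smul]
  · rw [neg_neg, qN_sub_one', neg_one_smul, neg_sub]

theorem qN_sub_sg (n i : ℕ) (x : B) :
    qN (x - (sg n i : B)) - qpow (-sg n i) • qN x = -sg n i • qE (-x) := by
  rw [sg_eq]; split_ifs
  · have h1 := qN_sub_one' x
    have h2 := qE_intCast (B := B) 1
    have h3 := isQPow_qpow.mul_neg 1
    rw [sub_eq_add_neg 1 x, qE_add (by simp)] at h1
    rw [Int.cast_one] at h2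
    rw [h2, ← Algebra.smul_def] at h1
    rw [Int.cast_one, ← one_smul ℂ⟦X⟧ (qN (x - 1)), ← one_smul ℂ⟦X⟧ (qE (-x)), ← h3, mul_comm,
      ← smul_smul, ← smul_smul, ← h1, smul_sub]
    simp
  · have h1 := qN_sub_one' (x + 1)
    rw [add_sub_cancel_right] at h1
    simpa using h1

end Weights

/-! ### Root vectors a_i^±, Cartan elements H_i and their weights. -/

section RootVectors

variable {B : Type} [Ring B] [Algebra ℂ⟦X⟧ B] [HComplete B] {n m : ℕ} {h e f : ℕ → B}

open MulOpposite

/-- The root vectors `a_i^-`. -/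
def rN (n : ℕ) (e : ℕ → B) (i : ℕ) : B := rootN n qpow e i

/-- The root vectors `a_i^+`. -/
def rP (n : ℕ) (f : ℕ → B) (i : ℕ) : B :=
  unop (rootN n (fun a => qpow (-a)) (fun i => op (f i)) i)

omit [HComplete B] in
theorem rN_succ {i : ℕ} (hi : 1 ≤ i) :
    rN n e (i + 1) = rN n e i * e (i + 1) - qpow (-sg n i) • (e (i + 1) * rN n e i) :=
  rootN_succ n qpow e i hi

omit [HComplete B] in
theorem rP_succ {i : ℕ} (hi : 1 ≤ i) :
    rP n f (i + 1) = f (i + 1) * rP n f i - qpow (sg n i) • (rP n f i * f (i + 1)) := by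
  rw [rP, rootN_succ n _ _ i hi, neg_neg]; rfl

/-- Multiplying row i by s_{i−1} symmetrises the Cartan matrix; this is why q-powers of s_{i−1} h_i,
rather than of h_i, appear below. -/
theorem sg_mul_cartan (n i j : ℕ) : sg n (i - 1) * cartan n i j
    = (if i = j then sg n (i - 1) + sg n i else 0) - (if i + 1 = j then sg n i else 0)
      - (if i = j + 1 then sg n (i - 1) else 0) := by
  have h1 := sg_mul_self n (i - 1)
  rw [cartan, pow_add, ← sg_eq_pow, ← sg_eq_pow]
  split_ifs <;>
    first | ring1 | linear_combination sg n i * h1 | linear_combination -sg n i * h1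

/-- The Cartan elements `H_i`. -/
def hH (n : ℕ) (h : ℕ → B) (i : ℕ) : B :=
  ∑ p ∈ Finset.Icc 1 i, ((-1 : ℤ) ^ theta n (p - 1)) • h p

omit [Algebra ℂ⟦X⟧ B] [HComplete B] in
theorem hH_zero : hH n h 0 = 0 := by simp [hH]

omit [Algebra ℂ⟦X⟧ B] [HComplete B] in
theorem hH_succ (i : ℕ) : hH n h (i + 1) = hH n h i + sg n i • h (i + 1) := by
  rw [hH, Finset.sum_Icc_succ_top (by omega), ← hH, Nat.add_sub_cancel, sg_eq_pow]

/-- The weight of `e_k` with respect to `H_i`. -/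
def wH (n i k : ℕ) : ℤ :=
  (if k = 1 then 1 else 0) + sg n i * ((if i = k then 1 else 0) - (if i + 1 = k then 1 else 0))

/-- The symmetrised rows telescope: H_{i+1} − H_i = s_i h_{i+1}, and only the two neighbours of
position i + 1 and the constant contribution at k = 1 survive. -/
theorem wH_succ (n i k : ℕ) : wH n (i + 1) k = wH n i k + sg n i * cartan n (i + 1) k := by
  have h1 := sg_mul_cartan n (i + 1) k
  rw [Nat.add_sub_cancel] at h1
  rw [h1, wH, wH]
  simp only [add_left_inj]
  split_ifs <;> omega

theorem wH_zero (n k : ℕ) (hk : 1 ≤ k) : wH n 0 k = 0 := by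
  rw [wH, sg_eq, if_pos (Nat.zero_le n), if_neg (by omega : ¬0 = k)]
  split_ifs <;> omega

theorem cagWt_succ (n i j : ℕ) (hj : 1 ≤ j) : cagWt n i (j + 1) = cagWt n i j + wH n i (j + 1) := by
  rw [wH, cagWt, cagWt, ← sg_eq_pow]
  simp only [add_left_inj]
  split_ifs <;> omega

theorem cagWt_one (n i : ℕ) (hi : 1 ≤ i) : cagWt n i 1 = wH n i 1 := by
  rw [wH, cagWt, ← sg_eq_pow]
  split_ifs <;> omega

/-- The generator e_{l+1} is odd exactly when the sign changes from l to l + 1. -/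
theorem sg_swap {n l : ℕ} : tau ℂ⟦X⟧ n (l + 1) (l + 1) * (sg n l : ℂ⟦X⟧) = (sg n (l + 1) : ℂ⟦X⟧) := by
  rw [tau_eq _ _ _ (by omega), sg_eq, sg_eq]
  split_ifs <;> first | omega | simp

theorem sg_cast_mul_self (n i : ℕ) : (sg n i : ℂ⟦X⟧) * (sg n i : ℂ⟦X⟧) = 1 := by
  rw [← Int.cast_mul, sg_mul_self, Int.cast_one]

namespace IsChev

variable (H : IsChev n m h e f)
include H

theorem wt_h_e {i j : ℕ} (hi : 1 ≤ i ∧ i ≤ n + m) (hj : 1 ≤ j ∧ j ≤ n + m) :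
    HasWt (h i) (e j) (cartan n i j) := H.he i j hi hj

theorem wt_h_f {i j : ℕ} (hi : 1 ≤ i ∧ i ≤ n + m) (hj : 1 ≤ j ∧ j ≤ n + m) :
    HasWt (h i) (f j) (-cartan n i j) := by
  rw [HasWt, H.hf i j hi hj, Int.cast_neg, sub_eq_add_neg]

theorem wt_H_e {i k : ℕ} (hi : i ≤ n + m) (hk : 1 ≤ k ∧ k ≤ n + m) :
    HasWt (hH n h i) (e k) (wH n i k) := by
  induction i with
  | zero => rw [hH_zero, wH_zero n k hk.1]; exact HasWt.zero_left _
  | succ i ih =>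
    rw [hH_succ, wH_succ]
    exact (ih (by omega)).add ((H.wt_h_e ⟨by omega, hi⟩ hk).zsmul _)

theorem wt_H_f {i k : ℕ} (hi : i ≤ n + m) (hk : 1 ≤ k ∧ k ≤ n + m) :
    HasWt (hH n h i) (f k) (-wH n i k) := by
  induction i with
  | zero => rw [hH_zero, wH_zero n k hk.1]; exact HasWt.zero_left _
  | succ i ih =>
    rw [hH_succ, wH_succ, neg_add, ← mul_neg]
    exact (ih (by omega)).add ((H.wt_h_f ⟨by omega, hi⟩ hk).zsmul _)

theorem wt_H_N {i j : ℕ} (hi : 1 ≤ i ∧ i ≤ n + m) (hj : 1 ≤ j) (hj' : j ≤ n + m) :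
    HasWt (hH n h i) (rN n e j) (cagWt n i j) := by
  induction j, hj using Nat.le_induction with
  | base => rw [cagWt_one n i hi.1]; exact H.wt_H_e hi.2 ⟨le_rfl, hj'⟩
  | succ j hj ih =>
    have h1 := ih (by omega)
    have h2 := H.wt_H_e hi.2 (show 1 ≤ j + 1 ∧ j + 1 ≤ n + m by omega)
    rw [rN_succ hj, cagWt_succ n i j hj]
    exact (h1.mul h2).sub (((h2.mul h1).of_eq (add_comm _ _)).smul _)

theorem wt_H_P {i j : ℕ} (hi : 1 ≤ i ∧ i ≤ n + m) (hj : 1 ≤ j) (hj' : j ≤ n + m) :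
    HasWt (hH n h i) (rP n f j) (-cagWt n i j) := by
  induction j, hj using Nat.le_induction with
  | base => rw [cagWt_one n i hi.1]; exact H.wt_H_f hi.2 ⟨le_rfl, hj'⟩
  | succ j hj ih =>
    have h1 := ih (by omega)
    have h2 := H.wt_H_f hi.2 (show 1 ≤ j + 1 ∧ j + 1 ≤ n + m by omega)
    rw [rP_succ hj, cagWt_succ n i j hj, neg_add]
    exact ((h2.mul h1).of_eq (add_comm _ _)).sub ((h1.mul h2).smul _)

theorem commute_H (i j : ℕ) : Commute (hH n h i) (hH n h j) :=
  Commute.sum_left _ _ _ fun p _ => Commute.sum_right _ _ _ fun k _ =>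
    ((H.hh p k).smul_left _).smul_right _

theorem commute_H_h (i j : ℕ) : Commute (hH n h i) (h j) :=
  Commute.sum_left _ _ _ fun p _ => (H.hh p j).smul_left _

theorem halfN : IsHalfChev n (n + m) qpow e f (fun i => qE (sg n (i - 1) • h i))
    (fun i => qN (h i)) where
  serre := H.serre_e
  ef_ne := H.ef_ne
  ef_eq := H.ef_eq
  Q_comm i j hi hij hj := by
    have h1 := ((H.wt_h_e (i := j) (j := i) (by omega) (by omega)).zsmul (sg n (j - 1))).qE
    rw [sg_mul_cartan, if_neg (by omega), if_neg (by omega), if_neg (by omega), sub_zero, sub_zero,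
      qpow_zero, one_smul] at h1
    exact h1
  N_comm i j hi hij hj := by
    have h0 : cartan n j i = 0 := by
      rw [cartan, if_neg (by omega), if_neg (by omega), if_neg (by omega)]; simp
    have h1 := (H.wt_h_e (i := j) (j := i) (by omega) (by omega)).qN
    rw [h0, Int.cast_zero, add_zero] at h1
    exact h1
  Q_succ i hi hir := by
    have h1 := ((H.wt_h_e (i := i) (j := i + 1) (by omega) (by omega)).zsmul (sg n (i - 1))).qE
    rw [sg_mul_cartan, if_neg (by omega), if_pos rfl, if_neg (by omega), zero_sub, sub_zero] at h1
    exact h1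
  N_succ i hi hir := by
    have h0 : cartan n (i + 1) i = -1 := by
      rw [cartan, if_neg (by omega), if_neg (by omega), if_pos rfl]; simp
    have hw := H.wt_h_e (i := i + 1) (j := i) (by omega) (by omega)
    rw [h0] at hw
    have h2 : HasWt (sg n i • h (i + 1)) (e i) (-sg n i) := (hw.zsmul _).of_eq (by ring)
    simp only [Nat.add_sub_cancel]
    rw [hw.qN, ← mul_smul_comm, ← mul_sub, Int.cast_neg, Int.cast_one, ← sub_eq_add_neg,
      qN_sub_smul_qN, qE_mul (h2 : _ = _)]
    simp [smul_sub, sub_eq_add_neg]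

/-- Reversing products exchanges the roles of e and f and inverts q. Each rule for the a_i^- thus
yields one for the a_i^+ by reading it in the opposite algebra. -/
theorem halfP : IsHalfChev n (n + m) (fun a => qpow (-a)) (fun i => op (f i)) (fun i => op (e i))
    (fun i => op (qE (-(sg n (i - 1) • h i)))) (fun i => op (qN (h i))) where
  serre := by
    have hs := H.serre_f
    refine ⟨fun i j hij hji => ?_, ?_, fun i j hij hin => ?_, ?_⟩
    · rw [← op_mul, ← op_mul, hs.comm i j hij hji]
    · rw [← op_mul, hs.sq, op_zero]
    · refine unop_injective ?_
      have := hs.triple i j hij hin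
      rw [add_comm (qpow 1)] at this
      simp only [unop_add, unop_sub, unop_mul, unop_smul, unop_op, neg_neg, unop_zero]
      rw [← this]
      noncomm_ring
    · refine unop_injective ?_
      have := hs.additional
      have h1 := hs.comm n (n + 2) (by omega) (by omega)
      rw [add_comm (qpow 1)] at this
      simp only [unop_add, unop_sub, unop_mul, unop_smul, unop_op, neg_neg, unop_zero]
      -- Reversal permutes the first four terms of the additional relation and turns the last into
      -- f_{n+1} f_{n+2} f_n f_{n+1}; commuting f_n with f_{n+2} restores it.
      linear_combination (norm := (simp only [mul_sub, sub_mul, mul_add, add_mul, smul_mul_assoc, mul_smul_comm, smul_sub,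
      smul_add, smul_smul, mul_assoc, zero_mul, mul_zero, smul_zero]; module))
        this + (qpow (-1) + qpow 1) • (f (n + 1) * h1 * f (n + 1))
  ef_ne i j hij := by rw [← op_mul, ← op_mul, H.ef_ne j i hij.symm]
  ef_eq i hi := by
    rw [← op_mul, ← op_mul, H.ef_eq i hi, op_add, op_smul]
  Q_comm i j hi hij hj := by
    have h1 := ((H.wt_h_f (i := j) (j := i) (by omega) (by omega)).zsmul (sg n (j - 1))).neg.qE
    rw [mul_neg, neg_neg, sg_mul_cartan, if_neg (by omega), if_neg (by omega), if_neg (by omega),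
      sub_zero, sub_zero, qpow_zero, one_smul] at h1
    exact (Commute.op (show Commute _ _ from h1))
  N_comm i j hi hij hj := by
    have h0 : cartan n j i = 0 := by
      rw [cartan, if_neg (by omega), if_neg (by omega), if_neg (by omega)]; simp
    have h1 := (H.wt_h_f (i := j) (j := i) (by omega) (by omega)).qN
    rw [h0, neg_zero, Int.cast_zero, add_zero] at h1
    exact (Commute.op (show Commute _ _ from h1))
  Q_succ i hi hir := by
    have h1 := ((H.wt_h_f (i := i) (j := i + 1) (by omega) (by omega)).zsmul (sg n (i - 1))).neg.qE
    rw [mul_neg, neg_neg, sg_mul_cartan, if_neg (by omega), if_pos rfl, if_neg (by omega), zero_sub,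
      sub_zero] at h1
    have h2 := isQPow_qpow.mul_neg (sg n i)
    rw [neg_neg, ← op_mul, ← op_mul, ← op_smul, h1, smul_smul, h2, one_smul]
  N_succ i hi hir := by
    have h0 : cartan n (i + 1) i = -1 := by
      rw [cartan, if_neg (by omega), if_neg (by omega), if_pos rfl]; simp
    have hw := H.wt_h_f (i := i + 1) (j := i) (by omega) (by omega)
    rw [h0, neg_neg] at hw
    have h1 := qN_sub_smul_qN n i (-h (i + 1))
    have h2 := isQPow_qpow.mul_neg (sg n i)
    have h3 : -h (i + 1) - 1 = -(h (i + 1) + 1) := by abel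
    have h4 : (-(sg n i • h (i + 1))) = sg n i • (-h (i + 1) - 1) + (sg n i : B) := by
      rw [smul_sub, zsmul_eq_mul (1 : B), mul_one]; simp
    have hc : Commute (sg n i • (-h (i + 1) - 1)) ((sg n i : ℤ) : B) := Int.commute_cast _ _
    refine unop_injective ?_
    simp only [Nat.add_sub_cancel, neg_neg, unop_sub, unop_smul, unop_mul, unop_op]
    rw [hw.qN, Int.cast_one, ← mul_smul_comm, ← mul_sub, h4, qE_add hc, qE_intCast, ← h1, h3, qN_neg,
      qN_neg, ← Algebra.commutes, ← Algebra.smul_def, smul_sub, smul_neg, smul_neg, smul_neg,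
      smul_smul, h2, one_smul]
    congr 1
    abel

end IsChev
end RootVectors
end UqSl
end

noncomputable section

namespace UqSl

/-! ### Brackets of the root vectors with each other and with the Chevalley generators. -/

section RootRelations

variable {B : Type} [Ring B] [Algebra ℂ⟦X⟧ B] [HComplete B] {n m : ℕ} {h e f : ℕ → B}

open MulOpposite

theorem wH_succ_self (i : ℕ) (hi : 1 ≤ i) : wH n i (i + 1) = -sg n i := by
  rw [wH, if_neg (by omega), if_neg (by omega), if_pos rfl]; ring

theorem cagWt_self (n i : ℕ) : cagWt n i i = 1 + sg n i := by
  rw [cagWt, if_pos rfl, mul_one, sg_eq_pow]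

theorem cagWt_ne {n i j : ℕ} (hij : i ≠ j) : cagWt n i j = 1 := by
  rw [cagWt, if_neg hij, mul_zero, add_zero]

theorem commute_qE {x y : B} (h : Commute x y) : Commute (qE x) y := qE_mul h

theorem commute_qN {x y : B} (h : Commute x y) : Commute (qN x) y := qN_mul h

omit [HComplete B] in
theorem rN_one : rN n e 1 = e 1 := rfl

omit [HComplete B] in
theorem rP_one : rP n f 1 = f 1 := rfl

namespace IsChev

variable (H : IsChev n m h e f)
include H

theorem rN_mul_f {i j : ℕ} (hij : i < j) : rN n e i * f j = f j * rN n e i := H.halfN.comm_f hij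

theorem e_mul_rP {i j : ℕ} (hij : i < j) : e j * rP n f i = rP n f i * e j :=
  op_injective (H.halfP.comm_f hij)

theorem rN_mul_f_self {i : ℕ} (hi : 1 ≤ i) (hir : i + 1 ≤ n + m) :
    rN n e (i + 1) * f (i + 1) = tau ℂ⟦X⟧ n (i + 1) (i + 1) • (f (i + 1) * rN n e (i + 1))
      + qE (sg n i • h (i + 1)) * rN n e i :=
  H.halfN.rootN_mul_f hi hir

theorem e_mul_rP_self {i : ℕ} (hi : 1 ≤ i) (hir : i + 1 ≤ n + m) :
    e (i + 1) * rP n f (i + 1) = tau ℂ⟦X⟧ n (i + 1) (i + 1) • (rP n f (i + 1) * e (i + 1))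
      + rP n f i * qE (-(sg n i • h (i + 1))) :=
  op_injective (H.halfP.rootN_mul_f hi hir)

theorem rN_mul_f_of_lt {i j : ℕ} (hj : 2 ≤ j) (hij : j < i) (hir : i ≤ n + m) :
    rN n e i * f j = tau ℂ⟦X⟧ n j i • (f j * rN n e i) := H.halfN.f_mul_rootN hj hij hir

theorem e_mul_rP_of_lt {i j : ℕ} (hj : 2 ≤ j) (hij : j < i) (hir : i ≤ n + m) :
    e j * rP n f i = tau ℂ⟦X⟧ n j i • (rP n f i * e j) :=
  op_injective (H.halfP.f_mul_rootN hj hij hir)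

theorem rN_mul_e_far {i j : ℕ} (hij : i + 2 ≤ j) : rN n e i * e j = e j * rN n e i :=
  H.serre_e.far hij

theorem f_mul_rP_far {i j : ℕ} (hij : i + 2 ≤ j) : f j * rP n f i = rP n f i * f j :=
  op_injective (H.halfP.serre.far hij)

theorem rN_mul_e_self {i : ℕ} (hi : 1 ≤ i) : rN n e (i + 1) * e (i + 1)
    = (tau ℂ⟦X⟧ n (i + 1) (i + 1) * qpow (sg n (i + 1))) • (e (i + 1) * rN n e (i + 1)) :=
  H.serre_e.rootN_succ_mul isQPow_qpow hi

theorem f_mul_rP_self {i : ℕ} (hi : 1 ≤ i) : f (i + 1) * rP n f (i + 1)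
    = (tau ℂ⟦X⟧ n (i + 1) (i + 1) * qpow (-sg n (i + 1))) • (rP n f (i + 1) * f (i + 1)) :=
  op_injective (H.halfP.serre.rootN_succ_mul isQPow_qpow.neg hi)

theorem e_mul_rN_of_lt {i j : ℕ} (hj : 2 ≤ j) (hij : j < i) :
    e j * rN n e i = tau ℂ⟦X⟧ n j i • (rN n e i * e j) := H.serre_e.comm_rootN isQPow_qpow hj hij

theorem rP_mul_f_of_lt {i j : ℕ} (hj : 2 ≤ j) (hij : j < i) :
    rP n f i * f j = tau ℂ⟦X⟧ n j i • (f j * rP n f i) :=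
  op_injective (H.halfP.serre.comm_rootN isQPow_qpow.neg hj hij)

/-- Since e_{i+1} commutes with a_i^+, the bracket reduces to the q-bracket of [H_i] with e_{i+1},
evaluated by `qN_sub_sg`. The diagonal identity `h0` is a hypothesis because this lemma is itself
used in the induction proving that identity. -/
theorem N_mul_P_succ_of {i : ℕ} (hi : 1 ≤ i) (hir : i + 1 ≤ n + m)
    (h0 : rN n e i * rP n f i - (sg n i : ℂ⟦X⟧) • (rP n f i * rN n e i) = qN (hH n h i)) :
    rN n e (i + 1) * rP n f i - (sg n i : ℂ⟦X⟧) • (rP n f i * rN n e (i + 1))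
      = -(sg n i : ℂ⟦X⟧) • (e (i + 1) * qE (-hH n h i)) := by
  have h1 := H.e_mul_rP (show i < i + 1 by omega)
  have hw := H.wt_H_e (i := i) (k := i + 1) (by omega) (by omega)
  rw [wH_succ_self i hi] at hw
  have h2 := hw.qN
  have h3 := congrArg (e (i + 1) * ·) (qN_sub_sg n i (hH n h i))
  rw [Int.cast_neg, ← sub_eq_add_neg] at h2
  rw [mul_sub, ← h2, mul_smul_comm, mul_smul_comm, ← Int.cast_smul_eq_zsmul ℂ⟦X⟧, Int.cast_neg] at h3
  rw [rN_succ hi]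
  linear_combination (norm := (simp only [mul_sub, sub_mul, mul_add, add_mul, smul_mul_assoc, mul_smul_comm, smul_sub,
      smul_add, smul_smul, mul_assoc, zero_mul, mul_zero, smul_zero]; module))
    h3 + h0 * e (i + 1) - qpow (-sg n i) • (e (i + 1) * h0) + rN n e i * h1
    + (sg n i * qpow (-sg n i) : ℂ⟦X⟧) • (-h1 * rN n e i)

theorem N_mul_P_pred_of {i : ℕ} (hi : 1 ≤ i) (hir : i + 1 ≤ n + m)
    (h0 : rN n e i * rP n f i - (sg n i : ℂ⟦X⟧) • (rP n f i * rN n e i) = qN (hH n h i)) :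
    rN n e i * rP n f (i + 1) - (sg n i : ℂ⟦X⟧) • (rP n f (i + 1) * rN n e i)
      = -(sg n i : ℂ⟦X⟧) • (qE (hH n h i) * f (i + 1)) := by
  have h1 := H.rN_mul_f (show i < i + 1 by omega)
  have hw := H.wt_H_f (i := i) (k := i + 1) (by omega) (by omega)
  rw [wH_succ_self i hi, neg_neg] at hw
  have h2 := hw.qN
  have h4 := hw.qE
  have h3 := congrArg (f (i + 1) * ·) (qN_sub_sg n i (-hH n h i))
  have h6 := isQPow_qpow.mul_neg (sg n i)
  rw [neg_neg, ← neg_add', qN_neg, qN_neg, mul_sub, mul_neg, ← h2, mul_smul_comm,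
    mul_neg, mul_smul_comm, ← Int.cast_smul_eq_zsmul ℂ⟦X⟧, Int.cast_neg] at h3
  rw [rP_succ hi]
  linear_combination (norm := (simp only [mul_sub, sub_mul, mul_add, add_mul, smul_mul_assoc, mul_smul_comm, smul_sub,
      smul_add, smul_smul, mul_assoc, zero_mul, mul_zero, smul_zero]; module))
    qpow (sg n i) • h3 + (sg n i : ℂ⟦X⟧) • h4 + f (i + 1) * h0 - qpow (sg n i) • (h0 * f (i + 1))
    + h1 * rP n f i - (sg n i * qpow (sg n i) : ℂ⟦X⟧) • (rP n f i * h1)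
    - h6 • (f (i + 1) * qN (hH n h i))

/-- Induction on i, expanding a_{i+1}^+ as a q-bracket of f_{i+1} and a_i^+. Moving a_{i+1}^-
through it produces [H_i] q^{s_i h_{i+1}} from the inductive hypothesis and s_i q^{−H_i} [h_{i+1}]
from ⟦e_{i+1}, f_{i+1}⟧, and these add up to [H_{i+1}]. -/
theorem N_mul_P_self {i : ℕ} (hi : 1 ≤ i) (hir : i ≤ n + m) :
    rN n e i * rP n f i - (sg n i : ℂ⟦X⟧) • (rP n f i * rN n e i) = qN (hH n h i) := by
  induction i, hi using Nat.le_induction with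
  | base =>
    have h1 := H.ef_eq 1 le_rfl
    have h2 : tau ℂ⟦X⟧ n 1 1 = (sg n 1 : ℂ⟦X⟧) := by
      rw [← sg_swap (l := 0), sg_eq n 0]; simp
    rw [rN_one, rP_one, h1, h2, add_sub_cancel_left, ← zero_add 1, hH_succ, hH_zero, sg_eq]
    simp
  | succ i hi ih =>
    have ih := ih (by omega)
    have h1 := H.N_mul_P_succ_of hi hir ih
    have h2 := H.rN_mul_f_self hi hir
    have h3 := H.ef_eq (i + 1) (by omega)
    have h4 : qE (sg n i • h (i + 1)) * rP n f i
        = qpow (sg n i) • (rP n f i * qE (sg n i • h (i + 1))) := by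
      have hw := (H.wt_H_P (i := i + 1) (j := i) (by omega) hi (by omega)).add
        (H.wt_H_P (i := i) (j := i) (by omega) hi (by omega)).neg
      rw [hH_succ, add_neg_cancel_comm, cagWt_ne (by omega : i + 1 ≠ i), cagWt_self] at hw
      simpa using hw.qE
    have h5 := (H.wt_H_f (i := i) (k := i + 1) (by omega) (by omega)).neg.qE
    rw [neg_neg, wH_succ_self i hi] at h5
    have h6 := isQPow_qpow.mul_neg (sg n i)
    have h7 := sg_cast_mul_self n i
    have h8 : qN (hH n h (i + 1)) = qN (hH n h i) * qE (sg n i • h (i + 1))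
        + qE (-hH n h i) * ((sg n i : ℂ⟦X⟧) • qN (h (i + 1))) := by
      rw [hH_succ, qN_add ((H.commute_H_h i (i + 1)).smul_right _)]
      congr 2
      rw [sg_eq]; split_ifs
      · simp
      · rw [neg_one_smul, qN_neg]; simp
    have h9 : Commute (qN (hH n h i)) (qE (sg n i • h (i + 1))) :=
      commute_qN (commute_qE ((H.commute_H_h i (i + 1)).symm.smul_left _)).symm
    have h10 : Commute (qE (-hH n h i)) (qN (h (i + 1))) :=
      commute_qE (commute_qN (H.commute_H_h i (i + 1)).symm.neg_right).symm
    have h9 := h9.eq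
    have h10 := h10.eq
    rw [h8, rP_succ hi, ← sg_swap]
    linear_combination (norm := (simp only [mul_sub, sub_mul, mul_add, add_mul, smul_mul_assoc, mul_smul_comm, smul_sub,
      smul_add, smul_smul, mul_assoc, zero_mul, mul_zero, smul_zero]; module))
      h2 * rP n f i - qpow (sg n i) • (h1 * f (i + 1))
      + tau ℂ⟦X⟧ n (i + 1) (i + 1) • (f (i + 1) * h1)
      - (qpow (sg n i) * (sg n i : ℂ⟦X⟧)) • (rP n f i * h2)
      + qE (sg n i • h (i + 1)) * ih + (sg n i : ℂ⟦X⟧) • (h4 * rN n e i)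
      - h9 + (sg n i : ℂ⟦X⟧) • (h3 * qE (-hH n h i)) - (sg n i : ℂ⟦X⟧) • h10
      + (qpow (sg n i) * (sg n i : ℂ⟦X⟧)) • (e (i + 1) * h5)
      + h6 • ((sg n i : ℂ⟦X⟧) • (e (i + 1) * f (i + 1) * qE (-hH n h i)))

theorem N_mul_P_succ {i : ℕ} (hi : 1 ≤ i) (hir : i + 1 ≤ n + m) :
    rN n e (i + 1) * rP n f i - (sg n i : ℂ⟦X⟧) • (rP n f i * rN n e (i + 1))
      = -(sg n i : ℂ⟦X⟧) • (e (i + 1) * qE (-hH n h i)) :=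
  H.N_mul_P_succ_of hi hir (H.N_mul_P_self hi (by omega))

theorem N_mul_P_pred {i : ℕ} (hi : 1 ≤ i) (hir : i + 1 ≤ n + m) :
    rN n e i * rP n f (i + 1) - (sg n i : ℂ⟦X⟧) • (rP n f (i + 1) * rN n e i)
      = -(sg n i : ℂ⟦X⟧) • (qE (hH n h i) * f (i + 1)) :=
  H.N_mul_P_pred_of hi hir (H.N_mul_P_self hi (by omega))

theorem L_mul_N {i k : ℕ} (hi : 1 ≤ i ∧ i ≤ n + m) (hk : 1 ≤ k ∧ k ≤ n + m) :
    qE (hH n h i) * rN n e k = qpow (cagWt n i k) • (rN n e k * qE (hH n h i)) :=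
  (H.wt_H_N hi hk.1 hk.2).qE

theorem Lb_mul_N {i k : ℕ} (hi : 1 ≤ i ∧ i ≤ n + m) (hk : 1 ≤ k ∧ k ≤ n + m) :
    qE (-hH n h i) * rN n e k = qpow (-cagWt n i k) • (rN n e k * qE (-hH n h i)) :=
  (H.wt_H_N hi hk.1 hk.2).neg.qE

theorem L_mul_P {i k : ℕ} (hi : 1 ≤ i ∧ i ≤ n + m) (hk : 1 ≤ k ∧ k ≤ n + m) :
    qE (hH n h i) * rP n f k = qpow (-cagWt n i k) • (rP n f k * qE (hH n h i)) :=
  (H.wt_H_P hi hk.1 hk.2).qE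

theorem Lb_mul_P {i k : ℕ} (hi : 1 ≤ i ∧ i ≤ n + m) (hk : 1 ≤ k ∧ k ≤ n + m) :
    qE (-hH n h i) * rP n f k = qpow (cagWt n i k) • (rP n f k * qE (-hH n h i)) := by
  have := (H.wt_H_P hi hk.1 hk.2).neg.qE
  rwa [neg_neg] at this

theorem qE_H_succ (l : ℕ) :
    qE (hH n h (l + 1)) = qE (hH n h l) * qE (sg n l • h (l + 1)) := by
  rw [hH_succ, qE_add ((H.commute_H_h l (l + 1)).smul_right _)]

theorem qE_neg_H_succ (l : ℕ) :
    qE (-hH n h (l + 1)) = qE (-(sg n l • h (l + 1))) * qE (-hH n h l) := by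
  rw [hH_succ, neg_add_rev, qE_add
    ((H.commute_H_h l (l + 1)).symm.smul_left _).neg_left.neg_right]

/-- Except for k = l + 1, the vector a_k^- commutes with f_{l+1} up to sign, so only the weight of
a_k^- under H_l enters. For k = l + 1 the last letter is removed, and L_l q^{s_l h_{l+1}} = L_{l+1}.
-/
theorem f_bracket_N {l k : ℕ} (hl : 1 ≤ l) (hlr : l + 1 ≤ n + m) (hk : 1 ≤ k ∧ k ≤ n + m) :
    (qE (hH n h l) * f (l + 1)) * rN n e k
      - (tau ℂ⟦X⟧ n (l + 1) k * qpow (cagWt n l k)) • (rN n e k * (qE (hH n h l) * f (l + 1)))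
      = if k = l + 1 then -tau ℂ⟦X⟧ n (l + 1) k • (qE (hH n h k) * rN n e l) else 0 := by
  have h1 := H.L_mul_N (i := l) (k := k) (by omega) hk
  have ht := tau_mul_self (K := ℂ⟦X⟧) n (l + 1) k
  split_ifs with hkl
  · subst hkl
    have h2 := H.rN_mul_f_self hl hlr
    rw [H.qE_H_succ]
    linear_combination (norm := (simp only [mul_sub, sub_mul, mul_add, add_mul, smul_mul_assoc, mul_smul_comm, smul_sub,
      smul_add, smul_smul, mul_assoc, zero_mul, mul_zero, smul_zero]; module))
      tau ℂ⟦X⟧ n (l + 1) (l + 1) • (h1 * f (l + 1))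
      - tau ℂ⟦X⟧ n (l + 1) (l + 1) • (qE (hH n h l) * h2)
      - ht • (qE (hH n h l) * f (l + 1) * rN n e (l + 1))
  · have h2 : rN n e k * f (l + 1) = tau ℂ⟦X⟧ n (l + 1) k • (f (l + 1) * rN n e k) := by
      rcases lt_or_gt_of_ne hkl with hlt | hgt
      · rw [H.rN_mul_f hlt, tau_eq _ _ _ (by omega), if_neg (by omega), one_smul]
      · exact H.rN_mul_f_of_lt (by omega) hgt hk.2
    linear_combination (norm := (simp only [mul_sub, sub_mul, mul_add, add_mul, smul_mul_assoc, mul_smul_comm, smul_sub,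
      smul_add, smul_smul, mul_assoc, zero_mul, mul_zero, smul_zero]; module))
      tau ℂ⟦X⟧ n (l + 1) k • (h1 * f (l + 1)) - tau ℂ⟦X⟧ n (l + 1) k • (qE (hH n h l) * h2)
      - ht • (qE (hH n h l) * f (l + 1) * rN n e k)

theorem e_bracket_P {l k : ℕ} (hl : 1 ≤ l) (hlr : l + 1 ≤ n + m) (hk : 1 ≤ k ∧ k ≤ n + m) :
    (e (l + 1) * qE (-hH n h l)) * rP n f k
      - (tau ℂ⟦X⟧ n (l + 1) k * qpow (cagWt n l k)) • (rP n f k * (e (l + 1) * qE (-hH n h l)))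
      = if k = l + 1 then qE (-hH n h k) * rP n f l else 0 := by
  have h1 := H.Lb_mul_P (i := l) (k := k) (by omega) hk
  split_ifs with hkl
  · subst hkl
    have h2 := H.e_mul_rP_self hl hlr
    have h3 := H.Lb_mul_P (i := l + 1) (k := l) (by omega) (by omega)
    rw [cagWt_ne (by omega : l ≠ l + 1)] at *
    rw [cagWt_ne (by omega : l + 1 ≠ l)] at h3
    rw [h3, H.qE_neg_H_succ]
    linear_combination (norm := (simp only [mul_sub, sub_mul, mul_add, add_mul, smul_mul_assoc, mul_smul_comm, smul_sub,
      smul_add, smul_smul, mul_assoc, zero_mul, mul_zero, smul_zero]; module))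
      e (l + 1) * h1 + qpow 1 • (h2 * qE (-hH n h l))
  · have h2 : e (l + 1) * rP n f k = tau ℂ⟦X⟧ n (l + 1) k • (rP n f k * e (l + 1)) := by
      rcases lt_or_gt_of_ne hkl with hlt | hgt
      · rw [H.e_mul_rP hlt, tau_eq _ _ _ (by omega), if_neg (by omega), one_smul]
      · exact H.e_mul_rP_of_lt (by omega) hgt hk.2
    linear_combination (norm := (simp only [mul_sub, sub_mul, mul_add, add_mul, smul_mul_assoc, mul_smul_comm, smul_sub,
      smul_add, smul_smul, mul_assoc, zero_mul, mul_zero, smul_zero]; module))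
      e (l + 1) * h1 + qpow (cagWt n l k) • (h2 * qE (-hH n h l))

/-- For k = l the bracket is the definition of a_{l+1}^-. For k = l + 1 the q-commutation of e_{l+1}
with a_{l+1}^- supplies the extra power of q, which is why the weight here is that of index l + 1.
All other k commute with e_{l+1} up to sign. -/
theorem e_bracket_N {l k : ℕ} (hl : 1 ≤ l) (hlr : l + 1 ≤ n + m) (hk : 1 ≤ k ∧ k ≤ n + m) :
    (e (l + 1) * qE (-hH n h l)) * rN n e k
      - (tau ℂ⟦X⟧ n (l + 1) k * qpow (-cagWt n (l + 1) k))
        • (rN n e k * (e (l + 1) * qE (-hH n h l)))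
      = if k = l then -(qE (-hH n h k) * rN n e (l + 1)) else 0 := by
  have h1 := H.Lb_mul_N (i := l) (k := k) (by omega) hk
  split_ifs with hkl
  · subst hkl
    have h3 := H.Lb_mul_N (i := k) (k := k + 1) (by omega) (by omega)
    have h4 := qpow_add (-1) (-sg n k)
    rw [cagWt_ne (by omega : k ≠ k + 1)] at h3
    rw [cagWt_self, neg_add, h4] at h1
    rw [h3, rN_succ hl, cagWt_ne (by omega : k + 1 ≠ k), tau_eq _ _ _ (by omega),
      if_neg (by omega)]
    linear_combination (norm := (simp only [mul_sub, sub_mul, mul_add, add_mul, smul_mul_assoc, mul_smul_comm, smul_sub,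
      smul_add, smul_smul, mul_assoc, zero_mul, mul_zero, smul_zero]; module))
      e (k + 1) * h1
  · by_cases hk1 : k = l + 1
    · subst hk1
      have h2 := H.rN_mul_e_self hl
      have h4 := qpow_add (-1) (-sg n (l + 1))
      have h5 := isQPow_qpow.mul_neg (sg n (l + 1))
      have ht := tau_mul_self (K := ℂ⟦X⟧) n (l + 1) (l + 1)
      rw [cagWt_ne (by omega : l ≠ l + 1)] at h1
      rw [cagWt_self, neg_add, h4]
      linear_combination (norm := (simp only [mul_sub, sub_mul, mul_add, add_mul, smul_mul_assoc, mul_smul_comm, smul_sub,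
      smul_add, smul_smul, mul_assoc, zero_mul, mul_zero, smul_zero]; module))
        e (l + 1) * h1
        - (tau ℂ⟦X⟧ n (l + 1) (l + 1) * (qpow (-1) * qpow (-sg n (l + 1)))) • (h2 * qE (-hH n h l))
        - (qpow (-1) * h5) • (e (l + 1) * rN n e (l + 1) * qE (-hH n h l))
        - (qpow (-1) * qpow (sg n (l + 1)) * qpow (-sg n (l + 1)) * ht)
          • (e (l + 1) * rN n e (l + 1) * qE (-hH n h l))
    · have h2 : e (l + 1) * rN n e k = tau ℂ⟦X⟧ n (l + 1) k • (rN n e k * e (l + 1)) := by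
        rcases lt_or_gt_of_ne hk1 with hlt | hgt
        · rw [H.rN_mul_e_far (show k + 2 ≤ l + 1 by omega), tau_eq _ _ _ (by omega),
            if_neg (by omega), one_smul]
        · exact H.e_mul_rN_of_lt (by omega) hgt
      rw [cagWt_ne (Ne.symm hkl)] at h1
      rw [cagWt_ne (Ne.symm hk1)]
      linear_combination (norm := (simp only [mul_sub, sub_mul, mul_add, add_mul, smul_mul_assoc, mul_smul_comm, smul_sub,
      smul_add, smul_smul, mul_assoc, zero_mul, mul_zero, smul_zero]; module))
        e (l + 1) * h1 + qpow (-1) • (h2 * qE (-hH n h l))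

theorem f_bracket_P {l k : ℕ} (hl : 1 ≤ l) (hlr : l + 1 ≤ n + m) (hk : 1 ≤ k ∧ k ≤ n + m) :
    (qE (hH n h l) * f (l + 1)) * rP n f k
      - (tau ℂ⟦X⟧ n (l + 1) k * qpow (-cagWt n (l + 1) k))
        • (rP n f k * (qE (hH n h l) * f (l + 1)))
      = if k = l then qE (hH n h k) * rP n f (l + 1) else 0 := by
  have h1 := H.L_mul_P (i := l) (k := k) (by omega) hk
  have h5 := isQPow_qpow.mul_neg (cagWt n l k)
  have h1' : rP n f k * qE (hH n h l) = qpow (cagWt n l k) • (qE (hH n h l) * rP n f k) := by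
    rw [h1, smul_smul, h5, one_smul]
  split_ifs with hkl
  · subst hkl
    have h4 := qpow_add (-1) (1 + sg n k)
    rw [neg_add_cancel_left] at h4
    rw [cagWt_self] at h1'
    rw [rP_succ hl, cagWt_ne (by omega : k + 1 ≠ k), tau_eq _ _ _ (by omega),
      if_neg (by omega), h4]
    linear_combination (norm := (simp only [mul_sub, sub_mul, mul_add, add_mul, smul_mul_assoc, mul_smul_comm, smul_sub,
      smul_add, smul_smul, mul_assoc, zero_mul, mul_zero, smul_zero]; module))
      - qpow (-1) • (h1' * f (k + 1))
  · by_cases hk1 : k = l + 1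
    · subst hk1
      have h2 := H.f_mul_rP_self hl
      have h4 := qpow_add (-1) (-sg n (l + 1))
      have h6 := isQPow_qpow.mul_neg 1
      rw [cagWt_ne (by omega : l ≠ l + 1)] at h1'
      rw [cagWt_self, neg_add, h4]
      linear_combination (norm := (simp only [mul_sub, sub_mul, mul_add, add_mul, smul_mul_assoc, mul_smul_comm, smul_sub,
      smul_add, smul_smul, mul_assoc, zero_mul, mul_zero, smul_zero]; module))
        qE (hH n h l) * h2
        - (tau ℂ⟦X⟧ n (l + 1) (l + 1) * (qpow (-1) * qpow (-sg n (l + 1)))) • (h1' * f (l + 1))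
        - (tau ℂ⟦X⟧ n (l + 1) (l + 1) * qpow (-sg n (l + 1)) * h6)
          • (qE (hH n h l) * rP n f (l + 1) * f (l + 1))
    · have h2 : f (l + 1) * rP n f k = tau ℂ⟦X⟧ n (l + 1) k • (rP n f k * f (l + 1)) := by
        rcases lt_or_gt_of_ne hk1 with hlt | hgt
        · rw [H.f_mul_rP_far (show k + 2 ≤ l + 1 by omega), tau_eq _ _ _ (by omega),
            if_neg (by omega), one_smul]
        · rw [H.rP_mul_f_of_lt (by omega) hgt, smul_smul, tau_mul_self, one_smul]
      have h6 := isQPow_qpow.mul_neg 1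
      rw [cagWt_ne (Ne.symm hkl)] at h1'
      rw [cagWt_ne (Ne.symm hk1)]
      linear_combination (norm := (simp only [mul_sub, sub_mul, mul_add, add_mul, smul_mul_assoc, mul_smul_comm, smul_sub,
      smul_add, smul_smul, mul_assoc, zero_mul, mul_zero, smul_zero]; module))
        qE (hH n h l) * h2 - (tau ℂ⟦X⟧ n (l + 1) k * qpow (-1)) • (h1' * f (l + 1))
        - (tau ℂ⟦X⟧ n (l + 1) k * h6) • (qE (hH n h l) * rP n f k * f (l + 1))

end IsChev
end RootRelations
end UqSl
end

noncomputable section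

namespace UqSl

/-! ### Families satisfying the relations of creation and annihilation generators -/

section IsCag

variable {B : Type} [Ring B] [Algebra ℂ⟦X⟧ B]

/-- The supercommutator `⟦a_i^ξ, a_j^η⟧`. -/
def scomm (n : ℕ) (a : ℤˣ → ℕ → B) (ξ η : ℤˣ) (i j : ℕ) : B :=
  a ξ i * a η j - ((-1 : ℂ⟦X⟧) ^ (theta n i * theta n j)) • (a η j * a ξ i)

/-- The relations of `UqCag n m`. -/
structure IsCag [HComplete B] (n m : ℕ) (H : ℕ → B) (a : ℤˣ → ℕ → B) : Prop where
  HH : ∀ i j, 1 ≤ i ∧ i ≤ n + m → 1 ≤ j ∧ j ≤ n + m → Commute (H i) (H j)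
  Ha : ∀ (ξ : ℤˣ) i j, 1 ≤ i ∧ i ≤ n + m → 1 ≤ j ∧ j ≤ n + m →
    HasWt (H i) (a ξ j) (-((ξ : ℤ) * cagWt n i j))
  aa : ∀ i, 1 ≤ i ∧ i ≤ n + m → scomm n a (-1) 1 i i = qN (H i)
  triple : ∀ (ξ η : ℤˣ) i j k, 1 ≤ i ∧ i ≤ n + m → 1 ≤ j ∧ j ≤ n + m → 1 ≤ k ∧ k ≤ n + m →
    (j : ℤ) = i + (ξ : ℤ) →
    scomm n a η (-η) i j * a η k
      - ((-1) ^ ((theta n i + theta n j) * theta n k) * qpow ((ξ : ℤ) * cagWt n i k))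
        • (a η k * scomm n a η (-η) i j)
      = if k = j then ((η : ℤ) ^ theta n k) • (qE ((-((ξ : ℤ) * (η : ℤ))) • H k) * a η i) else 0
  a12 : ∀ ξ, 2 ≤ n + m →
    a ξ 1 * a ξ 2 - ((-1) ^ (theta n 1 * theta n 2) * qpow 1) • (a ξ 2 * a ξ 1) = 0
  a11 : ∀ ξ, 1 ≤ n + m → scomm n a ξ ξ 1 1 = 0

end IsCag

/-! ### The root vectors satisfy the relations of U'. -/

section

variable {B : Type} [Ring B] [Algebra ℂ⟦X⟧ B] {n m : ℕ} {h e f : ℕ → B}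

/-- The family `a_i^±` built from Chevalley generators. -/
def ra (n : ℕ) (e f : ℕ → B) (ξ : ℤˣ) (i : ℕ) : B := if ξ = 1 then rP n f i else rN n e i

theorem ra_one (i : ℕ) : ra n e f 1 i = rP n f i := if_pos rfl

theorem ra_neg_one (i : ℕ) : ra n e f (-1) i = rN n e i := if_neg (by decide)

theorem neg_one_pow_theta_succ (n i : ℕ) :
    (-1 : ℂ⟦X⟧) ^ (theta n i * theta n (i + 1)) = (sg n i : ℂ⟦X⟧) := by
  rw [sg_eq, theta, theta]; split_ifs <;> first | omega | simp

theorem neg_one_pow_theta_self (n i : ℕ) :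
    (-1 : ℂ⟦X⟧) ^ (theta n i * theta n i) = (sg n i : ℂ⟦X⟧) := by
  rw [sg_eq, theta]; split_ifs <;> simp

theorem neg_one_pow_tau (n l k : ℕ) :
    (-1 : ℂ⟦X⟧) ^ ((theta n l + theta n (l + 1)) * theta n k) = tau ℂ⟦X⟧ n (l + 1) k := rfl

variable [HComplete B]

namespace IsChev

variable (H : IsChev n m h e f)
include H

/-- This and the next three identities turn double brackets of a^± into Chevalley generators times
q^{±H_l}. They reduce the triple relations to the bracket lemmas above; the two with a^- first,
solved for e_{l+1} and f_{l+1}, are the inverse formulas. -/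
theorem scomm_N_succ {l : ℕ} (hl : 1 ≤ l) (hlr : l + 1 ≤ n + m) :
    scomm n (ra n e f) (-1) 1 (l + 1) l = -(sg n l : ℂ⟦X⟧) • (e (l + 1) * qE (-hH n h l)) := by
  rw [scomm, ra_one, ra_neg_one, mul_comm, neg_one_pow_theta_succ, H.N_mul_P_succ hl hlr]

theorem scomm_N_pred {l : ℕ} (hl : 1 ≤ l) (hlr : l + 1 ≤ n + m) :
    scomm n (ra n e f) (-1) 1 l (l + 1) = -(sg n l : ℂ⟦X⟧) • (qE (hH n h l) * f (l + 1)) := by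
  rw [scomm, ra_one, ra_neg_one, neg_one_pow_theta_succ, H.N_mul_P_pred hl hlr]

theorem scomm_P_succ {l : ℕ} (hl : 1 ≤ l) (hlr : l + 1 ≤ n + m) :
    scomm n (ra n e f) 1 (-1) (l + 1) l = qE (hH n h l) * f (l + 1) := by
  have h1 := H.N_mul_P_pred hl hlr
  have h2 := sg_cast_mul_self n l
  rw [scomm, ra_one, ra_neg_one, mul_comm, neg_one_pow_theta_succ]
  linear_combination (norm := (simp only [mul_sub, sub_mul, mul_add, add_mul, smul_mul_assoc, mul_smul_comm, smul_sub,
      smul_add, smul_smul, mul_assoc, zero_mul, mul_zero, smul_zero]; module))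
    -(sg n l : ℂ⟦X⟧) • h1 + h2 • (qE (hH n h l) * f (l + 1)) - h2 • (rP n f (l + 1) * rN n e l)

theorem scomm_P_pred {l : ℕ} (hl : 1 ≤ l) (hlr : l + 1 ≤ n + m) :
    scomm n (ra n e f) 1 (-1) l (l + 1) = e (l + 1) * qE (-hH n h l) := by
  have h1 := H.N_mul_P_succ hl hlr
  have h2 := sg_cast_mul_self n l
  rw [scomm, ra_one, ra_neg_one, neg_one_pow_theta_succ]
  linear_combination (norm := (simp only [mul_sub, sub_mul, mul_add, add_mul, smul_mul_assoc, mul_smul_comm, smul_sub,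
      smul_add, smul_smul, mul_assoc, zero_mul, mul_zero, smul_zero]; module))
    -(sg n l : ℂ⟦X⟧) • h1 + h2 • (e (l + 1) * qE (-hH n h l)) - h2 • (rP n f l * rN n e (l + 1))

/-- The triple relations split into four cases by the signs ξ and η, one for each of `e_bracket_P`,
`f_bracket_N`, `f_bracket_P`, `e_bracket_N`. -/
theorem isCag : IsCag n m (hH n h) (ra n e f) where
  HH i j _ _ := H.commute_H i j
  Ha ξ i j hi hj := by
    obtain rfl | rfl := Int.units_eq_one_or ξ
    · simpa [ra_one] using H.wt_H_P hi hj.1 hj.2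
    · simpa [ra_neg_one] using H.wt_H_N hi hj.1 hj.2
  aa i hi := by
    rw [scomm, ra_one, ra_neg_one, neg_one_pow_theta_self, H.N_mul_P_self hi.1 hi.2]
  triple ξ η i j k hi hj hk hij := by
    obtain rfl | rfl := Int.units_eq_one_or ξ
    · obtain rfl : j = i + 1 := by simpa [← @Nat.cast_inj ℤ] using hij
      have hir := hj.2
      obtain rfl | rfl := Int.units_eq_one_or η
      · have := H.e_bracket_P hi.1 hir hk
        rw [H.scomm_P_pred hi.1 hir, ra_one, ra_one, neg_one_pow_tau]
        simpa using this
      · have h1 := H.f_bracket_N hi.1 hir hk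
        rw [neg_neg, H.scomm_N_pred hi.1 hir, ra_neg_one, ra_neg_one, neg_one_pow_tau]
        have h2 := congrArg (-(sg n i : ℂ⟦X⟧) • ·) h1
        simp only [smul_sub, smul_ite, smul_zero] at h2
        rw [smul_mul_assoc, mul_smul_comm, smul_comm _ (-(sg n i : ℂ⟦X⟧)), Units.val_one, one_mul]
        refine h2.trans ?_
        split_ifs with hki
        · subst hki
          have h3 : (((-1 : ℤˣ) : ℤ) ^ theta n (i + 1)) = sg n (i + 1) := by
            rw [sg_eq_pow]; rfl
          rw [h3, smul_smul, neg_mul_neg, mul_comm, sg_swap, Int.cast_smul_eq_zsmul]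
          simp
        · rfl
    · obtain ⟨l, rfl⟩ := Nat.exists_eq_add_of_le' hi.1
      obtain rfl : j = l := by
        have : (j : ℤ) = l := by simpa using hij
        exact_mod_cast this
      have hlr := hi.2
      obtain rfl | rfl := Int.units_eq_one_or η
      · have := H.f_bracket_P hj.1 hlr hk
        rw [H.scomm_P_succ hj.1 hlr, ra_one, ra_one, add_comm (theta n (j + 1)), neg_one_pow_tau]
        simpa using this
      · have h1 := H.e_bracket_N hj.1 hlr hk
        rw [neg_neg, H.scomm_N_succ hj.1 hlr, ra_neg_one, ra_neg_one, add_comm (theta n (j + 1)),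
          neg_one_pow_tau]
        have h2 := congrArg (-(sg n j : ℂ⟦X⟧) • ·) h1
        simp only [smul_sub, smul_ite, smul_zero] at h2
        rw [smul_mul_assoc, mul_smul_comm, smul_comm _ (-(sg n j : ℂ⟦X⟧)), Units.val_neg,
          Units.val_one, neg_one_mul]
        refine h2.trans ?_
        split_ifs with hki
        · subst hki
          have h3 : ((-1 : ℤ) ^ theta n k) = sg n k := by
            rw [sg_eq_pow]
          rw [h3, neg_smul_neg, Int.cast_smul_eq_zsmul]
          simp
        · rfl
  a12 ξ hr := by
    have hq := isQPow_qpow.mul_neg 1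
    have hs : ((-1 : ℂ⟦X⟧) ^ (theta n 1 * theta n 2)) = (sg n 1 : ℂ⟦X⟧) := neg_one_pow_theta_succ n 1
    rw [hs]
    -- For n = 0 the generators e_1 and f_1 are odd, and their vanishing squares take the place of
    -- the cubic Serre relation.
    by_cases hn : n = 0
    · subst hn
      have h1 : sg 0 1 = -1 := by rw [sg_eq]; simp
      rw [h1]
      obtain rfl | rfl := Int.units_eq_one_or ξ
      · have h2 := H.serre_f.sq
        have h3 : rP 0 f 2 = f 2 * f 1 - qpow (-1) • (f 1 * f 2) := by
          rw [← h1]; exact rP_succ le_rfl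
        rw [ra_one, ra_one, rP_one, h3]
        push_cast
        linear_combination (norm := (simp only [mul_sub, sub_mul, mul_add, add_mul, smul_mul_assoc, mul_smul_comm, smul_sub,
      smul_add, smul_smul, mul_assoc, zero_mul, mul_zero, smul_zero]; module))
          qpow 1 • (f 2 * h2) - qpow (-1) • (h2 * f 2) - hq • (f 1 * f 2 * f 1)
      · have h2 := H.serre_e.sq
        have h3 : rN 0 e 2 = e 1 * e 2 - qpow 1 • (e 2 * e 1) := by
          have := rN_succ (n := 0) (e := e) (le_refl 1)
          rwa [h1, neg_neg] at this
        rw [ra_neg_one, ra_neg_one, rN_one, h3]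
        push_cast
        linear_combination (norm := (simp only [mul_sub, sub_mul, mul_add, add_mul, smul_mul_assoc, mul_smul_comm, smul_sub,
      smul_add, smul_smul, mul_assoc, zero_mul, mul_zero, smul_zero]; module))
          h2 * e 2 - (qpow 1 * qpow 1) • (e 2 * h2)
    · have h1 : sg n 1 = 1 := by rw [sg_eq, if_pos (by omega)]
      rw [h1]
      obtain rfl | rfl := Int.units_eq_one_or ξ
      · have h2 := H.serre_f.triple 1 2 (by omega) (by omega)
        have h3 : rP n f 2 = f 2 * f 1 - qpow 1 • (f 1 * f 2) := by
          rw [← h1]; exact rP_succ le_rfl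
        rw [ra_one, ra_one, rP_one, h3]
        push_cast
        linear_combination (norm := (simp only [mul_sub, sub_mul, mul_add, add_mul, smul_mul_assoc, mul_smul_comm, smul_sub,
      smul_add, smul_smul, mul_assoc, zero_mul, mul_zero, smul_zero]; module))
          -qpow 1 • h2 - hq • (f 1 * f 2 * f 1)
      · have h2 := H.serre_e.triple 1 2 (by omega) (by omega)
        have h3 : rN n e 2 = e 1 * e 2 - qpow (-1) • (e 2 * e 1) := by
          rw [← h1]; exact rN_succ le_rfl
        rw [ra_neg_one, ra_neg_one, rN_one, h3]
        push_cast
        linear_combination (norm := (simp only [mul_sub, sub_mul, mul_add, add_mul, smul_mul_assoc, mul_smul_comm, smul_sub,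
      smul_add, smul_smul, mul_assoc, zero_mul, mul_zero, smul_zero]; module))
          h2 + hq • (e 2 * e 1 * e 1)
  a11 ξ hr := by
    rw [scomm, neg_one_pow_theta_self]
    by_cases hn : n = 0
    · subst hn
      have h1 : sg 0 1 = -1 := by rw [sg_eq]; simp
      obtain rfl | rfl := Int.units_eq_one_or ξ
      · have h2 := H.serre_f.sq
        rw [zero_add] at h2
        rw [ra_one, rP_one, h2]; simp
      · have h2 := H.serre_e.sq
        rw [zero_add] at h2
        rw [ra_neg_one, rN_one, h2]; simp
    · have h1 : sg n 1 = 1 := by rw [sg_eq, if_pos (by omega)]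
      rw [h1]; simp

end IsChev

end

/-! ### The universal property of U'. -/

section UqCag

variable {n m : ℕ}

/-- The classes of the generators `H_i`. -/
def cH (n m i : ℕ) : UqCag n m := cls (CagRel n m) (cagH n m i)

/-- The classes of the generators `a_i^±`. -/
def ca (n m : ℕ) (ξ : ℤˣ) (i : ℕ) : UqCag n m := cls (CagRel n m) (caga n m ξ i)

theorem map_cagsbr {B : Type} [Ring B] [Algebra ℂ⟦X⟧ B] (Φ : HFree (CagGen n m) →ₐ[ℂ⟦X⟧] B)
    (ξ η : ℤˣ) (i j : ℕ) :
    Φ (cagsbr n m ξ η i j) = scomm n (fun ξ i => Φ (caga n m ξ i)) ξ η i j := by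
  simp [cagsbr, sbr, scomm]

theorem const_zsmul {G : Type} (c : ℤ) (x : FreeAlgebra ℂ G) :
    HFree.const (c • x) = c • HFree.const x := map_zsmul HFree.constHom c x

theorem map_cagL {B : Type} [Ring B] [Algebra ℂ⟦X⟧ B] [HComplete B]
    (Φ : HFree (CagGen n m) →ₐ[ℂ⟦X⟧] B) (c : ℤ) (i : ℕ) :
    Φ (cagL n m c i) = qE (c • Φ (cagH n m i)) := by
  rw [cagL, qexp_eq_qE, map_qE, const_zsmul, map_zsmul]; rfl

theorem isCag_iff {B : Type} [Ring B] [Algebra ℂ⟦X⟧ B] [HComplete B]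
    (Φ : HFree (CagGen n m) →ₐ[ℂ⟦X⟧] B) :
    IsCag n m (fun i => Φ (cagH n m i)) (fun ξ i => Φ (caga n m ξ i))
      ↔ ∀ x y, CagRel n m x y → Φ x = Φ y := by
  constructor
  · intro h x y hxy
    cases hxy with
    | HH i j hi hj =>
      have := h.HH i j hi hj
      simp [br, this.eq]
    | Ha ξ i j hi hj =>
      have := h.Ha ξ i j hi hj
      simp only [br, one_smul, map_sub, map_mul, map_zsmul]
      rw [HasWt] at this
      rw [this, mul_add, add_sub_cancel_left, zsmul_eq_mul, Int.cast_comm]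
    | aa i hi =>
      rw [map_cagsbr, h.aa i hi, qnum_eq_qN, map_qN]; rfl
    | triple ξ η i j k hi hj hk hij =>
      have := h.triple ξ η i j k hi hj hk hij
      rw [sbr, map_sub, map_smul, map_mul, map_mul, map_cagsbr, this]
      split_ifs
      · rw [map_zsmul, map_mul, map_cagL]
      · rw [map_zero]
    | a12 ξ hr =>
      simpa [sbr] using h.a12 ξ hr
    | a11 ξ hr =>
      rw [map_cagsbr, map_zero]; exact h.a11 ξ hr
  · intro h
    refine ⟨fun i j hi hj => ?_, fun ξ i j hi hj => ?_, fun i hi => ?_,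
      fun ξ η i j k hi hj hk hij => ?_, fun ξ hr => ?_, fun ξ hr => ?_⟩
    · have := h _ _ (CagRel.HH i j hi hj)
      rw [br, one_smul, map_sub, map_mul, map_mul, map_zero, sub_eq_zero] at this
      exact this
    · have := h _ _ (CagRel.Ha ξ i j hi hj)
      rw [br, one_smul, map_sub, map_mul, map_mul, map_zsmul, sub_eq_iff_eq_add'] at this
      rw [HasWt, this, mul_add, zsmul_eq_mul, Int.cast_comm]
    · have := h _ _ (CagRel.aa i hi)
      rw [map_cagsbr, qnum_eq_qN, map_qN] at this
      exact this
    · have := h _ _ (CagRel.triple ξ η i j k hi hj hk hij)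
      rw [sbr, map_sub, map_smul, map_mul, map_mul, map_cagsbr] at this
      rw [this]
      split_ifs
      · rw [map_zsmul, map_mul, map_cagL]
      · rw [map_zero]
    · simpa [sbr] using h _ _ (CagRel.a12 ξ hr)
    · have := h _ _ (CagRel.a11 ξ hr)
      rwa [map_cagsbr, map_zero] at this

theorem isCag_cls (n m : ℕ) : IsCag n m (cH n m) (ca n m) :=
  (isCag_iff (cls (CagRel n m))).2 fun _ _ hxy => cls_rel hxy

/-- Only indices in [1; n+m] occur in the relations, so families need not vanish outside this range.
-/
theorem IsCag.congr {B : Type} [Ring B] [Algebra ℂ⟦X⟧ B] [HComplete B] {H H' : ℕ → B}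
    {a a' : ℤˣ → ℕ → B} (h : IsCag n m H a) (hH : ∀ i, 1 ≤ i ∧ i ≤ n + m → H' i = H i)
    (ha : ∀ ξ i, 1 ≤ i ∧ i ≤ n + m → a' ξ i = a ξ i) : IsCag n m H' a' where
  HH i j hi hj := by rw [hH i hi, hH j hj]; exact h.HH i j hi hj
  Ha ξ i j hi hj := by rw [hH i hi, ha ξ j hj]; exact h.Ha ξ i j hi hj
  aa i hi := by
    rw [scomm, ha _ i hi, ha _ i hi, hH i hi]; exact h.aa i hi
  triple ξ η i j k hi hj hk hij := by
    rw [scomm, ha _ i hi, ha _ j hj, ha _ k hk, hH k hk]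
    exact h.triple ξ η i j k hi hj hk hij
  a12 ξ hr := by
    rw [ha ξ 1 ⟨by omega, by omega⟩, ha ξ 2 ⟨by omega, by omega⟩]; exact h.a12 ξ hr
  a11 ξ hr := by
    rw [scomm, ha ξ 1 ⟨by omega, by omega⟩]; exact h.a11 ξ hr

theorem IsCag.exists_lift {B : Type} [Ring B] [Algebra ℂ⟦X⟧ B] [HComplete B] {H : ℕ → B}
    {a : ℤˣ → ℕ → B} (h : IsCag n m H a) :
    ∃ Φ : UqCag n m →ₐ[ℂ⟦X⟧] B, ∀ i, 1 ≤ i ∧ i ≤ n + m →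
      Φ (cH n m i) = H i ∧ ∀ ξ, Φ (ca n m ξ i) = a ξ i := by
  obtain ⟨Φ, hΦ⟩ := HFree.exists_lift (G := CagGen n m) (fun | .H i => H i | .a ξ i => a ξ i)
  have hH : ∀ i, 1 ≤ i ∧ i ≤ n + m → Φ (cagH n m i) = H i := by
    intro i hi
    rw [cagH, cagH0, dif_pos hi]; exact hΦ (.H ⟨i, hi⟩)
  have ha : ∀ ξ i, 1 ≤ i ∧ i ≤ n + m → Φ (caga n m ξ i) = a ξ i := by
    intro ξ i hi
    rw [caga, dif_pos hi]; exact hΦ (.a ξ ⟨i, hi⟩)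
  obtain ⟨Ψ, hΨ⟩ := HPresented.exists_lift Φ ((isCag_iff Φ).1 (h.congr hH ha))
  exact ⟨Ψ, fun i hi => ⟨(hΨ _).trans (hH i hi), fun ξ => (hΨ _).trans (ha ξ i hi)⟩⟩

/-- There is a homomorphism `UqCag n m → Uq n m` with the prescribed values. -/
theorem exists_cagToUq (n m : ℕ) : ∃ Φ : UqCag n m →ₐ[ℂ⟦X⟧] Uq n m, ∀ i, 1 ≤ i ∧ i ≤ n + m →
    Φ (cH n m i) = hH n (uh n m) i ∧ ∀ ξ, Φ (ca n m ξ i) = ra n (ue n m) (uf n m) ξ i :=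
  (isChev_cls n m).isCag.exists_lift

end UqCag

end UqSl
end

noncomputable section

namespace UqSl

/-! ### Tensor products with the vector representation -/

section SerreSum

variable {K D : Type} [CommRing K] [Ring D] [Algebra K D]

/-- Here x, y come from one tensor factor and u, v from the other. Moving u, v to the left by the
q-commutation rules makes the mixed terms cancel once a a' = 1 is used, and the terms in u and v
alone vanish by nilpotency. -/
theorem serre_triple_add {x y u v : D} {a a' : K} (ha : a * a' = 1)
    (hA : x * x * y - (a + a') • (x * y * x) + y * x * x = 0)
    (hxu : x * u = (a' * a') • (u * x)) (hxv : x * v = a • (v * x)) (hyu : y * u = a • (u * y))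
    (huu : u * u = 0) (huvu : u * v * u = 0) :
    (x + u) * (x + u) * (y + v) - (a + a') • ((x + u) * (y + v) * (x + u))
      + (y + v) * (x + u) * (x + u) = 0 := by
  have hxu' : ∀ w, x * (u * w) = (a' * a') • (u * (x * w)) := fun w => by
    rw [← mul_assoc, hxu, smul_mul_assoc, mul_assoc]
  have hxv' : ∀ w, x * (v * w) = a • (v * (x * w)) := fun w => by
    rw [← mul_assoc, hxv, smul_mul_assoc, mul_assoc]
  have hyu' : ∀ w, y * (u * w) = a • (u * (y * w)) := fun w => by
    rw [← mul_assoc, hyu, smul_mul_assoc, mul_assoc]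
  have huu' : ∀ w, u * (u * w) = 0 := fun w => by rw [← mul_assoc, huu, zero_mul]
  rw [mul_assoc] at huvu
  linear_combination (norm := (simp only [mul_sub, sub_mul, mul_add, add_mul, smul_mul_assoc, mul_smul_comm, smul_sub, smul_add, smul_smul, mul_assoc, zero_mul, mul_zero, smul_zero, hxu, hxv, hyu, hxu', hxv', hyu', huu, huu', huvu]; match_scalars <;> grind)) hA

/-- The same mechanism for the additional relation: all mixed terms are ordered with u, v, w on the
left and cancel. -/
theorem serre_additional_add {x y z u v w : D} {a a' : K} (ha : a * a' = 1)
    (hA : y * x * y * z + y * z * y * x + x * y * z * y + z * y * x * y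
      - (a + a') • (y * x * z * y) = 0)
    (hyy : y * y = 0) (hzx : z * x = x * z)
    (hyv : y * v = (-1 : K) • (v * y)) (hxv : x * v = a • (v * x)) (hyu : y * u = a • (u * y))
    (hzv : z * v = a' • (v * z)) (hyw : y * w = a' • (w * y)) (hxw : x * w = w * x)
    (hzu : z * u = u * z) (hvv : v * v = 0) (huw : u * w = 0) (hwu : w * u = 0)
    (hvuv : v * u * v = 0) (hvwv : v * w * v = 0) :
    (y + v) * (x + u) * (y + v) * (z + w) + (y + v) * (z + w) * (y + v) * (x + u)
      + (x + u) * (y + v) * (z + w) * (y + v) + (z + w) * (y + v) * (x + u) * (y + v)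
      - (a + a') • ((y + v) * (x + u) * (z + w) * (y + v)) = 0 := by
  have assoc : ∀ {p r s : D} {c : K}, p * r = c • s → ∀ t, p * (r * t) = c • (s * t) :=
    fun h t => by rw [← mul_assoc, h, smul_mul_assoc]
  have assoc0 : ∀ {p r : D}, p * r = 0 → ∀ t, p * (r * t) = 0 :=
    fun h t => by rw [← mul_assoc, h, zero_mul]
  have assoc1 : ∀ {p r s : D}, p * r = s → ∀ t, p * (r * t) = s * t :=
    fun h t => by rw [← mul_assoc, h]
  have hyy' := assoc0 hyy
  have hzx' := assoc1 hzx
  have hyv' := assoc hyv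
  have hxv' := assoc hxv
  have hyu' := assoc hyu
  have hzv' := assoc hzv
  have hyw' := assoc hyw
  have hxw' := assoc1 hxw
  have hzu' := assoc1 hzu
  have hvv' := assoc0 hvv
  have huw' := assoc0 huw
  have hwu' := assoc0 hwu
  rw [mul_assoc] at hvuv hvwv
  have hvuv' : ∀ t, v * (u * (v * t)) = 0 := fun t => by
    rw [← mul_assoc u, ← mul_assoc, hvuv, zero_mul]
  have hvwv' : ∀ t, v * (w * (v * t)) = 0 := fun t => by
    rw [← mul_assoc w, ← mul_assoc, hvwv, zero_mul]
  linear_combination (norm := (simp only [mul_sub, sub_mul, mul_add, add_mul, smul_mul_assoc, mul_smul_comm, smul_sub, smul_add, smul_smul, mul_assoc, zero_mul, mul_zero, smul_zero, hyy, hzx, hyv, hxv, hyu, hzv, hyw, hxw, hzu, hvv, huw, hwu, hyy', hzx', hyv', hxv', hyu', hzv', hyw', hxw', hzu', hvv', huw', hwu', hvuv, hvwv, hvuv', hvwv']; match_scalars <;> grind)) hA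

/-- The symmetrised Cartan matrix. -/
def symCartan (n i j : ℕ) : ℤ := (if i = j then sg n (i - 1) + sg n i else 0)
  - (if i + 1 = j then sg n i else 0) - (if i = j + 1 then sg n (i - 1) else 0)

theorem symCartan_comm (n i j : ℕ) : symCartan n i j = symCartan n j i := by
  unfold symCartan
  split_ifs <;> first | omega | (subst_vars; simp)

/-- The factor by which tensor components of generators commute. -/
def braid (n : ℕ) (p : ℤ → K) (i j : ℕ) : K :=
  (-1) ^ (chevDeg n i * chevDeg n j) * p (symCartan n i j)

theorem neg_one_pow_chevDeg {n i j : ℕ} (hi : 1 ≤ i) (hj : 1 ≤ j) :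
    (-1 : K) ^ (chevDeg n i * chevDeg n j) = if i = n + 1 ∧ j = n + 1 then -1 else 1 := by
  rw [chevDeg_eq n i hi, chevDeg_eq n j hj]
  split_ifs <;> first | omega | norm_num

/-- The two alternatives in `hBB` fit upper and lower matrix units. Either one forces B_i B_j = 0
for non-neighbours and B_i B_j B_i = 0 always, which is all that is used about B besides its
commutation with A. -/
theorem IsSerre.add {n : ℕ} {p : ℤ → K} (hp : IsQPow p) {A B : ℕ → D} (hA : IsSerre n p A)
    (hA0 : A 0 = 0) (hB0 : B 0 = 0)
    (hAB : ∀ i j, 1 ≤ i → 1 ≤ j → A i * B j = braid n p i j • (B j * A i))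
    (hBB : (∀ i j, j ≠ i + 1 → B i * B j = 0) ∨ (∀ i j, i ≠ j + 1 → B i * B j = 0)) :
    IsSerre n p fun i => A i + B i := by
  have hfar : ∀ i j, i ≠ j + 1 → j ≠ i + 1 → B i * B j = 0 := by
    intro i j hij hji
    rcases hBB with h | h
    · exact h i j hji
    · exact h i j hij
  have htri : ∀ i j, B i * B j * B i = 0 := by
    intro i j
    rcases hBB with h | h
    · by_cases hji : j = i + 1
      · rw [mul_assoc, h j i (by omega), mul_zero]
      · rw [h i j hji, zero_mul]
    · by_cases hji : i = j + 1
      · rw [mul_assoc, h j i (by omega), mul_zero]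
      · rw [h i j hji, zero_mul]
  have hcomm : ∀ i j, i ≠ j → i ≠ j + 1 → j ≠ i + 1 → A i * B j = B j * A i := by
    intro i j h0 hij hji
    rcases Nat.eq_zero_or_pos i with rfl | hi
    · rw [hA0]; simp
    · rcases Nat.eq_zero_or_pos j with rfl | hj
      · rw [hB0]; simp
      · rw [hAB i j hi hj, braid, neg_one_pow_chevDeg hi hj, symCartan, if_neg (by omega),
          if_neg h0, if_neg (by omega), if_neg (by omega)]
        simp [hp.zero]
  have hsq : A (n + 1) * B (n + 1) = (-1 : K) • (B (n + 1) * A (n + 1)) := by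
    rw [hAB _ _ (by omega) (by omega), braid, neg_one_pow_chevDeg (by omega) (by omega), symCartan,
      if_pos ⟨rfl, rfl⟩, if_pos rfl, if_neg (by omega), if_neg (by omega), Nat.add_sub_cancel,
      sg_eq, if_pos le_rfl, sg_eq, if_neg (by omega)]
    simp [hp.zero]
  have hnext : ∀ i, 1 ≤ i → A i * B (i + 1) = p (-sg n i) • (B (i + 1) * A i) := by
    intro i hi
    rw [hAB _ _ hi (by omega), braid, neg_one_pow_chevDeg hi (by omega), symCartan,
      if_neg (by omega), if_neg (by omega), if_pos rfl, if_neg (by omega)]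
    simp
  have hprev : ∀ i, 1 ≤ i → A (i + 1) * B i = p (-sg n i) • (B i * A (i + 1)) := by
    intro i hi
    rw [hAB _ _ (by omega) hi, braid, neg_one_pow_chevDeg (by omega) hi, symCartan_comm, symCartan,
      if_neg (by omega), if_neg (by omega), if_pos rfl, if_neg (by omega)]
    simp
  refine ⟨?_, ?_, ?_, ?_⟩
  · intro i j hij hji
    by_cases h0 : i = j
    · rw [h0]
    · have h1 := hcomm i j h0 hij hji
      have h2 := hcomm j i (Ne.symm h0) hji hij
      have h3 := hA.comm i j hij hji
      have h4 := hfar i j hij hji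
      have h5 := hfar j i hji hij
      simp only [mul_add, add_mul, h1, h2, h3, h4, h5]
      abel
  · have h1 := hA.sq
    have h2 := hfar (n + 1) (n + 1) (by omega) (by omega)
    simp only [mul_add, add_mul, h1, h2, hsq]
    simp
  · intro i j hij hin
    rcases Nat.eq_zero_or_pos i with rfl | hi
    · simp [hA0, hB0]
    rcases Nat.eq_zero_or_pos j with rfl | hj
    · simp [hA0, hB0]
    have hs : sg n i = sg n (i - 1) := by rw [sg_eq, sg_eq]; split_ifs <;> omega
    have hT := hA.triple i j hij hin
    have ht : p 1 + p (-1) = p (-sg n i) + p (sg n i) := by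
      rw [sg_eq]; split_ifs
      · rw [add_comm]
      · rw [neg_neg]
    have haa : p (-sg n i) * p (sg n i) = 1 := by rw [mul_comm]; exact hp.mul_neg _
    have hii : A i * B i = (p (sg n i) * p (sg n i)) • (B i * A i) := by
      rw [hAB _ _ hi hi, braid, neg_one_pow_chevDeg hi hi, symCartan, if_neg (by omega), if_pos rfl,
        if_neg (by omega), if_neg (by omega), ← hs, sub_zero, sub_zero, hp.add, one_mul]
    have hAiBj : A i * B j = p (-sg n i) • (B j * A i) := by
      rcases hij with rfl | rfl
      · rw [hprev j hj, hs, Nat.add_sub_cancel]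
      · exact hnext i hi
    have hAjBi : A j * B i = p (-sg n i) • (B i * A j) := by
      rcases hij with rfl | rfl
      · rw [hnext j hj, hs, Nat.add_sub_cancel]
      · exact hprev i hi
    rw [ht] at hT ⊢
    exact serre_triple_add haa hT hii hAiBj hAjBi (hfar i i (by omega) (by omega)) (htri i j)
  · have hT := hA.additional
    rcases Nat.eq_zero_or_pos n with rfl | hn
    · simp [hA0, hB0]
    have hs : sg n n = 1 := by rw [sg_eq, if_pos le_rfl]
    have hs' : sg n (n + 1) = -1 := by rw [sg_eq, if_neg (by omega)]
    have h1 := hnext n hn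
    have h2 := hprev n hn
    have h3 := hnext (n + 1) (by omega)
    have h4 := hprev (n + 1) (by omega)
    rw [hs] at h1 h2
    rw [hs', neg_neg] at h3 h4
    have haa : p (-1) * p 1 = 1 := by rw [mul_comm]; exact hp.mul_neg _
    rw [add_comm (p 1)] at hT ⊢
    exact serre_additional_add haa hT hA.sq (hA.comm _ _ (by omega) (by omega)) hsq h1 h2 h4 h3
      (hcomm _ _ (by omega) (by omega) (by omega)) (hcomm _ _ (by omega) (by omega) (by omega))
      (hfar _ _ (by omega) (by omega)) (hfar _ _ (by omega) (by omega))
      (hfar _ _ (by omega) (by omega)) (htri _ _) (htri _ _)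

end SerreSum

end UqSl
end

noncomputable section

namespace UqSl

/-! ### The coproduct with the vector representation. -/

section Coproduct

/-- Each Serre relation is homogeneous, so all its terms acquire the same product of the commuting
factors S_i. -/
theorem IsSerre.mul_commuting {K D : Type} [CommRing K] [Ring D] [Algebra K D] {n : ℕ} {p : ℤ → K}
    {x S : ℕ → D} (h : IsSerre n p x) (hS : ∀ i j, Commute (S i) (S j))
    (hxS : ∀ i j, Commute (x i) (S j)) : IsSerre n p fun i => x i * S i := by
  have h2 : ∀ i j, x i * S i * (x j * S j) = x i * x j * (S i * S j) := fun i j => by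
    rw [mul_assoc, ← mul_assoc (S i), ← (hxS j i).eq]; simp only [mul_assoc]
  have h2' : ∀ i j k t, (x i * x j * t) * (x k * S k) = x i * x j * (t * x k * S k) :=
    fun i j k t => by simp only [mul_assoc]
  have h3 : ∀ i j k, x i * S i * (x j * S j) * (x k * S k) = x i * x j * x k * (S i * S j * S k) := by
    intro i j k
    rw [h2, h2', ← ((hxS k i).mul_right (hxS k j)).eq]; simp only [mul_assoc]
  have h4 : ∀ i j k l, x i * S i * (x j * S j) * (x k * S k) * (x l * S l)
      = x i * x j * x k * x l * (S i * S j * S k * S l) := by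
    intro i j k l
    rw [h3]
    have := (((hxS l i).mul_right (hxS l j)).mul_right (hxS l k)).eq
    simp only [mul_assoc] at this ⊢
    rw [← mul_assoc (S k) (x l), ← mul_assoc (S j), ← mul_assoc (S i), ← this]
    simp only [mul_assoc]
  refine ⟨fun i j hij hji => ?_, ?_, fun i j hij hin => ?_, ?_⟩
  · rw [h2, h2, h.comm i j hij hji, (hS i j).eq]
  · rw [h2, h.sq, zero_mul]
  · rw [h3, h3, h3]
    rw [show S i * S j * S i = S i * S i * S j by rw [mul_assoc, (hS j i).eq, mul_assoc],
      show S j * S i * S i = S i * S i * S j by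
        rw [mul_assoc, ((hS j i).mul_right (hS j i)).eq], ← smul_mul_assoc, ← sub_mul, ← add_mul,
      h.triple i j hij hin, zero_mul]
  · simp only [h4]
    set a := S n
    set b := S (n + 1)
    set c := S (n + 2)
    have hab : a * b = b * a := hS _ _
    have hbc : b * c = c * b := hS _ _
    have hac : a * c = c * a := hS _ _
    have e1 : b * c * b * a = b * a * b * c := by
      rw [mul_assoc b c b, ← hbc, mul_assoc b a b, hab]; simp only [mul_assoc, hac]
    have e2 : a * b * c * b = b * a * b * c := by
      rw [mul_assoc, ← hbc, hab, ← mul_assoc]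
    have e3 : c * b * a * b = b * a * b * c := by
      rw [← hbc, mul_assoc b, ← hac, ← mul_assoc, mul_assoc, ← hbc, ← mul_assoc]
    have e4 : b * a * c * b = b * a * b * c := by
      rw [mul_assoc, ← hbc, ← mul_assoc]
    rw [e1, e2, e3, e4, ← smul_mul_assoc, ← add_mul, ← add_mul, ← add_mul, ← sub_mul, h.additional,
      zero_mul]

/-- Families satisfying the relations of the vector representation; `s i` is the parity operator of
`e' i` and `f' i`. -/
structure IsVec {D : Type} [Ring D] [Algebra ℂ⟦X⟧ D] (n m : ℕ) (h e f s : ℕ → D) : Prop where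
  h_zero : ∀ i, ¬(1 ≤ i ∧ i ≤ n + m) → h i = 0
  e_zero : ∀ i, ¬(1 ≤ i ∧ i ≤ n + m) → e i = 0
  f_zero : ∀ i, ¬(1 ≤ i ∧ i ≤ n + m) → f i = 0
  hh : ∀ i j, Commute (h i) (h j)
  he : ∀ i j, 1 ≤ i ∧ i ≤ n + m → 1 ≤ j ∧ j ≤ n + m →
    h i * e j = e j * (h i + (cartan n i j : D))
  hf : ∀ i j, 1 ≤ i ∧ i ≤ n + m → 1 ≤ j ∧ j ≤ n + m →
    h i * f j = f j * (h i - (cartan n i j : D))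
  ss : ∀ i, s i * s i = 1
  s_comm : ∀ i j, Commute (s i) (s j)
  hs : ∀ i j, Commute (h i) (s j)
  s_e : ∀ i j, s i * e j = ((-1 : ℂ⟦X⟧) ^ (chevDeg n i * chevDeg n j)) • (e j * s i)
  s_f : ∀ i j, s i * f j = ((-1 : ℂ⟦X⟧) ^ (chevDeg n i * chevDeg n j)) • (f j * s i)
  ee : ∀ i j, j ≠ i + 1 → e i * e j = 0
  ff : ∀ i j, i ≠ j + 1 → f i * f j = 0
  ef_ne : ∀ i j, i ≠ j → e i * f j = 0
  fe_ne : ∀ i j, i ≠ j → f j * e i = 0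
  ef_eq : ∀ i, 1 ≤ i → e i * f i = tau ℂ⟦X⟧ n i i • (f i * e i) + h i
  cube : ∀ i, h i ^ 3 = h i

variable {D : Type} [Ring D] [Algebra ℂ⟦X⟧ D] [HComplete D] {n m : ℕ} {h e f h' e' f' s : ℕ → D}

omit [HComplete D] in
theorem isSerre_qpow_neg {x : ℕ → D} :
    IsSerre n (fun a => qpow (-a)) x ↔ IsSerre n qpow x := by
  constructor
  · intro h
    have h3 := h.triple
    have h4 := h.additional
    simp only [neg_neg] at h3 h4
    rw [add_comm (qpow (-1))] at h3 h4
    exact ⟨h.comm, h.sq, h3, h4⟩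
  · intro h
    have h3 := h.triple
    have h4 := h.additional
    rw [add_comm (qpow 1)] at h3 h4
    refine ⟨h.comm, h.sq, ?_, ?_⟩
    · simpa only [neg_neg] using h3
    · simpa only [neg_neg] using h4

theorem sg_mul_cartan' (n i j : ℕ) : sg n (i - 1) * cartan n i j = symCartan n i j :=
  sg_mul_cartan n i j

theorem qE_smul_mul_of_wt {x y : D} {n i j : ℕ} (h : x * y = y * (x + (cartan n i j : D))) :
    qE (sg n (i - 1) • x) * y = qpow (symCartan n i j) • (y * qE (sg n (i - 1) • x)) := by
  rw [← sg_mul_cartan']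
  exact (HasWt.zsmul (show HasWt x y _ from h) _).qE

theorem qE_smul_mul_of_wt_neg {x y : D} {n i j : ℕ} (h : x * y = y * (x - (cartan n i j : D))) :
    qE (sg n (i - 1) • x) * y = qpow (-symCartan n i j) • (y * qE (sg n (i - 1) • x)) := by
  rw [← sg_mul_cartan', ← mul_neg]
  refine (HasWt.zsmul (show HasWt x y _ from ?_) _).qE
  rw [HasWt, h, Int.cast_neg, sub_eq_add_neg]

theorem qE_neg_mul_of_qE_mul {x y : D} {a : ℤ} (h : qE x * y = qpow a • (y * qE x)) :
    qE (-x) * y = qpow (-a) • (y * qE (-x)) := by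
  have h1 := isQPow_qpow.mul_neg a
  calc qE (-x) * y = qE (-x) * y * (qE x * qE (-x)) := by rw [qE_mul_neg_self, mul_one]
    _ = qE (-x) * ((qpow (-a) * qpow a) • (y * qE x)) * qE (-x) := by
        rw [mul_comm, h1, one_smul]; simp only [mul_assoc]
    _ = qpow (-a) • (y * qE (-x)) := by
        rw [mul_smul, ← h, mul_smul_comm, ← mul_assoc (qE (-x)), qE_neg_mul_self, one_mul,
          smul_mul_assoc]

/-- For both signs this is the addition formula, q-numbers being invariant under q ↔ q⁻¹. It makes
the diagonal parts of the coproduct of ⟦e_i, f_i⟧ add up. -/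
theorem qN_add_sg (n i : ℕ) {x y : D} (h : Commute x y) :
    qN x * qE (sg n i • y) + qE (-(sg n i • x)) * qN y = qN (x + y) := by
  have h1 : Commute (qN x) (qE (-y)) := commute_qN (commute_qE h.symm.neg_left).symm
  have h2 : Commute (qE x) (qN y) := commute_qE (commute_qN h.symm).symm
  rw [sg_eq]; split_ifs
  · rw [one_smul, one_smul, qN_add h]
  · rw [neg_one_smul, neg_one_smul, neg_neg, add_comm x, qN_add h.symm, h1.eq, h2.eq, add_comm]

/-- This is the coproduct e ↦ e ⊗ q^{s h} + 1 ⊗ e, f ↦ f ⊗ 1 + q^{−s h} ⊗ f of a quantum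
superalgebra, realised in one ordinary algebra: membership in S makes the two factors commute, and
the parity operators s_i restore the signs of the graded tensor product. Mixed terms of ⟦e_i, f_j⟧
cancel because the q-powers from the two factors are inverse by symmetry of the Cartan matrix. The
Serre relations follow from `IsSerre.add`, for f with q inverted. -/
theorem IsChev.coproduct (H : IsChev n m h e f) (V : IsVec n m h' e' f' s)
    {S : Set D} (hh' : ∀ i, h' i ∈ S) (he' : ∀ i, e' i ∈ S) (hf' : ∀ i, f' i ∈ S)
    (hs : ∀ i, s i ∈ S) (hS : ∀ x ∈ S, ∀ i, Commute (h i) x ∧ Commute (e i) x ∧ Commute (f i) x) :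
    IsChev n m (fun i => h i + h' i)
      (fun i => e i * (s i * qE (sg n (i - 1) • h' i)) + e' i)
      (fun i => f i * s i + qE (-(sg n (i - 1) • h i)) * f' i) := by
  have hxQ : ∀ i j, Commute (h i) (qE (sg n (j - 1) • h' j)) ∧
      Commute (e i) (qE (sg n (j - 1) • h' j)) ∧ Commute (f i) (qE (sg n (j - 1) • h' j)) := by
    intro i j
    obtain ⟨h1, h2, h3⟩ := hS _ (hh' j) i
    exact ⟨(commute_qE (h1.symm.smul_left _)).symm, (commute_qE (h2.symm.smul_left _)).symm,
      (commute_qE (h3.symm.smul_left _)).symm⟩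
  have hsQ : ∀ i j, Commute (s i) (qE (sg n (j - 1) • h' j)) := fun i j =>
    (commute_qE ((V.hs j i).smul_left _)).symm
  have hQx : ∀ i, ∀ x ∈ S, Commute (qE (-(sg n (i - 1) • h i))) x := fun i x hx =>
    commute_qE (((hS x hx i).1.smul_left _).neg_left)
  have hQQ : ∀ i j, Commute (qE (sg n (i - 1) • h' i)) (qE (sg n (j - 1) • h' j)) := fun i j =>
    commute_qE ((commute_qE (((V.hh j i).smul_left _).smul_right _)).symm)
  have hxS : ∀ i j, Commute (h i) (s j * qE (sg n (j - 1) • h' j)) ∧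
      Commute (e i) (s j * qE (sg n (j - 1) • h' j)) ∧
      Commute (f i) (s j * qE (sg n (j - 1) • h' j)) := fun i j =>
    ⟨(hS _ (hs j) i).1.mul_right (hxQ i j).1, (hS _ (hs j) i).2.1.mul_right (hxQ i j).2.1,
      (hS _ (hs j) i).2.2.mul_right (hxQ i j).2.2⟩
  have hSe : ∀ i j, 1 ≤ i ∧ i ≤ n + m → s i * qE (sg n (i - 1) • h' i) * e' j
      = braid n qpow i j • (e' j * (s i * qE (sg n (i - 1) • h' i))) := by
    intro i j hi
    by_cases hj : 1 ≤ j ∧ j ≤ n + m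
    · rw [mul_assoc, qE_smul_mul_of_wt (V.he i j hi hj), mul_smul_comm, ← mul_assoc, V.s_e,
        smul_mul_assoc, smul_smul, braid, mul_assoc, mul_comm (qpow _)]
    · rw [V.e_zero j hj]; simp
  have hSf : ∀ i j, 1 ≤ i ∧ i ≤ n + m → s i * qE (sg n (i - 1) • h' i) * f' j
      = braid n (fun a => qpow (-a)) i j • (f' j * (s i * qE (sg n (i - 1) • h' i))) := by
    intro i j hi
    by_cases hj : 1 ≤ j ∧ j ≤ n + m
    · rw [mul_assoc, qE_smul_mul_of_wt_neg (V.hf i j hi hj), mul_smul_comm, ← mul_assoc, V.s_f,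
        smul_mul_assoc, smul_smul, braid, mul_assoc, mul_comm (qpow _)]
    · rw [V.f_zero j hj]; simp
  have hQe : ∀ i j, 1 ≤ j ∧ j ≤ n + m → qE (-(sg n (j - 1) • h j)) * e i
      = qpow (-symCartan n j i) • (e i * qE (-(sg n (j - 1) • h j))) := by
    intro i j hj
    by_cases hi : 1 ≤ i ∧ i ≤ n + m
    · exact qE_neg_mul_of_qE_mul (qE_smul_mul_of_wt (H.he j i hj hi))
    · rw [H.e_zero i hi]; simp
  have hQf : ∀ i j, 1 ≤ j ∧ j ≤ n + m → qE (-(sg n (j - 1) • h j)) * f i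
      = qpow (symCartan n j i) • (f i * qE (-(sg n (j - 1) • h j))) := by
    intro i j hj
    by_cases hi : 1 ≤ i ∧ i ≤ n + m
    · have := qE_neg_mul_of_qE_mul (qE_smul_mul_of_wt_neg (H.hf j i hj hi))
      rwa [neg_neg] at this
    · rw [H.f_zero i hi]; simp
  have hcast : ∀ (a : ℤ) (x : D), (a : D) * x = x * a := Int.cast_comm
  -- the mixed terms of `[e_i, f_j]`
  have hmix : ∀ i j, e i * (s i * qE (sg n (i - 1) • h' i)) * (qE (-(sg n (j - 1) • h j)) * f' j)
      = ((-1 : ℂ⟦X⟧) ^ (chevDeg n i * chevDeg n j)) •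
        (qE (-(sg n (j - 1) • h j)) * f' j * (e i * (s i * qE (sg n (i - 1) • h' i)))) := by
    intro i j
    by_cases hi : 1 ≤ i ∧ i ≤ n + m
    · by_cases hj : 1 ≤ j ∧ j ≤ n + m
      · set Si := s i * qE (sg n (i - 1) • h' i) with hSi
        set Q := qE (-(sg n (j - 1) • h j)) with hQ
        have h1 : Commute Q Si := (hQx j _ (hs i)).mul_right (commute_qE
          ((hxQ j i).1.smul_left _).neg_left)
        have h2 : e i * f' j = f' j * e i := (hS _ (hf' j) i).2.1.eq
        have h3 := hSf i j hi
        have h4 := hQe i j hj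
        calc e i * Si * (Q * f' j) = e i * Q * (Si * f' j) := by
              simp only [mul_assoc]; rw [← mul_assoc Si Q, ← h1.eq, mul_assoc]
          _ = braid n (fun a => qpow (-a)) i j • (e i * Q * f' j * Si) := by
              rw [h3, ← hSi, mul_smul_comm]; simp only [mul_assoc]
          _ = (-1 : ℂ⟦X⟧) ^ (chevDeg n i * chevDeg n j) • (Q * e i * f' j * Si) := by
              rw [hQ, h4, braid, symCartan_comm n i j]; simp only [smul_mul_assoc, smul_smul]
          _ = _ := by rw [mul_assoc Q, h2]; simp only [mul_assoc]
      · rw [V.f_zero j hj]; simp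
    · rw [H.e_zero i hi]; simp
  have hmix' : ∀ i j, e' i * (f j * s j)
      = ((-1 : ℂ⟦X⟧) ^ (chevDeg n i * chevDeg n j)) • (f j * s j * e' i) := by
    intro i j
    rw [mul_assoc (f j), V.s_e, mul_smul_comm, smul_smul, mul_comm (chevDeg n j), ← mul_pow,
      neg_one_mul, neg_neg, one_pow, one_smul, ← mul_assoc, ← mul_assoc, (hS _ (he' i) j).2.2.eq]
  have hdiag : ∀ i j, e i * (s i * qE (sg n (i - 1) • h' i)) * (f j * s j)
      = e i * f j * (s j * (s i * qE (sg n (i - 1) • h' i))) := by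
    intro i j
    rw [mul_assoc, ← mul_assoc _ (f j), ← (hxS j i).2.2.eq, mul_assoc (f j), mul_assoc (e i),
      ((V.s_comm j i).mul_right (hsQ j i)).eq]
  have hdiag' : ∀ i j, f j * s j * (e i * (s i * qE (sg n (i - 1) • h' i)))
      = f j * e i * (s j * (s i * qE (sg n (i - 1) • h' i))) := by
    intro i j
    rw [mul_assoc, ← mul_assoc (s j), ← (hS _ (hs j) i).2.1.eq, mul_assoc (e i), mul_assoc (f j)]
  refine ⟨?_, ?_, ?_, ?_, ?_, ?_, ?_, ?_, ?_, ?_⟩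
  · intro i hi; simp only [H.h_zero i hi, V.h_zero i hi, add_zero]
  · intro i hi; simp only [H.e_zero i hi, V.e_zero i hi, zero_mul, add_zero]
  · intro i hi; simp only [H.f_zero i hi, V.f_zero i hi, zero_mul, mul_zero, add_zero]
  · intro i j
    exact ((H.hh i j).add_right (hS _ (hh' j) i).1).add_left
      ((hS _ (hh' i) j).1.symm.add_right (V.hh i j))
  · intro i j hi hj
    have h1 : h' i * (e j * (s j * qE (sg n (j - 1) • h' j)))
        = e j * (s j * qE (sg n (j - 1) • h' j)) * h' i :=
      ((hS _ (hh' i) j).2.1.symm.mul_right ((V.hs i j).mul_right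
        (commute_qE ((V.hh j i).smul_left _)).symm)).eq
    have h2 : h i * (e j * (s j * qE (sg n (j - 1) • h' j)))
        = e j * (s j * qE (sg n (j - 1) • h' j)) * (h i + (cartan n i j : D)) := by
      rw [← mul_assoc, H.he i j hi hj, mul_assoc, mul_assoc, add_mul, (hxS i j).1.eq, hcast, ← mul_add]
    have h3 : h i * e' j = e' j * h i := (hS _ (he' j) i).1.eq
    rw [add_mul, mul_add, mul_add, h1, h2, h3, V.he i j hi hj]
    simp only [mul_add, add_mul]
    abel
  · intro i j hi hj
    have h1 : h' i * (f j * s j) = f j * s j * h' i :=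
      ((hS _ (hh' i) j).2.2.symm.mul_right (V.hs i j)).eq
    have h2 : h i * (f j * s j) = f j * s j * (h i - (cartan n i j : D)) := by
      rw [← mul_assoc, H.hf i j hi hj, mul_assoc, mul_assoc, sub_mul, (hS _ (hs j) i).1.eq, hcast,
        ← mul_sub]
    have h3 : h i * (qE (-(sg n (j - 1) • h j)) * f' j) = qE (-(sg n (j - 1) • h j)) * f' j * h i :=
      (((commute_qE ((H.hh j i).smul_left _).neg_left).symm).mul_right (hS _ (hf' j) i).1).eq
    have h4 : h' i * (qE (-(sg n (j - 1) • h j)) * f' j)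
        = qE (-(sg n (j - 1) • h j)) * f' j * (h' i - (cartan n i j : D)) := by
      rw [← mul_assoc, ← (hQx j _ (hh' i)).eq, mul_assoc, V.hf i j hi hj, mul_assoc]
    rw [add_mul, mul_add, mul_add, h1, h2, h3, h4]
    simp only [mul_add, add_mul, mul_sub]
    abel
  · intro i j hij
    by_cases hi : 1 ≤ i
    · by_cases hj : 1 ≤ j
      · have h1 := hmix i j
        have h2 := hmix' i j
        rw [chevDeg_mul_chevDeg hi hj hij, one_smul] at h1 h2
        have h3 : e' i * (qE (-(sg n (j - 1) • h j)) * f' j) = 0 := by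
          rw [← mul_assoc, ← (hQx j _ (he' i)).eq, mul_assoc, V.ef_ne i j hij, mul_zero]
        have h4 : qE (-(sg n (j - 1) • h j)) * f' j * e' i = 0 := by
          rw [mul_assoc, V.fe_ne i j hij, mul_zero]
        rw [mul_add, add_mul, add_mul, add_mul, mul_add, mul_add, hdiag, hdiag', h1, h2, h3, h4,
          H.ef_ne i j hij]
      · simp only [H.f_zero j (by omega), V.f_zero j (by omega)]; simp
    · simp only [H.e_zero i (by omega), V.e_zero i (by omega)]; simp
  · intro i hi
    have h1 := hmix i i
    have h2 := hmix' i i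
    rw [chevDeg_mul_self hi] at h1 h2
    have h3 : e' i * (qE (-(sg n (i - 1) • h i)) * f' i)
        = qE (-(sg n (i - 1) • h i)) * (e' i * f' i) := by
      rw [← mul_assoc, ← (hQx i _ (he' i)).eq, mul_assoc]
    have h4 : s i * (s i * qE (sg n (i - 1) • h' i)) = qE (sg n (i - 1) • h' i) := by
      rw [← mul_assoc, V.ss, one_mul]
    rw [mul_add, add_mul, add_mul, add_mul, mul_add, mul_add, hdiag, hdiag', h1, h2, h3, h4,
      H.ef_eq i hi, V.ef_eq i hi, ← qN_add_sg n (i - 1) (hS _ (hh' i) i).1, qN_of_cube (V.cube i)]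
    simp only [mul_add, add_mul, smul_add, smul_mul_assoc, mul_smul_comm, mul_assoc]
    abel
  · refine IsSerre.add isQPow_qpow (H.serre_e.mul_commuting (fun i j => ?_) fun i j => (hxS i j).2.1)
      ?_ (V.e_zero 0 (by omega)) ?_ (Or.inl V.ee)
    · exact ((V.s_comm i j).mul_right (hsQ i j)).mul_left ((hsQ j i).symm.mul_right (hQQ i j))
    · simp only [H.e_zero 0 (by omega), zero_mul]
    · intro i j hi hj
      by_cases hi' : 1 ≤ i ∧ i ≤ n + m
      · rw [mul_assoc, hSe i j hi', mul_smul_comm, ← mul_assoc, (hS _ (he' j) i).2.1.eq, mul_assoc]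
      · rw [H.e_zero i hi']; simp
  · rw [← isSerre_qpow_neg]
    refine IsSerre.add isQPow_qpow.neg ((isSerre_qpow_neg.2 H.serre_f).mul_commuting V.s_comm
      fun i j => (hS _ (hs j) i).2.2) ?_ ?_ ?_ (Or.inr ?_)
    · simp only [H.f_zero 0 (by omega), zero_mul]
    · simp only [V.f_zero 0 (by omega), mul_zero]
    · intro i j hi hj
      by_cases hj' : 1 ≤ j ∧ j ≤ n + m
      · have h1 := hQf i j hj'
        rw [mul_assoc, ← mul_assoc (s i), ← (hQx j _ (hs i)).eq, mul_assoc _ (s i), V.s_f,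
          mul_smul_comm, mul_smul_comm, braid, mul_smul]
        congr 1
        rw [mul_assoc _ (f' j), ← mul_assoc (f' j), ← (hS _ (hf' j) i).2.2.eq, mul_assoc (f i),
          ← mul_assoc _ (f i), h1, symCartan_comm n i j, smul_mul_assoc, smul_smul, mul_comm,
          isQPow_qpow.mul_neg, one_smul, mul_assoc]
      · rw [V.f_zero j hj']; simp
    · intro i j hij
      rw [mul_assoc, ← mul_assoc (f' i), ← (hQx j _ (hf' i)).eq, mul_assoc _ (f' i), V.ff i j hij]
      simp

end Coproduct

end UqSl
end

noncomputable section

namespace UqSl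

/-! ### The vector representation, together with trivial representations of both parities -/

section VecRep

variable {R : Type} [Ring R] {N : ℕ}

/-- The matrix unit with entry `1` in position `(i, j)`. -/
def vU (R : Type) [Ring R] (N i j : ℕ) : Matrix (Fin N) (Fin N) R :=
  Matrix.of fun u v => if (u : ℕ) = i ∧ (v : ℕ) = j then 1 else 0

/-- The diagonal matrix with entries `d 0, d 1, …`. -/
def vD (R : Type) [Ring R] (N : ℕ) (d : ℕ → ℤ) : Matrix (Fin N) (Fin N) R :=
  Matrix.diagonal fun u => ((d u : ℤ) : R)

theorem vU_mul_vU_self {i j l : ℕ} (hj : j < N) : vU R N i j * vU R N j l = vU R N i l := by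
  ext u v
  simp only [vU, Matrix.mul_apply, Matrix.of_apply]
  rw [Finset.sum_eq_single ⟨j, hj⟩]
  · by_cases h1 : (u : ℕ) = i <;> by_cases h2 : (v : ℕ) = l <;> simp [h1, h2]
  · intro b _ hb
    have : (b : ℕ) ≠ j := fun h => hb (Fin.ext h)
    simp [this]
  · simp

theorem vU_mul_vU_ne {i j k l : ℕ} (hjk : j ≠ k) : vU R N i j * vU R N k l = 0 := by
  ext u v
  simp only [vU, Matrix.mul_apply, Matrix.of_apply, Matrix.zero_apply]
  refine Finset.sum_eq_zero fun b _ => ?_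
  by_cases h1 : (b : ℕ) = j
  · have : (b : ℕ) ≠ k := fun h => hjk (h1.symm.trans h)
    simp [this]
  · simp [h1]

theorem vD_mul_vU (d : ℕ → ℤ) (i j : ℕ) : vD R N d * vU R N i j = d i • vU R N i j := by
  ext u v
  rw [vD, Matrix.diagonal_mul, Matrix.smul_apply, vU, Matrix.of_apply, zsmul_eq_mul]
  split_ifs with h
  · rw [h.1]
  · simp

theorem vU_mul_vD (d : ℕ → ℤ) (i j : ℕ) : vU R N i j * vD R N d = d j • vU R N i j := by
  ext u v
  rw [vD, Matrix.mul_diagonal, Matrix.smul_apply, vU, Matrix.of_apply, zsmul_eq_mul]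
  split_ifs with h
  · rw [h.2, mul_one, one_mul]
  · simp

theorem vD_mul_vD (d d' : ℕ → ℤ) : vD R N d * vD R N d' = vD R N fun u => d u * d' u := by
  rw [vD, vD, Matrix.diagonal_mul_diagonal, vD]; simp

theorem vD_add_vD (d d' : ℕ → ℤ) : vD R N d + vD R N d' = vD R N fun u => d u + d' u := by
  rw [vD, vD, Matrix.diagonal_add, vD]; simp

theorem zsmul_vD (a : ℤ) (d : ℕ → ℤ) : a • vD R N d = vD R N fun u => a * d u := by
  rw [vD, vD, ← Matrix.diagonal_smul]; congr 1; ext u; simp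

theorem vU_self (i : ℕ) : vU R N i i = vD R N fun u => if u = i then 1 else 0 := by
  ext u v
  rw [vU, vD, Matrix.of_apply, Matrix.diagonal_apply]
  by_cases h : u = v
  · subst h; simp
  · have : ¬((u : ℕ) = i ∧ (v : ℕ) = i) := fun h' => h (Fin.ext (h'.1.trans h'.2.symm))
    rw [if_neg h, if_neg this]

theorem vD_one : vD R N (fun _ => 1) = 1 := by simp [vD]

theorem vD_commute (d d' : ℕ → ℤ) : Commute (vD R N d) (vD R N d') := by
  rw [Commute, SemiconjBy, vD_mul_vD, vD_mul_vD]; simp only [mul_comm]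

theorem scalar_commute_vU (x : R) (i j : ℕ) : Commute (Matrix.scalar (Fin N) x) (vU R N i j) := by
  rw [Commute, SemiconjBy]
  ext u v
  rw [Matrix.scalar_apply, Matrix.diagonal_mul, Matrix.mul_diagonal, vU, Matrix.of_apply]
  split_ifs <;> simp

theorem scalar_commute_vD (x : R) (d : ℕ → ℤ) : Commute (Matrix.scalar (Fin N) x) (vD R N d) := by
  rw [Commute, SemiconjBy, vD, Matrix.scalar_apply, Matrix.diagonal_mul_diagonal,
    Matrix.diagonal_mul_diagonal]
  congr 1; ext u; exact (Int.cast_comm _ _).symm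

variable {R' : Type} [Ring R']

theorem mapMatrix_vU (κ : R →+* R') (i j : ℕ) : κ.mapMatrix (vU R N i j) = vU R' N i j := by
  ext u v
  simp only [vU, RingHom.mapMatrix_apply, Matrix.map_apply, Matrix.of_apply]
  split_ifs <;> simp

theorem mapMatrix_vD (κ : R →+* R') (d : ℕ → ℤ) : κ.mapMatrix (vD R N d) = vD R' N d := by
  ext u v
  simp only [vD, RingHom.mapMatrix_apply, Matrix.map_apply, Matrix.diagonal_apply]
  split_ifs <;> simp

theorem mapMatrix_scalar (κ : R →+* R') (x : R) :
    κ.mapMatrix (Matrix.scalar (Fin N) x) = Matrix.scalar (Fin N) (κ x) := by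
  ext u v
  simp only [RingHom.mapMatrix_apply, Matrix.map_apply, Matrix.scalar_apply, Matrix.diagonal_apply]
  split_ifs <;> simp

/-- The parities of the basis vectors: those of the vector representation, followed by those of the
two trivial representations. -/
def vp (n r u : ℕ) : ℕ := if u ≤ r then theta n u else u - (r + 1)

/-- The operator `v ↦ (-1) ^ (deg v * k) v`. -/
def vS (R : Type) [Ring R] (n r k : ℕ) : Matrix (Fin (r + 3)) (Fin (r + 3)) R :=
  vD R (r + 3) fun u => (-1) ^ (vp n r u * k)

/-- The eigenvalues of `h_i`. -/
def vw (n i u : ℕ) : ℤ := (if u + 1 = i then 1 else 0) - sg n (i - 1) * sg n i * (if u = i then 1 else 0)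

/-- The Chevalley generators in the vector representation. -/
def vh (R : Type) [Ring R] (n r i : ℕ) : Matrix (Fin (r + 3)) (Fin (r + 3)) R :=
  if 1 ≤ i ∧ i ≤ r then vD R (r + 3) (vw n i) else 0
/-- The Chevalley generators in the vector representation. -/
def ve (R : Type) [Ring R] (r i : ℕ) : Matrix (Fin (r + 3)) (Fin (r + 3)) R :=
  if 1 ≤ i ∧ i ≤ r then vU R (r + 3) (i - 1) i else 0
/-- The Chevalley generators in the vector representation. -/
def vf (R : Type) [Ring R] (r i : ℕ) : Matrix (Fin (r + 3)) (Fin (r + 3)) R :=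
  if 1 ≤ i ∧ i ≤ r then vU R (r + 3) i (i - 1) else 0

theorem vw_sub_one (n i j : ℕ) (hi : 1 ≤ i) (hj : 1 ≤ j) : vw n i (j - 1) = vw n i j + cartan n i j := by
  obtain ⟨j, rfl⟩ := Nat.exists_eq_succ_of_ne_zero (Nat.one_le_iff_ne_zero.1 hj)
  obtain ⟨i, rfl⟩ := Nat.exists_eq_succ_of_ne_zero (Nat.one_le_iff_ne_zero.1 hi)
  simp only [vw, cartan, Nat.succ_eq_add_one, Nat.add_sub_cancel, pow_add, ← sg_eq_pow]
  split_ifs <;> omega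

/-- The eigenvalues of h_i are 0, 1, −1, so that `qN_of_cube` applies. -/
theorem vw_cube (n i u : ℕ) : vw n i u ^ 3 = vw n i u := by
  rw [vw, sg_eq, sg_eq]; split_ifs <;> omega

theorem neg_one_pow_vp (n r j : ℕ) (hj : 1 ≤ j) (hj' : j ≤ r) (k : ℕ) :
    (-1 : ℤ) ^ (vp n r (j - 1) * k) = (-1) ^ (k * chevDeg n j) * (-1) ^ (vp n r j * k) := by
  rw [vp, vp, if_pos (by omega), if_pos hj', chevDeg, ← pow_add]
  have : k * (theta n (j - 1) + theta n j) + theta n j * k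
      = theta n (j - 1) * k + 2 * (theta n j * k) := by ring
  rw [this, pow_add, pow_mul (-1 : ℤ) 2]; simp

theorem int_smul_eq {M : Type} [AddCommGroup M] [Module ℂ⟦X⟧ M] (a : ℤ) (x : M) :
    a • x = (a : ℂ⟦X⟧) • x := (Int.cast_smul_eq_zsmul _ _ _).symm

theorem tau_eq_sg (n i : ℕ) (hi : 1 ≤ i) : tau ℂ⟦X⟧ n i i = ((sg n (i - 1) * sg n i : ℤ) : ℂ⟦X⟧) := by
  rw [tau_eq _ _ _ hi, sg_eq, sg_eq]
  split_ifs <;> first | omega | simp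

theorem isVec (n m : ℕ) (B : Type) [Ring B] [Algebra ℂ⟦X⟧ B] :
    IsVec n m (vh B n (n + m)) (ve B (n + m)) (vf B (n + m))
      (fun i => vS B n (n + m) (chevDeg n i)) where
  h_zero i hi := if_neg hi
  e_zero i hi := if_neg hi
  f_zero i hi := if_neg hi
  hh i j := by
    rw [vh, vh]; split_ifs <;> simp [vD_commute]
  he i j hi hj := by
    rw [vh, ve, if_pos hi, if_pos hj, vD_mul_vU, mul_add, vU_mul_vD, vw_sub_one n i j hi.1 hj.1,
      add_smul, ← Int.cast_comm, zsmul_eq_mul _ (cartan n i j)]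
  hf i j hi hj := by
    rw [vh, vf, if_pos hi, if_pos hj, vD_mul_vU, mul_sub, vU_mul_vD, vw_sub_one n i j hi.1 hj.1,
      add_smul, ← Int.cast_comm, zsmul_eq_mul _ (cartan n i j), add_sub_cancel_right]
  ss i := by
    rw [vS, vD_mul_vD, ← vD_one]; congr 1; ext u; rw [← mul_pow]; simp
  s_comm i j := vD_commute _ _
  hs i j := by
    rw [vh]; split_ifs
    · exact vD_commute _ _
    · exact Commute.zero_left _
  s_e i j := by
    rw [ve]; split_ifs with hj
    · rw [vS, vD_mul_vU, vU_mul_vD, neg_one_pow_vp n _ j hj.1 hj.2, mul_smul,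
        int_smul_eq ((-1) ^ (chevDeg n i * chevDeg n j))]
      push_cast; rfl
    · simp
  s_f i j := by
    rw [vf]; split_ifs with hj
    · rw [vS, vD_mul_vU, vU_mul_vD, neg_one_pow_vp n _ j hj.1 hj.2, mul_smul,
        int_smul_eq ((-1) ^ (chevDeg n i * chevDeg n j)), Int.cast_pow, Int.cast_neg, Int.cast_one,
        smul_smul, ← mul_pow, neg_one_mul, neg_neg, one_pow, one_smul]
    · simp
  ee i j hij := by
    rw [ve, ve]; split_ifs with hi hj <;> first | exact vU_mul_vU_ne (by omega) | simp
  ff i j hij := by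
    rw [vf, vf]; split_ifs with hi hj <;> first | exact vU_mul_vU_ne (by omega) | simp
  ef_ne i j hij := by
    rw [ve, vf]; split_ifs with hi hj <;> first | exact vU_mul_vU_ne (by omega) | simp
  fe_ne i j hij := by
    rw [ve, vf]; split_ifs with hi hj <;> first | exact vU_mul_vU_ne (by omega) | simp
  ef_eq i hi := by
    rw [ve, vf, vh]; split_ifs with hi'
    · rw [vU_mul_vU_self (by omega), vU_mul_vU_self (by omega), tau_eq_sg n i hi, ← int_smul_eq,
        vU_self, vU_self, zsmul_vD, vD_add_vD]
      congr 1; ext u; rw [vw]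
      split_ifs <;> omega
    · simp
  cube i := by
    rw [vh]; split_ifs
    · rw [pow_succ, pow_two, vD_mul_vD, vD_mul_vD]; congr 1; ext u; rw [← pow_two, ← pow_succ, vw_cube]
    · simp

/-- The coproduct with the vector representation and the two trivial representations. -/
theorem IsChev.exists_coproduct {n m : ℕ} {B : Type} [Ring B] [Algebra ℂ⟦X⟧ B] [HComplete B]
    [HComplete (Matrix (Fin (n + m + 3)) (Fin (n + m + 3)) B)] {h e f : ℕ → B}
    (H : IsChev n m h e f) :
    ∃ Q Q' : ℕ → Matrix (Fin (n + m + 3)) (Fin (n + m + 3)) B,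
      (∀ i, Q i = qE (sg n (i - 1) • vh B n (n + m) i)) ∧
      (∀ i, Q' i = qE (-(sg n (i - 1) • Matrix.scalar (Fin (n + m + 3)) (h i)))) ∧
      IsChev n m (fun i => Matrix.scalar _ (h i) + vh B n (n + m) i)
        (fun i => Matrix.scalar _ (e i) * (vS B n (n + m) (chevDeg n i) * Q i) + ve B (n + m) i)
        (fun i => Matrix.scalar _ (f i) * vS B n (n + m) (chevDeg n i) + Q' i * vf B (n + m) i) := by
  refine ⟨_, _, fun i => rfl, fun i => rfl, ?_⟩
  let j : B →ₐ[ℂ⟦X⟧] Matrix (Fin (n + m + 3)) (Fin (n + m + 3)) B :=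
    { Matrix.scalar (Fin (n + m + 3)) with
      commutes' := fun c => rfl }
  have hs : ∀ (x : B) (y) , y ∈ {y | ∀ x : B, Commute (Matrix.scalar (Fin (n + m + 3)) x) y} →
      Commute (Matrix.scalar (Fin (n + m + 3)) x) y := fun x y hy => hy x
  refine (H.map j).coproduct (isVec n m B)
    (S := {y | ∀ x : B, Commute (Matrix.scalar (Fin (n + m + 3)) x) y})
    (fun i x => ?_) (fun i x => ?_) (fun i x => ?_) (fun i x => scalar_commute_vD _ _)
    fun y hy i => ⟨hs _ y hy, hs _ y hy, hs _ y hy⟩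
  · rw [vh]; split_ifs
    · exact scalar_commute_vD _ _
    · exact Commute.zero_right _
  · rw [ve]; split_ifs
    · exact scalar_commute_vU _ _ _
    · exact Commute.zero_right _
  · rw [vf]; split_ifs
    · exact scalar_commute_vU _ _ _
    · exact Commute.zero_right _

/-! ### The coproduct at `h = 0` -/

/-- The classical root vectors. -/
def cN (e : ℕ → R) : ℕ → R
  | 0 => 0
  | 1 => e 1
  | (i + 2) => cN e (i + 1) * e (i + 2) - e (i + 2) * cN e (i + 1)

/-- The classical root vectors. -/
def cP (f : ℕ → R) : ℕ → R
  | 0 => 0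
  | 1 => f 1
  | (i + 2) => f (i + 2) * cP f (i + 1) - cP f (i + 1) * f (i + 2)

theorem scalar_commute_vS (x : R) (n r k : ℕ) :
    Commute (Matrix.scalar (Fin (r + 3)) x) (vS R n r k) := scalar_commute_vD _ _

theorem vS_commute (n r k l : ℕ) : Commute (vS R n r k) (vS R n r l) := vD_commute _ _

theorem vS_mul_vS (n r k l : ℕ) : vS R n r k * vS R n r l = vS R n r (k + l) := by
  rw [vS, vS, vS, vD_mul_vD]; congr 1; ext u; rw [← pow_add, mul_add]

theorem vS_congr {n r k l : ℕ} (hkl : Even (k + l)) : vS R n r k = vS R n r l := by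
  rw [vS, vS]; congr 1; ext u
  refine neg_one_pow_congr ?_
  rw [Nat.even_mul, Nat.even_mul, (Nat.even_add.1 hkl)]

theorem vS_mul_vU {n r i : ℕ} (j k : ℕ) (hi : i ≤ r) :
    vS R n r k * vU R (r + 3) i j = ((-1 : ℤ) ^ (theta n i * k)) • vU R (r + 3) i j := by
  rw [vS, vD_mul_vU, vp, if_pos hi]

theorem vU_mul_vS {n r j : ℕ} (i k : ℕ) (hj : j ≤ r) :
    vU R (r + 3) i j * vS R n r k = ((-1 : ℤ) ^ (theta n j * k)) • vU R (r + 3) i j := by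
  rw [vS, vU_mul_vD, vp, if_pos hj]

/-- The sign picked up when σ' passes U, and σ passes W, is the sign ε of the superbracket; hence
the mixed terms cancel and the bracket is computed in each factor separately. -/
theorem superbracket_coproduct {x y σ σ' U W : R} {ε : ℤ} (hxσ : Commute x σ') (hyσ : Commute y σ)
    (hxW : Commute x W) (hyU : Commute y U) (hσ : Commute σ σ') (h1 : U * σ' = ε • (σ' * U))
    (h2 : σ * W = ε • (W * σ)) :
    (x * σ + U) * (y * σ' + W) - ε • ((y * σ' + W) * (x * σ + U))
      = (x * y - ε • (y * x)) * (σ * σ') + (U * W - ε • (W * U)) := by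
  have e1 : x * σ * (y * σ') = x * y * (σ * σ') := by
    rw [mul_assoc, ← mul_assoc σ, ← hyσ.eq]; simp only [mul_assoc]
  have e2 : y * σ' * (x * σ) = y * x * (σ * σ') := by
    rw [mul_assoc, ← mul_assoc σ', ← hxσ.eq, hσ.eq]; simp only [mul_assoc]
  have e3 : U * (y * σ') = ε • (y * σ' * U) := by
    rw [← mul_assoc, ← hyU.eq, mul_assoc, h1, mul_smul_comm, mul_assoc]
  have e4 : x * σ * W = ε • (W * (x * σ)) := by
    rw [mul_assoc, h2, mul_smul_comm, ← mul_assoc, hxW.eq, mul_assoc]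
  simp only [mul_add, add_mul, sub_mul, e1, e2, e3, e4, smul_add, smul_mul_assoc]
  abel

/-- If θ_i = 1 then i > n and e_{i+1} has degree 2. So the plain commutators in the definition of
the classical root vectors are superbrackets. -/
theorem even_theta_mul_chevDeg (n i : ℕ) : Even (theta n i * chevDeg n (i + 1)) := by
  rw [chevDeg, Nat.add_sub_cancel, theta, theta]
  split_ifs <;> first | omega | decide

/-- At h = 0 the root vectors are primitive up to the parity operator, since superbrackets of
primitive elements are primitive. -/
theorem cN_coproduct (n r : ℕ) (e : ℕ → R) (i : ℕ) (hi : 1 ≤ i) (hir : i ≤ r) :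
    cN (fun i => Matrix.scalar _ (e i) * vS R n r (chevDeg n i) + ve R r i) i
      = Matrix.scalar _ (cN e i) * vS R n r (theta n i) + vU R (r + 3) 0 i := by
  induction i, hi using Nat.le_induction with
  | base =>
    rw [cN, cN, ve, if_pos ⟨le_rfl, hir⟩, chevDeg]
    simp [theta]
  | succ i hi ih =>
    obtain ⟨i, rfl⟩ := Nat.exists_eq_succ_of_ne_zero (Nat.one_le_iff_ne_zero.1 hi)
    rw [cN, ih (by omega), cN, ve, if_pos ⟨by omega, hir⟩]
    have h := superbracket_coproduct (ε := 1) (scalar_commute_vS (cN e (i + 1)) n r (chevDeg n (i + 2)))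
      (scalar_commute_vS (e (i + 2)) n r (theta n (i + 1))) (scalar_commute_vU (cN e (i + 1)) (i + 1) (i + 2))
      (scalar_commute_vU (e (i + 2)) 0 (i + 1))
      (vS_commute _ _ _ _)
      (by
        rw [vS_mul_vU _ _ (by omega), vU_mul_vS _ _ (by omega),
          (even_theta_mul_chevDeg n (i + 1)).neg_one_pow]
        simp [theta])
      (by
        rw [vS_mul_vU _ _ (by omega), vU_mul_vS _ _ (by omega), one_smul]
        congr 1
        refine neg_one_pow_congr ?_
        have := even_theta_mul_chevDeg n (i + 1)
        rwa [chevDeg, mul_add, Nat.even_add, Nat.add_sub_cancel, mul_comm _ (theta n (i + 1 + 1))]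
          at this)
    rw [one_smul, one_smul, vS_mul_vS, vU_mul_vU_self (by omega), vU_mul_vU_ne (by omega)] at h
    rw [map_sub, map_mul, map_mul]
    refine h.trans ?_
    rw [one_smul, sub_zero]
    congr 2
    refine vS_congr ?_
    change Even (theta n (i + 1) + (theta n (i + 1) + theta n (i + 2)) + theta n (i + 2))
    exact ⟨theta n (i + 1) + theta n (i + 2), by ring⟩

theorem cP_coproduct (n r : ℕ) (f : ℕ → R) (i : ℕ) (hi : 1 ≤ i) (hir : i ≤ r) :
    cP (fun i => Matrix.scalar _ (f i) * vS R n r (chevDeg n i) + vf R r i) i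
      = Matrix.scalar _ (cP f i) * vS R n r (theta n i) + vU R (r + 3) i 0 := by
  induction i, hi using Nat.le_induction with
  | base =>
    rw [cP, cP, vf, if_pos ⟨le_rfl, hir⟩, chevDeg]
    simp [theta]
  | succ i hi ih =>
    obtain ⟨i, rfl⟩ := Nat.exists_eq_succ_of_ne_zero (Nat.one_le_iff_ne_zero.1 hi)
    rw [cP, ih (by omega), cP, vf, if_pos ⟨by omega, hir⟩]
    have h := superbracket_coproduct (ε := 1) (scalar_commute_vS (f (i + 2)) n r (theta n (i + 1)))
      (scalar_commute_vS (cP f (i + 1)) n r (chevDeg n (i + 2))) (scalar_commute_vU (f (i + 2)) (i + 1) 0)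
      (scalar_commute_vU (cP f (i + 1)) (i + 2) (i + 1))
      (vS_commute _ _ _ _)
      (by
        rw [vS_mul_vU _ _ (by omega), vU_mul_vS _ _ (by omega), one_smul]
        congr 1
        refine neg_one_pow_congr ?_
        have := even_theta_mul_chevDeg n (i + 1)
        rwa [chevDeg, mul_add, Nat.even_add, Nat.add_sub_cancel, mul_comm _ (theta n (i + 1 + 1))]
          at this)
      (by
        rw [vS_mul_vU _ _ (by omega), vU_mul_vS _ _ (by omega),
          (even_theta_mul_chevDeg n (i + 1)).neg_one_pow]
        simp [theta])
    rw [one_smul, one_smul, vS_mul_vS, vU_mul_vU_self (by omega), vU_mul_vU_ne (by omega)] at h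
    rw [map_sub, map_mul, map_mul]
    refine h.trans ?_
    rw [one_smul, sub_zero]
    congr 2
    refine vS_congr ?_
    change Even (theta n (i + 1) + theta n (i + 2) + theta n (i + 1) + theta n (i + 2))
    exact ⟨theta n (i + 1) + theta n (i + 2), by ring⟩

/-- The root vectors `x_{0j} = N_j`, `x_{i0} = P_i`, `x_{ij} = ⟦P_i, N_j⟧`. -/
def cX (n : ℕ) (P N : ℕ → R) (i j : ℕ) : R :=
  if i = 0 then N j else if j = 0 then P i else
    P i * N j - ((-1 : ℤ) ^ (theta n i * theta n j)) • (N j * P i)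

/-- The images of the root vectors in the vector representation. -/
def vX (R : Type) [Ring R] (n r i j : ℕ) : Matrix (Fin (r + 3)) (Fin (r + 3)) R :=
  vU R (r + 3) i j - if i = j then ((-1 : ℤ) ^ theta n i) • vU R (r + 3) 0 0 else 0

/-- The last term of the second factor comes from ⟦E_{i0}, E_{0j}⟧ = E_{ij}, corrected for i = j by
a multiple of E_{00}. -/
theorem cX_coproduct (n r : ℕ) {P N : ℕ → R} {P' N' : ℕ → Matrix (Fin (r + 3)) (Fin (r + 3)) R}
    (hP : ∀ i, 1 ≤ i → i ≤ r →
      P' i = Matrix.scalar _ (P i) * vS R n r (theta n i) + vU R (r + 3) i 0)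
    (hN : ∀ i, 1 ≤ i → i ≤ r →
      N' i = Matrix.scalar _ (N i) * vS R n r (theta n i) + vU R (r + 3) 0 i)
    (i j : ℕ) (hi : i ≤ r) (hj : j ≤ r) (hij : ¬(i = 0 ∧ j = 0)) :
    cX n P' N' i j
      = Matrix.scalar _ (cX n P N i j) * vS R n r (theta n i + theta n j) + vX R n r i j := by
  have h0 : theta n 0 = 0 := by simp [theta]
  rcases Nat.eq_zero_or_pos i with rfl | hi0
  · rw [cX, cX, if_pos rfl, if_pos rfl, hN j (by omega) hj, vX, if_neg (by omega), sub_zero, h0,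
      zero_add]
  rcases Nat.eq_zero_or_pos j with rfl | hj0
  · rw [cX, cX, if_neg (by omega), if_pos rfl, if_neg (by omega), if_pos rfl, hP i (by omega) hi, vX,
      if_neg (by omega), sub_zero, h0, add_zero]
  have hsq : ((-1 : ℤ) ^ (theta n i * theta n j)) * ((-1 : ℤ) ^ (theta n i * theta n j)) = 1 := by
    rw [← mul_pow]; simp
  rw [cX, cX, if_neg (by omega), if_neg (by omega), if_neg (by omega), if_neg (by omega),
    hP i hi0 hi, hN j hj0 hj]
  have h := superbracket_coproduct (ε := (-1 : ℤ) ^ (theta n i * theta n j))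
    (scalar_commute_vS (P i) n r (theta n j))
    (scalar_commute_vS (N j) n r (theta n i)) (scalar_commute_vU (P i) 0 j)
    (scalar_commute_vU (N j) i 0)
    (vS_commute _ _ _ _)
    (by
      rw [vS_mul_vU _ _ (by omega), vU_mul_vS _ _ (by omega), smul_smul, hsq, h0, zero_mul,
        pow_zero])
    (by
      rw [vS_mul_vU _ _ (by omega), vU_mul_vS _ _ (by omega), smul_smul, mul_comm (theta n j),
        hsq, h0, zero_mul, pow_zero])
  rw [vS_mul_vS, vU_mul_vU_self (by omega)] at h
  rw [map_sub, map_zsmul, map_mul, map_mul]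
  refine h.trans ?_
  congr 1
  rw [vX]
  split_ifs with hij
  · subst hij
    rw [vU_mul_vU_self (by omega)]
    congr 2
    rw [theta]; split_ifs <;> simp
  · rw [vU_mul_vU_ne (by omega), smul_zero]

end VecRep

end UqSl
end

noncomputable section

namespace UqSl

/-! ### Linear independence of ordered monomials -/

section Independence

variable {I : Type}

/-- The word `w`, as an element of the free algebra. -/
def mon (w : List I) : FreeAlgebra ℂ I := (w.map (FreeAlgebra.ι ℂ)).prod

theorem mon_nil : mon ([] : List I) = 1 := rfl

theorem mon_cons (α : I) (w : List I) : mon (α :: w) = FreeAlgebra.ι ℂ α * mon w := by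
  rw [mon, mon, List.map_cons, List.prod_cons]

/-- The span of the words of length less than `k`. -/
def shortWords (I : Type) (k : ℕ) : Submodule ℂ (FreeAlgebra ℂ I) :=
  Submodule.span ℂ {x | ∃ w : List I, w.length < k ∧ x = mon w}

theorem mon_mem_shortWords {w : List I} {k : ℕ} (h : w.length < k) : mon w ∈ shortWords I k :=
  Submodule.subset_span ⟨w, h, rfl⟩

theorem shortWords_mono {k l : ℕ} (h : k ≤ l) : shortWords I k ≤ shortWords I l :=
  Submodule.span_mono fun _ ⟨w, hw, hx⟩ => ⟨w, by omega, hx⟩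

theorem ι_mul_mem_shortWords (α : I) {x : FreeAlgebra ℂ I} {k : ℕ} (hx : x ∈ shortWords I k) :
    FreeAlgebra.ι ℂ α * x ∈ shortWords I (k + 1) := by
  induction hx using Submodule.span_induction with
  | mem x hx =>
    obtain ⟨w, hw, rfl⟩ := hx
    rw [← mon_cons]; exact mon_mem_shortWords (by simpa using hw)
  | zero => rw [mul_zero]; exact zero_mem _
  | add x y _ _ hx hy => rw [mul_add]; exact add_mem hx hy
  | smul c x _ hx => rw [mul_smul_comm]; exact Submodule.smul_mem _ _ hx

variable {J : Type} [Fintype J] [DecidableEq J]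

/-- The homomorphism which describes the tensor product with a finite-dimensional representation:
`x_α` acts by `χ u α • x_α` on the `u`-th basis vector, plus the matrix `π α`. -/
def coaction (χ : J → I → ℂ) (π : I → Matrix J J ℂ) :
    FreeAlgebra ℂ I →ₐ[ℂ] Matrix J J (FreeAlgebra ℂ I) :=
  FreeAlgebra.lift ℂ fun α => Matrix.diagonal (fun u => χ u α • FreeAlgebra.ι ℂ α)
    + (π α).map (algebraMap ℂ (FreeAlgebra ℂ I))

/-- The product of the `χ u α` for `α ∈ w`. -/
def charWord (χ : J → I → ℂ) (w : List I) (u : J) : ℂ := (w.map (χ u)).prod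

/-- The subleading term of the coaction on a word. -/
def subWord (χ : J → I → ℂ) (π : I → Matrix J J ℂ) (u v : J) : List I → FreeAlgebra ℂ I
  | [] => 0
  | α :: w => χ u α • (FreeAlgebra.ι ℂ α * subWord χ π u v w) + (π α u v * charWord χ w v) • mon w

variable {χ : J → I → ℂ} {π : I → Matrix J J ℂ}

omit [Fintype J] [DecidableEq J] in
theorem subWord_mem (u v : J) (w : List I) : subWord χ π u v w ∈ shortWords I w.length := by
  induction w with
  | nil => exact zero_mem _
  | cons α w ih =>
    exact add_mem (Submodule.smul_mem _ _ (ι_mul_mem_shortWords α ih))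
      (Submodule.smul_mem _ _ (mon_mem_shortWords (by simp)))

/-- Expansion of the product by the number of letters for which the matrix part is taken. With none,
the word itself appears on the diagonal; with exactly one, `subWord`; with two or more, words at
least two letters shorter. -/
theorem coaction_mon (w : List I) (u v : J) :
    coaction χ π (mon w) u v - (if u = v then charWord χ w u • mon w else 0) - subWord χ π u v w
      ∈ shortWords I (w.length - 1) := by
  induction w generalizing u v with
  | nil =>
    rw [mon_nil, map_one, Matrix.one_apply, subWord, charWord]
    simp
  | cons α w ih =>
    have hx : coaction χ π (mon (α :: w)) u v
        = χ u α • (FreeAlgebra.ι ℂ α * coaction χ π (mon w) u v)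
          + ∑ t, π α u t • coaction χ π (mon w) t v := by
      rw [mon_cons, map_mul, coaction, FreeAlgebra.lift_ι_apply, ← coaction, add_mul,
        Matrix.add_apply, Matrix.diagonal_mul, smul_mul_assoc, Matrix.mul_apply]
      simp only [Matrix.map_apply, ← Algebra.smul_def]
    have h1 : ∀ t, coaction χ π (mon w) t v - (if t = v then charWord χ w t • mon w else 0)
        ∈ shortWords I w.length := fun t => by
      have := add_mem (shortWords_mono (Nat.sub_le _ _) (ih t v)) (subWord_mem (χ := χ) (π := π) t v w)
      rwa [sub_add_cancel] at this
    have h2 : FreeAlgebra.ι ℂ α * (coaction χ π (mon w) u v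
        - (if u = v then charWord χ w u • mon w else 0) - subWord χ π u v w)
        ∈ shortWords I w.length := by
      rcases w with _ | ⟨β, w⟩
      · have h0 : coaction χ π (mon ([] : List I)) u v
          - (if u = v then charWord χ ([] : List I) u • mon ([] : List I) else 0)
          - subWord χ π u v ([] : List I) = 0 := by
          rw [mon_nil, map_one, Matrix.one_apply, subWord, charWord]; simp
        rw [h0, mul_zero]; exact zero_mem _
      · exact ι_mul_mem_shortWords α (ih u v)
    have h3 : ∑ t, π α u t • (coaction χ π (mon w) t v
        - (if t = v then charWord χ w t • mon w else 0)) ∈ shortWords I w.length :=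
      Submodule.sum_mem _ fun t _ => Submodule.smul_mem _ _ (h1 t)
    have h4 : ∑ t, π α u t • (if t = v then charWord χ w t • mon w else 0)
        = (π α u v * charWord χ w v) • mon w := by
      rw [Finset.sum_eq_single v (fun t _ ht => by rw [if_neg ht, smul_zero]) (by simp), if_pos rfl,
        smul_smul]
    simp only [smul_sub, Finset.sum_sub_distrib] at h3
    rw [h4] at h3
    have h5 := add_mem (Submodule.smul_mem _ (χ u α) h2) h3
    rw [List.length_cons, Nat.add_sub_cancel]
    convert h5 using 1
    rw [hx, subWord, mon_cons, charWord, List.map_cons, List.prod_cons, ← charWord]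
    split_ifs with huv <;>
      simp only [mul_sub, smul_sub, mul_zero, smul_zero, sub_zero, mul_smul_comm, smul_smul] <;> abel

/-- Matrix entries which detect the `x_β`. -/
structure IsDetecting (χ : J → I → ℂ) (π : I → Matrix J J ℂ) (odd : I → Prop) (b b' c : I → J) :
    Prop where
  χ_ne : ∀ u α, χ u α ≠ 0
  π_self : ∀ β, π β (b β) (b' β) = 1
  π_ne : ∀ α β, α ≠ β → π α (b β) (b' β) = 0
  π_c : ∀ α β, b β = b' β → π α (c β) (c β) = 0
  χ_c : ∀ α β, b β = b' β → χ (b β) α = χ (c β) α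
  even : ∀ β, ¬odd β → (∀ α, χ (b β) α = χ (b' β) α) ∧ χ (b β) β = 1

/-- The linear map detecting `x_β`. -/
def detect (χ : J → I → ℂ) (π : I → Matrix J J ℂ) (b b' c : I → J) (β : I) :
    FreeAlgebra ℂ I →ₗ[ℂ] FreeAlgebra ℂ I :=
  (Matrix.entryLinearMap ℂ (FreeAlgebra ℂ I) (b β) (b' β)
    - if b β = b' β then Matrix.entryLinearMap ℂ (FreeAlgebra ℂ I) (c β) (c β) else 0)
    ∘ₗ (coaction χ π).toLinearMap

variable {odd : I → Prop} {b b' c : I → J}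

omit [Fintype J] [DecidableEq J] in
theorem charWord_ne (h : IsDetecting χ π odd b b' c) (w : List I) (u : J) : charWord χ w u ≠ 0 := by
  refine List.prod_ne_zero fun h0 => ?_
  obtain ⟨α, -, hα⟩ := List.mem_map.1 h0
  exact h.χ_ne u α hα

theorem detect_apply (β : I) (x : FreeAlgebra ℂ I) : detect χ π b b' c β x
    = coaction χ π x (b β) (b' β) - if b β = b' β then coaction χ π x (c β) (c β) else 0 := by
  rw [detect]; split_ifs <;> simp

omit [Fintype J] [DecidableEq J] in
theorem subWord_c (h : IsDetecting χ π odd b b' c) (β : I) (hβ : b β = b' β) (w : List I) :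
    subWord χ π (c β) (c β) w = 0 := by
  induction w with
  | nil => rfl
  | cons α w ih => rw [subWord, ih, h.π_c α β hβ]; simp

/-- Off the diagonal there is no leading term. On the diagonal the leading term is cancelled by the
(c, c) entry, which carries the same character but belongs to a trivial representation, so its own
subleading term vanishes. This is what the trivial representations of both parities are for. -/
theorem detect_mon (h : IsDetecting χ π odd b b' c) (β : I) (w : List I) :
    detect χ π b b' c β (mon w) - subWord χ π (b β) (b' β) w ∈ shortWords I (w.length - 1) := by
  have h1 := coaction_mon (χ := χ) (π := π) w (b β) (b' β)
  rw [detect_apply]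
  split_ifs with hβ
  · have h2 := coaction_mon (χ := χ) (π := π) w (c β) (c β)
    rw [subWord_c h β hβ, sub_zero, if_pos rfl] at h2
    rw [if_pos hβ] at h1
    have h3 : charWord χ w (b β) = charWord χ w (c β) := by
      rw [charWord, charWord]; congr 2; ext α; exact h.χ_c α β hβ
    rw [h3] at h1
    have h4 := sub_mem h1 h2
    convert h4 using 1
    abel
  · rw [if_neg hβ] at h1
    exact h1

theorem detect_mem (h : IsDetecting χ π odd b b' c) (β : I) {k : ℕ} {x : FreeAlgebra ℂ I}
    (hx : x ∈ shortWords I (k + 1)) : detect χ π b b' c β x ∈ shortWords I k := by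
  induction hx using Submodule.span_induction with
  | mem x hx =>
    obtain ⟨w, hw, rfl⟩ := hx
    have h1 := add_mem (shortWords_mono (Nat.sub_le _ _) (detect_mon h β w))
      (subWord_mem (χ := χ) (π := π) (b β) (b' β) w)
    rw [sub_add_cancel] at h1
    exact shortWords_mono (by omega) h1
  | zero => rw [map_zero]; exact zero_mem _
  | add x y _ _ hx hy => rw [map_add]; exact add_mem hx hy
  | smul c x _ hx => rw [map_smul]; exact Submodule.smul_mem _ _ hx

variable [LinearOrder I]

/-- Ordered words in which odd letters are not repeated. -/
def IsPBW (odd : I → Prop) (w : List I) : Prop :=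
  w.Pairwise (· ≤ ·) ∧ ∀ β, odd β → w.count β ≤ 1

theorem IsPBW.of_cons {α : I} {w : List I} (h : IsPBW odd (α :: w)) : IsPBW odd w :=
  ⟨(List.pairwise_cons.1 h.1).2, fun β hβ =>
    (List.count_le_count_cons).trans (h.2 β hβ)⟩

theorem IsPBW.erase {w : List I} (h : IsPBW odd w) (β : I) : IsPBW odd (w.erase β) :=
  ⟨h.1.sublist List.erase_sublist, fun γ hγ =>
    (List.Sublist.count_le γ List.erase_sublist).trans (h.2 γ hγ)⟩

-- Each occurrence of β contributes the word with that occurrence deleted. In a sorted word the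
-- copies of an even β are adjacent and contribute with equal factors, so the total is `count`; an
-- odd β occurs at most once. The clause on ε for even β is carried along to match the factors in
-- the induction.
omit [Fintype J] [DecidableEq J] in
theorem subWord_of_isPBW (h : IsDetecting χ π odd b b' c) (β : I) (w : List I) (hw : IsPBW odd w) :
    ∃ ε : ℂ, ε ≠ 0 ∧ (¬odd β → ε = charWord χ w (b' β)) ∧
      subWord χ π (b β) (b' β) w = (ε * (w.count β : ℂ)) • mon (w.erase β) := by
  induction w with
  | nil => exact ⟨1, one_ne_zero, fun _ => by simp [charWord], by simp [subWord]⟩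
  | cons α w ih =>
    obtain ⟨ε, hε, hε', hs⟩ := ih hw.of_cons
    by_cases hαβ : α = β
    · subst hαβ
      rw [List.erase_cons_head, List.count_cons_self, subWord, h.π_self, hs, one_mul]
      by_cases hodd : odd α
      · have h0 : w.count α = 0 := by
          have := hw.2 α hodd
          rw [List.count_cons_self] at this; omega
        refine ⟨_, charWord_ne h w (b' α), fun h => absurd hodd h, ?_⟩
        rw [h0]; simp
      · obtain ⟨h1, h2⟩ := h.even α hodd
        refine ⟨charWord χ (α :: w) (b' α), charWord_ne h _ _, fun _ => rfl, ?_⟩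
        have h3 : charWord χ (α :: w) (b' α) = charWord χ w (b' α) := by
          rw [charWord, List.map_cons, List.prod_cons, ← h1, h2, one_mul]; rfl
        rw [h3, h2, one_smul, hε' hodd]
        by_cases hα : α ∈ w
        · have h4 : FreeAlgebra.ι ℂ α * mon (w.erase α) = mon w := by
            rw [← mon_cons]
            congr 1
            rcases w with _ | ⟨γ, w⟩
            · simp at hα
            · have h5 : α = γ := by
                have h6 := List.pairwise_cons.1 hw.1
                have h7 := h6.1 γ (by simp)
                rcases List.mem_cons.1 hα with h8 | h8
                · exact h8
                · exact le_antisymm h7 ((List.pairwise_cons.1 h6.2).1 α h8)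
              rw [h5, List.erase_cons_head]
          rw [mul_smul_comm, h4, ← add_smul]
          congr 1; push_cast; ring
        · rw [List.count_eq_zero_of_not_mem hα]; simp
    · rw [List.count_cons_of_ne hαβ, List.erase_cons_tail (by simpa using hαβ), subWord,
        h.π_ne α β hαβ, hs]
      refine ⟨χ (b β) α * ε, mul_ne_zero (h.χ_ne _ _) hε, fun hodd => ?_, ?_⟩
      · rw [hε' hodd, charWord, charWord, List.map_cons, List.prod_cons, (h.even β hodd).1]
      · rw [mul_smul_comm, smul_smul, mon_cons, zero_mul, zero_smul, add_zero, mul_assoc]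

/-- Induction on the length D. For a word w choose a letter β of it; `detect` at β keeps the
relation in Z, lowers lengths by one, and replaces each leading word containing β by that word with
one β erased, times a nonzero scalar. In length 0 a nonzero coefficient would put 1 into Z. -/
theorem coeff_eq_zero_of_isPBW (h : IsDetecting χ π odd b b' c) (Z : Submodule ℂ (FreeAlgebra ℂ I))
    (hZ : ∀ z ∈ Z, ∀ u v, coaction χ π z u v ∈ Z) (h1 : (1 : FreeAlgebra ℂ I) ∉ Z) (D : ℕ) :
    ∀ (s : Finset (List I)) (a : List I → ℂ), (∀ w ∈ s, IsPBW odd w ∧ w.length = D) →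
      (∃ y ∈ shortWords I D, ∑ w ∈ s, a w • mon w + y ∈ Z) → ∀ w ∈ s, a w = 0 := by
  induction D with
  | zero =>
    intro s a hs ⟨y, hy, hz⟩ w hw
    have hnil : ∀ w ∈ s, w = [] := fun w hw => List.length_eq_zero_iff.1 (hs w hw).2
    have hy0 : y = 0 := by
      have : shortWords I 0 = ⊥ := by
        rw [shortWords, Submodule.span_eq_bot]
        rintro x ⟨w, hw, -⟩
        omega
      rw [this] at hy; exact hy
    have hs' : s = {[]} := Finset.eq_singleton_iff_unique_mem.2 ⟨hnil w hw ▸ hw, hnil⟩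
    rw [hs', Finset.sum_singleton, hy0, add_zero, mon_nil] at hz
    rw [hnil w hw]
    by_contra h0
    refine h1 ?_
    have := Z.smul_mem (a [])⁻¹ hz
    rwa [smul_smul, inv_mul_cancel₀ h0, one_smul] at this
  | succ D ih =>
    intro s a hs ⟨y, hy, hz⟩ w hw
    obtain ⟨β, hβ⟩ : ∃ β, β ∈ w := by
      rcases w with _ | ⟨β, w⟩
      · simpa using (hs _ hw).2
      · exact ⟨β, by simp⟩
    have hR : ∀ z ∈ Z, detect χ π b b' c β z ∈ Z := by
      intro z hz
      rw [detect_apply]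
      split_ifs
      · exact sub_mem (hZ z hz _ _) (hZ z hz _ _)
      · rw [sub_zero]; exact hZ z hz _ _
    have hex : ∀ w, ∃ ε : ℂ, IsPBW odd w → ε ≠ 0 ∧
        subWord χ π (b β) (b' β) w = (ε * (w.count β : ℂ)) • mon (w.erase β) := by
      intro w
      by_cases hw : IsPBW odd w
      · obtain ⟨ε, h1, -, h2⟩ := subWord_of_isPBW h β w hw
        exact ⟨ε, fun _ => ⟨h1, h2⟩⟩
      · exact ⟨0, fun h => absurd h hw⟩
    choose ε hε using hex
    -- Sorted words are determined by their multisets of letters, so erasing β merges no two terms.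
    have hinj : Set.InjOn (fun w : List I => w.erase β) (s.filter (β ∈ ·) : Finset (List I)) := by
      intro w hw w' hw' hww
      rw [Finset.coe_filter] at hw hw'
      have hp : w.Perm w' := (List.perm_cons_erase hw.2).trans
        ((by rw [show w.erase β = w'.erase β from hww] : (β :: w.erase β).Perm (β :: w'.erase β)).trans
          (List.perm_cons_erase hw'.2).symm)
      exact hp.eq_of_pairwise (fun _ _ _ _ h1 h2 => le_antisymm h1 h2) (hs w hw.1).1.1 (hs w' hw'.1).1.1
    -- The coefficient of a shorter word is written as a sum over its preimages; by `hinj` there is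
    -- only one.
    have key := ih ((s.filter (β ∈ ·)).image (fun w => w.erase β))
      (fun v => ∑ w ∈ s.filter (fun w => β ∈ w ∧ w.erase β = v), a w * (ε w * (w.count β : ℂ))) ?_ ?_
      (w.erase β) (Finset.mem_image_of_mem _ (Finset.mem_filter.2 ⟨hw, hβ⟩))
    · rw [Finset.sum_eq_single w] at key
      · have h2 := (hε w (hs w hw).1).1
        have h3 : (w.count β : ℂ) ≠ 0 := Nat.cast_ne_zero.2 (List.count_pos_iff.2 hβ).ne'
        rcases mul_eq_zero.1 key with h4 | h4
        · exact h4
        · exact absurd h4 (mul_ne_zero h2 h3)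
      · intro w' hw' hne
        have h5 := (Finset.mem_filter.1 hw').2
        exact absurd (hinj (by simpa using ⟨(Finset.mem_filter.1 hw').1, h5.1⟩)
          (by simpa using ⟨hw, hβ⟩) h5.2) hne
      · intro hn
        exact absurd (Finset.mem_filter.2 ⟨hw, hβ, rfl⟩) hn
    · intro v hv
      obtain ⟨w', hw', rfl⟩ := Finset.mem_image.1 hv
      obtain ⟨hw1, hw2⟩ := Finset.mem_filter.1 hw'
      refine ⟨(hs w' hw1).1.erase β, ?_⟩
      rw [List.length_erase_of_mem hw2, (hs w' hw1).2, Nat.add_sub_cancel]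
    · have hsum : ∑ v ∈ (s.filter (β ∈ ·)).image (fun w => w.erase β),
          (∑ w ∈ s.filter (fun w => β ∈ w ∧ w.erase β = v), a w * (ε w * (w.count β : ℂ))) • mon v
          = ∑ w ∈ s, a w • subWord χ π (b β) (b' β) w := by
        rw [← Finset.sum_filter_of_ne (p := (β ∈ ·)) (s := s)]
        · refine Eq.trans ?_ (Finset.sum_fiberwise_of_maps_to
            (fun w hw => Finset.mem_image_of_mem (fun w : List I => w.erase β) hw) _)
          refine Finset.sum_congr rfl fun v _ => ?_
          rw [Finset.sum_smul, Finset.filter_filter]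
          refine Finset.sum_congr rfl fun w hw => ?_
          obtain ⟨hw1, hw2, hw3⟩ := Finset.mem_filter.1 hw
          rw [(hε w (hs w hw1).1).2, hw3, smul_smul]
        · intro w hw hne
          by_contra hβw
          refine hne ?_
          rw [(hε w (hs w hw).1).2, List.count_eq_zero_of_not_mem hβw]; simp
      refine ⟨detect χ π b b' c β (∑ w ∈ s, a w • mon w + y)
        - ∑ w ∈ s, a w • subWord χ π (b β) (b' β) w, ?_, ?_⟩
      · rw [map_add, map_sum, add_sub_right_comm, ← Finset.sum_sub_distrib]
        refine add_mem (Submodule.sum_mem _ fun w hw => ?_) (detect_mem h β hy)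
        rw [map_smul, ← smul_sub]
        have := detect_mon h β w
        rw [(hs w hw).2, Nat.add_sub_cancel] at this
        exact Submodule.smul_mem _ _ this
      · rw [hsum, add_sub_cancel]
        exact hR _ hz

theorem eq_zero_of_mem_span_isPBW (h : IsDetecting χ π odd b b' c)
    (Z : Submodule ℂ (FreeAlgebra ℂ I))
    (hZ : ∀ z ∈ Z, ∀ u v, coaction χ π z u v ∈ Z) (h1 : (1 : FreeAlgebra ℂ I) ∉ Z)
    {z : FreeAlgebra ℂ I} (hz : z ∈ Submodule.span ℂ (mon '' {w | IsPBW odd w}))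
    (hzZ : z ∈ Z) : z = 0 := by
  obtain ⟨a, ha, rfl⟩ := (Finsupp.mem_span_image_iff_linearCombination ℂ).1 hz
  rw [Finsupp.mem_supported] at ha
  -- Induction on a bound for the lengths: the words of maximal length have zero coefficients, the
  -- others counting as lower terms.
  suffices key : ∀ D : ℕ, (∀ w ∈ a.support, w.length < D) → a = 0 by
    rw [key (a.support.sup List.length + 1) fun w hw =>
      Nat.lt_succ_of_le (Finset.le_sup (f := List.length) hw), map_zero]
  rw [Finsupp.linearCombination_apply, Finsupp.sum] at hzZ
  intro D
  induction D with
  | zero =>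
    intro hD
    exact Finsupp.support_eq_empty.1 (Finset.eq_empty_of_forall_notMem fun w hw => by
      simpa using hD w hw)
  | succ D ih =>
    intro hD
    refine ih fun w hw => lt_of_le_of_ne (Nat.le_of_lt_succ (hD w hw)) fun hwD => ?_
    refine Finsupp.mem_support_iff.1 hw (coeff_eq_zero_of_isPBW h Z hZ h1 D
      (a.support.filter (·.length = D)) a (fun w hw => ?_)
      ⟨∑ w ∈ a.support.filter (¬ ·.length = D), a w • mon w, ?_, ?_⟩ w
      (Finset.mem_filter.2 ⟨hw, hwD⟩))
    · exact ⟨ha (Finset.mem_filter.1 hw).1, (Finset.mem_filter.1 hw).2⟩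
    · refine Submodule.sum_mem _ fun w hw => Submodule.smul_mem _ _ (mon_mem_shortWords ?_)
      have h2 := Finset.mem_filter.1 hw
      exact lt_of_le_of_ne (Nat.le_of_lt_succ (hD w h2.1)) h2.2
    · rw [Finset.sum_filter_add_sum_filter_not]; exact hzZ

end Independence

end UqSl
end

noncomputable section

namespace UqSl

/-! ### Ordered monomials span -/

section Spanning

variable {I : Type} {C : Type} [Ring C] [Algebra ℂ C]

/-- The superbracket of elements of degrees `k` and `l`. -/
def sb {C : Type} [Ring C] (k l : ℕ) (x y : C) : C := x * y - ((-1 : ℤ) ^ (k * l)) • (y * x)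

/-- The span of the products of length less than `k`. -/
def shortProducts (x : I → C) (k : ℕ) : Submodule ℂ C :=
  (shortWords I k).map (FreeAlgebra.lift ℂ x).toLinearMap

theorem lift_mon_cons (x : I → C) (α : I) (w : List I) :
    FreeAlgebra.lift ℂ x (mon (α :: w)) = x α * FreeAlgebra.lift ℂ x (mon w) := by
  rw [mon_cons, map_mul, FreeAlgebra.lift_ι_apply]

theorem mon_mem_shortProducts (x : I → C) {w : List I} {k : ℕ} (h : w.length < k) :
    FreeAlgebra.lift ℂ x (mon w) ∈ shortProducts x k :=
  ⟨_, mon_mem_shortWords h, rfl⟩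

theorem mul_mem_shortProducts (x : I → C) (α : I) {y : C} {k : ℕ} (hy : y ∈ shortProducts x k) :
    x α * y ∈ shortProducts x (k + 1) := by
  obtain ⟨t, ht, rfl⟩ := hy
  exact ⟨_, ι_mul_mem_shortWords α ht, by simp⟩

theorem span_mul_mem_shortProducts (x : I → C) {y : C} (hy : y ∈ Submodule.span ℂ (Set.range x))
    {w : List I} {k : ℕ} (hw : w.length + 1 < k) :
    y * FreeAlgebra.lift ℂ x (mon w) ∈ shortProducts x k := by
  induction hy using Submodule.span_induction with
  | mem y hy =>
    obtain ⟨α, rfl⟩ := hy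
    rw [← lift_mon_cons]; exact mon_mem_shortProducts x (by simpa using hw)
  | zero => rw [zero_mul]; exact zero_mem _
  | add y z _ _ hy hz => rw [add_mul]; exact add_mem hy hz
  | smul c y _ hy => rw [smul_mul_assoc]; exact Submodule.smul_mem _ _ hy

variable {x : I → C} {p : I → ℕ}

/-- A transposition of neighbours costs a sign and a superbracket; the latter lies in the span of
the family and therefore shortens the product. -/
theorem perm_mem_shortProducts
    (hx : ∀ α β, sb (p α) (p β) (x α) (x β) ∈ Submodule.span ℂ (Set.range x)) {w w' : List I}
    (h : w.Perm w') : ∃ ε : ℤ, FreeAlgebra.lift ℂ x (mon w) - ε • FreeAlgebra.lift ℂ x (mon w')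
      ∈ shortProducts x w.length := by
  induction h with
  | nil => exact ⟨1, by simp⟩
  | cons α h ih =>
    obtain ⟨ε, hε⟩ := ih
    refine ⟨ε, ?_⟩
    rw [lift_mon_cons, lift_mon_cons, ← mul_smul_comm, ← mul_sub]
    exact mul_mem_shortProducts x α hε
  | swap α β w =>
    refine ⟨(-1) ^ (p β * p α), ?_⟩
    have := span_mul_mem_shortProducts x (hx β α) (w := w) (k := (β :: α :: w).length) (by simp)
    rw [sb, sub_mul, smul_mul_assoc, mul_assoc, mul_assoc] at this
    simpa only [lift_mon_cons] using this
  | trans h1 h2 ih1 ih2 =>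
    obtain ⟨ε, hε⟩ := ih1
    obtain ⟨ε', hε'⟩ := ih2
    refine ⟨ε * ε', ?_⟩
    rw [← h1.length_eq] at hε'
    have := add_mem hε (zsmul_mem hε' ε)
    rwa [smul_sub, smul_smul, sub_add_sub_cancel] at this

/-- Strong induction on length. A word without repeated odd letters is sorted modulo shorter words.
Otherwise two copies of an odd letter are brought to the front, and their product is replaced by an
element of the span. -/
theorem prod_mem_span_isPBW [LinearOrder I]
    (hx : ∀ α β, sb (p α) (p β) (x α) (x β) ∈ Submodule.span ℂ (Set.range x)) (w : List I) :
    FreeAlgebra.lift ℂ x (mon w) ∈ (Submodule.span ℂ (mon '' {w | IsPBW (fun α => Odd (p α)) w})).map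
      (FreeAlgebra.lift ℂ x).toLinearMap := by
  set PB := (Submodule.span ℂ (mon '' {w | IsPBW (fun α => Odd (p α)) w})).map
      (FreeAlgebra.lift ℂ x).toLinearMap with hPB
  induction hk : w.length using Nat.strong_induction_on generalizing w with
  | _ k ih =>
    subst hk
    have hshort : shortProducts x w.length ≤ PB := by
      rw [shortProducts, shortWords, Submodule.map_span, Submodule.span_le]
      rintro _ ⟨_, ⟨v, hv, rfl⟩, rfl⟩
      exact ih _ hv v rfl
    by_cases hodd : ∀ β, Odd (p β) → w.count β ≤ 1
    · obtain ⟨ε, hε⟩ := perm_mem_shortProducts hx (List.perm_insertionSort (· ≤ ·) w).symm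
      have h1 : FreeAlgebra.lift ℂ x (mon (w.insertionSort (· ≤ ·))) ∈ PB := by
        refine ⟨_, Submodule.subset_span ⟨_, ⟨List.pairwise_insertionSort _ _, fun β hβ => ?_⟩, rfl⟩, rfl⟩
        rw [(List.perm_insertionSort (· ≤ ·) w).count_eq]; exact hodd β hβ
      have h2 := add_mem (hshort hε) (zsmul_mem h1 ε)
      rwa [sub_add_cancel] at h2
    · push Not at hodd
      obtain ⟨β, hβ, hc⟩ := hodd
      have hperm : ∃ v, w.Perm (β :: β :: v) := by
        have h1 : β ∈ w := List.count_pos_iff.1 (by omega)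
        have h2 : β ∈ w.erase β := List.count_pos_iff.1 (by rw [List.count_erase_self]; omega)
        exact ⟨_, (List.perm_cons_erase h1).trans ((List.perm_cons_erase h2).cons β)⟩
      obtain ⟨v, hv⟩ := hperm
      obtain ⟨ε, hε⟩ := perm_mem_shortProducts hx hv
      -- For odd β the superbracket of x_β with itself is twice its square, and 2 is invertible.
      have h1 : x β * x β ∈ Submodule.span ℂ (Set.range x) := by
        have h2 := hx β β
        rw [sb, (hβ.mul hβ).neg_one_pow, neg_one_smul, sub_neg_eq_add, ← two_smul ℂ] at h2
        have h3 := Submodule.smul_mem _ (2 : ℂ)⁻¹ h2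
        rwa [smul_smul, inv_mul_cancel₀ two_ne_zero, one_smul] at h3
      have h4 := span_mul_mem_shortProducts x h1 (w := v) (k := w.length) (by rw [hv.length_eq]; simp)
      rw [mul_assoc, ← lift_mon_cons, ← lift_mon_cons] at h4
      have h2 := add_mem hε (zsmul_mem h4 ε)
      rw [sub_add_cancel] at h2
      exact hshort h2

theorem exists_isPBW_of_adjoin [LinearOrder I]
    (hx : ∀ α β, sb (p α) (p β) (x α) (x β) ∈ Submodule.span ℂ (Set.range x))
    (htop : Algebra.adjoin ℂ (Set.range x) = ⊤) (y : C) :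
    ∃ t ∈ Submodule.span ℂ (mon '' {w | IsPBW (fun α => Odd (p α)) w}),
      FreeAlgebra.lift ℂ x t = y := by
  have h1 : y ∈ Algebra.adjoin ℂ (Set.range x) := htop ▸ trivial
  rw [← Subalgebra.mem_toSubmodule, Algebra.adjoin_eq_span] at h1
  refine Submodule.span_le.2 (fun z hz => ?_ : _ ⊆ ((Submodule.span ℂ
    (mon '' {w | IsPBW (fun α => Odd (p α)) w})).map (FreeAlgebra.lift ℂ x).toLinearMap : Set C)) h1
  suffices ∃ w : List I, z = FreeAlgebra.lift ℂ x (mon w) by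
    obtain ⟨w, rfl⟩ := this
    exact prod_mem_span_isPBW hx w
  induction hz using Submonoid.closure_induction with
  | mem z hz =>
    obtain ⟨α, rfl⟩ := hz
    exact ⟨[α], by rw [lift_mon_cons, mon_nil, map_one, mul_one]⟩
  | one => exact ⟨[], by rw [mon_nil, map_one]⟩
  | mul y z _ _ hy hz =>
    obtain ⟨w, rfl⟩ := hy
    obtain ⟨w', rfl⟩ := hz
    exact ⟨w ++ w', by rw [← map_mul, mon, mon, mon, List.map_append, List.prod_append]⟩

end Spanning

/-! ### Superbrackets of the root vectors at `h = 0` -/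

section Super

variable {C : Type} [Ring C]

theorem sb_symm (k l : ℕ) (x y : C) : sb k l x y = -((-1 : ℤ) ^ (k * l)) • sb l k y x := by
  have h : ((-1 : ℤ) ^ (k * l)) * ((-1 : ℤ) ^ (k * l)) = 1 := by rw [← mul_pow]; simp
  rw [sb, sb, smul_sub, mul_comm l, smul_smul, neg_mul, h]
  simp only [neg_smul, one_smul]; abel

theorem sb_jacobi (k l p : ℕ) (x y z : C) :
    sb (k + l) p (sb k l x y) z
      = sb k (l + p) x (sb l p y z) - ((-1 : ℤ) ^ (k * l)) • sb l (k + p) y (sb k p x z) := by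
  have h : ((-1 : ℤ) ^ (k * l)) * ((-1 : ℤ) ^ (k * l)) = 1 := by rw [← mul_pow]; simp
  simp only [sb, mul_add, add_mul, pow_add, mul_comm l k]
  generalize ((-1 : ℤ) ^ (k * l)) = a at *
  generalize ((-1 : ℤ) ^ (k * p)) = b at *
  generalize ((-1 : ℤ) ^ (l * p)) = c at *
  linear_combination (norm := (simp only [mul_sub, sub_mul, mul_add, add_mul, smul_mul_assoc, mul_smul_comm, smul_sub,
      smul_add, smul_smul, mul_assoc, zero_mul, mul_zero, smul_zero]; module))
    b • c • (h • (z * x * y)) - c • (h • (x * z * y))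

theorem sb_zero_right (k l : ℕ) (x : C) : sb k l x 0 = 0 := by simp [sb]
theorem sb_add_right (k l : ℕ) (x y z : C) : sb k l x (y + z) = sb k l x y + sb k l x z := by
  simp only [sb, mul_add, add_mul, smul_add]; abel
theorem sb_smul_right [Algebra ℂ C] (k l : ℕ) (c : ℂ) (x y : C) : sb k l x (c • y) = c • sb k l x y := by
  simp only [sb, mul_smul_comm, smul_mul_assoc, smul_sub]; rw [smul_comm]
theorem sb_zsmul_left (k l : ℕ) (c : ℤ) (x y : C) : sb k l (c • x) y = c • sb k l x y := by
  simp only [sb, mul_smul_comm, smul_mul_assoc, smul_sub]; rw [smul_comm]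
theorem sb_zsmul_right (k l : ℕ) (c : ℤ) (x y : C) : sb k l x (c • y) = c • sb k l x y := by
  simp only [sb, mul_smul_comm, smul_mul_assoc, smul_sub]; rw [smul_comm]

theorem sb_congr {k l k' l' : ℕ} (h : Even (k + k')) (h' : Even (l + l')) (x y : C) :
    sb k l x y = sb k' l' x y := by
  rw [sb, sb]; congr 2
  refine neg_one_pow_congr ?_
  rw [Nat.even_mul, Nat.even_mul, Nat.even_add.1 h, Nat.even_add.1 h']

variable [Algebra ℂ C]

/-- The span of the members of degree `k` of a family. -/
def homSpan {I : Type} (x : I → C) (p : I → ℕ) (k : ℕ) : Submodule ℂ C :=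
  Submodule.span ℂ (x '' {α | Even (p α + k)})

/-- Brackets with `x` preserve the graded span of a family. -/
def Stabilizes {I : Type} (y : I → C) (p : I → ℕ) (k : ℕ) (x : C) : Prop :=
  ∀ l, ∀ z ∈ homSpan y p l, sb k l x z ∈ homSpan y p (k + l)

theorem homSpan_congr {I : Type} {y : I → C} {p : I → ℕ} {k l : ℕ} (h : Even (k + l)) :
    homSpan y p k = homSpan y p l := by
  rw [homSpan, homSpan]; congr 3; ext α
  rw [Nat.even_add, Nat.even_add, Nat.even_add.1 h]

theorem mem_homSpan {I : Type} {y : I → C} {p : I → ℕ} {k : ℕ} (α : I) (h : Even (p α + k)) :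
    y α ∈ homSpan y p k := Submodule.subset_span ⟨α, h, rfl⟩

variable {I : Type} {y : I → C} {p : I → ℕ}

theorem stabilizes_of {k : ℕ} {x : C} (h : ∀ α, sb k (p α) x (y α) ∈ homSpan y p (k + p α)) :
    Stabilizes y p k x := by
  intro l z hz
  induction hz using Submodule.span_induction with
  | mem z hz =>
    obtain ⟨α, hα, rfl⟩ := hz
    rw [sb_congr (Even.add_self k) (by rwa [add_comm] : Even (l + p α)),
      homSpan_congr (l := k + p α)]
    · exact h α
    · rw [show k + l + (k + p α) = (k + k) + (p α + l) by ring]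
      exact (Even.add_self k).add hα
  | zero => rw [sb_zero_right]; exact zero_mem _
  | add z w _ _ hz hw => rw [sb_add_right]; exact add_mem hz hw
  | smul c z _ hz => rw [sb_smul_right]; exact Submodule.smul_mem _ _ hz

/-- By the super Jacobi identity the adjoint action of a bracket is the superbracket of the adjoint
actions. -/
theorem Stabilizes.sb {k l : ℕ} {x x' : C} (h : Stabilizes y p k x) (h' : Stabilizes y p l x') :
    Stabilizes y p (k + l) (sb k l x x') := by
  intro i z hz
  rw [sb_jacobi]
  refine sub_mem ?_ (zsmul_mem ?_ _)
  · rw [add_assoc]; exact h _ _ (h' _ _ hz)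
  · rw [add_comm k l, add_assoc]; exact h' _ _ (h _ _ hz)

theorem Stabilizes.zsmul {k : ℕ} {x : C} (h : Stabilizes y p k x) (c : ℤ) :
    Stabilizes y p k (c • x) := by
  intro i z hz
  rw [sb_zsmul_left]; exact zsmul_mem (h _ _ hz) _

theorem Stabilizes.congr {k l : ℕ} {x : C} (h : Stabilizes y p k x) (hkl : Even (k + l)) :
    Stabilizes y p l x := by
  intro i z hz
  rw [sb_congr (by rwa [add_comm] : Even (l + k)) (Even.add_self i), homSpan_congr (l := k + i)]
  · exact h _ _ hz
  · rw [show l + i + (k + i) = (k + l) + (i + i) by ring]; exact hkl.add (Even.add_self i)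

end Super

section Classical

variable {C : Type} [Ring C] {n m : ℕ}

/-- The superbracket `⟦a_i^η, a_j^{-η}⟧`. -/
def cU (n : ℕ) (a : ℤˣ → ℕ → C) (η : ℤˣ) (i j : ℕ) : C := sb (theta n i) (theta n j) (a η i) (a (-η) j)

/-- The relations of the creation and annihilation generators at `h = 0`. -/
structure IsClassicalCag (n m : ℕ) (H : ℕ → C) (a : ℤˣ → ℕ → C) : Prop where
  Ha : ∀ ξ i j, 1 ≤ i ∧ i ≤ n + m → 1 ≤ j ∧ j ≤ n + m →
    H i * a ξ j - a ξ j * H i = (-((ξ : ℤ) * cagWt n i j)) • a ξ j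
  aa : ∀ i, 1 ≤ i ∧ i ≤ n + m → cU n a (-1) i i = H i
  triple : ∀ η i j k, 1 ≤ i ∧ i ≤ n + m → 1 ≤ j ∧ j ≤ n + m → 1 ≤ k ∧ k ≤ n + m →
    (i = j + 1 ∨ j = i + 1) → sb (theta n i + theta n j) (theta n k) (cU n a η i j) (a η k)
      = if k = j then ((η : ℤ) ^ theta n k) • a η i else 0
  a12 : ∀ ξ, 2 ≤ n + m → sb (theta n 1) (theta n 2) (a ξ 1) (a ξ 2) = 0
  a11 : ∀ ξ, 1 ≤ n + m → sb (theta n 1) (theta n 1) (a ξ 1) (a ξ 1) = 0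

theorem cU_symm (a : ℤˣ → ℕ → C) (η : ℤˣ) (i j : ℕ) :
    cU n a η i j = -((-1 : ℤ) ^ (theta n i * theta n j)) • cU n a (-η) j i := by
  rw [cU, cU, sb_symm, neg_neg]

theorem sb_sb_right (k l p : ℕ) (x y z : C) : sb k (l + p) x (sb l p y z)
    = sb (k + l) p (sb k l x y) z + ((-1 : ℤ) ^ (k * l)) • sb l (k + p) y (sb k p x z) := by
  rw [sb_jacobi]; abel

theorem sb_zero_left (k l : ℕ) (x : C) : sb k l 0 x = 0 := by simp [sb]

theorem sb_eq_zero_symm {k l : ℕ} {x y : C} (h : sb k l x y = 0) : sb l k y x = 0 := by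
  rw [sb_symm, h, smul_zero]

theorem even_of_units_pow (η : ℤˣ) (k : ℕ) : ((η : ℤ) ^ k) * ((η : ℤ) ^ k) = 1 := by
  rw [← mul_pow, ← Units.val_mul, Int.units_mul_self]; simp

namespace IsClassicalCag

variable {H : ℕ → C} {a : ℤˣ → ℕ → C} (h : IsClassicalCag n m H a)

include h

/-- The triple relation with k = j, read as a raising operator: the bracket of a_{i+1}^η with
a_i^{−η} carries a_i^η to a_{i+1}^η up to sign. It propagates facts about small indices upwards. -/
theorem raise {η : ℤˣ} {i : ℕ} (hi : 1 ≤ i) (hi' : i + 1 ≤ n + m) :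
    ((η : ℤ) ^ theta n i) • sb (theta n (i + 1) + theta n i) (theta n i) (cU n a η (i + 1) i) (a η i)
      = a η (i + 1) := by
  rw [h.triple η (i + 1) i i (by omega) (by omega) (by omega) (by omega), if_pos rfl, smul_smul,
    even_of_units_pow, one_smul]

/-- The raising operator kills a_j^η for j ≠ i, so by Jacobi it carries the vanishing bracket at
index i to the one at i + 1. -/
theorem raise_comm {η : ℤˣ} {i j : ℕ} (hi : 1 ≤ i) (hi' : i + 1 ≤ n + m) (hj : 1 ≤ j) (hj' : j ≤ n + m)
    (hij : i ≠ j) (h0 : sb (theta n i) (theta n j) (a η i) (a η j) = 0) :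
    sb (theta n (i + 1)) (theta n j) (a η (i + 1)) (a η j) = 0 := by
  rw [← h.raise (η := η) hi hi', sb_zsmul_left,
    sb_congr (k' := theta n (i + 1) + theta n i + theta n i) ⟨theta n (i + 1) + theta n i, by ring⟩
    (Even.add_self _), sb_jacobi, h0, sb_zero_right,
    h.triple η (i + 1) i j (by omega) (by omega) (by omega) (by omega), if_neg (Ne.symm hij),
    sb_zero_right]
  simp

/-- From the relations at (1, 1) and (1, 2), first the larger index is raised and then the smaller
one. Starting with i ≤ j keeps the raised index different from the other. -/
theorem comm (η : ℤˣ) {i j : ℕ} (hi : 1 ≤ i) (hij : i ≤ j) (hj : j ≤ n + m) :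
    sb (theta n i) (theta n j) (a η i) (a η j) = 0 := by
  induction i, hi using Nat.le_induction generalizing j with
  | base =>
    induction j, hij using Nat.le_induction with
    | base => exact h.a11 η (by omega)
    | succ j hj1 ih =>
      rcases Nat.eq_or_lt_of_le hj1 with rfl | hj1
      · exact h.a12 η (by omega)
      · exact sb_eq_zero_symm (h.raise_comm (by omega) (by omega) (by omega) (by omega) (by omega)
          (sb_eq_zero_symm (ih (by omega))))
  | succ i hi ih =>
    exact h.raise_comm hi (by omega) (by omega) hj (by omega) (ih (by omega) hj)

theorem comm' (η : ℤˣ) {i j : ℕ} (hi : 1 ≤ i ∧ i ≤ n + m) (hj : 1 ≤ j ∧ j ≤ n + m) :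
    sb (theta n i) (theta n j) (a η i) (a η j) = 0 := by
  rcases le_total i j with hij | hij
  · exact h.comm η hi.1 hij hj.2
  · exact sb_eq_zero_symm (h.comm η hj.1 hij hi.2)

variable [Algebra ℂ C]

/-- The bracket `⟦a_i^η, a_j^{-η}⟧` preserves the graded span of the `a_k^ξ`, for both signs `ξ`. -/
def StabAt (_h : IsClassicalCag n m H a) (η : ℤˣ) (i j : ℕ) : Prop :=
  ∀ ξ, Stabilizes (fun k : Idx n m => a ξ k) (fun k => theta n k) (theta n i + theta n j) (cU n a η i j)

omit h in
theorem stabAt_symm (h : IsClassicalCag n m H a) {η : ℤˣ} {i j : ℕ} (hs : h.StabAt (-η) j i) :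
    h.StabAt η i j := fun ξ => by
  rw [cU_symm, add_comm (theta n i)]; exact (hs ξ).zsmul _

theorem stabAt_self (η : ℤˣ) {i : ℕ} (hi : 1 ≤ i ∧ i ≤ n + m) : h.StabAt η i i := by
  have key : h.StabAt (-1) i i := by
    intro ξ
    refine Stabilizes.congr (k := 0) (stabilizes_of fun k => ?_) ⟨theta n i, by ring⟩
    rw [h.aa i hi, sb, zero_mul, pow_zero, one_smul, h.Ha ξ i k hi k.2]
    exact zsmul_mem (mem_homSpan k ⟨theta n k, by ring⟩) _
  rcases Int.units_eq_one_or η with rfl | rfl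
  · exact h.stabAt_symm key
  · exact key

/-- The triple relation covers the family of sign η. For the opposite sign, super-antisymmetry
rewrites the bracket with the roles of i and j exchanged. -/
theorem stabAt_next (η : ℤˣ) {i j : ℕ} (hi : 1 ≤ i ∧ i ≤ n + m) (hj : 1 ≤ j ∧ j ≤ n + m)
    (hij : i = j + 1 ∨ j = i + 1) : h.StabAt η i j := by
  have key : ∀ η i j, 1 ≤ i ∧ i ≤ n + m → 1 ≤ j ∧ j ≤ n + m → (i = j + 1 ∨ j = i + 1) →
      Stabilizes (fun k : Idx n m => a η k) (fun k => theta n k) (theta n i + theta n j)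
        (cU n a η i j) := by
    intro η i j hi hj hij
    refine stabilizes_of fun k => ?_
    rw [h.triple η i j k hi hj k.2 hij]
    split_ifs with hk
    · refine zsmul_mem (mem_homSpan (⟨i, hi⟩ : Idx n m) ⟨theta n i + theta n j, ?_⟩) _
      rw [hk]; ring
    · exact zero_mem _
  intro ξ
  rcases eq_or_ne ξ η with rfl | hξ
  · exact key _ _ _ hi hj hij
  · have : ξ = -η := by
      rcases Int.units_eq_one_or ξ with rfl | rfl <;> rcases Int.units_eq_one_or η with rfl | rfl <;>
        simp_all
    rw [this, cU_symm, add_comm (theta n i)]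
    exact (key _ _ _ hj hi hij.symm).zsmul _

/-- Induction on the distance d. Writing a_{i+d+1}^{−η} by the raising operator, Jacobi expresses
the bracket at distance d + 1, up to sign, as the bracket of one at distance 1 with one at distance
d. -/
theorem stabAt_add (d : ℕ) (η : ℤˣ) {i : ℕ} (hi : 1 ≤ i) (hid : i + d ≤ n + m) :
    h.StabAt η i (i + d) := by
  induction d with
  | zero => exact h.stabAt_self η (by omega)
  | succ d ih =>
    rcases Nat.eq_zero_or_pos d with rfl | hd
    · exact h.stabAt_next η (by omega) (by omega) (by omega)
    · intro ξ
      have h1 := h.stabAt_next (-η) (i := i + d + 1) (j := i + d) (by omega) (by omega) (by omega)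
      have h2 := ih (by omega)
      -- The other Jacobi term vanishes: this bracket acts nontrivially on a_k^η only for k = i + d
      -- + 1.
      have h3 : sb (theta n i) (theta n (i + d + 1) + theta n (i + d)) (a η i)
          (cU n a (-η) (i + d + 1) (i + d)) = 0 := by
        rw [cU_symm, sb_zsmul_right, neg_neg, add_comm (theta n (i + d + 1)), sb_symm,
          h.triple η (i + d) (i + d + 1) i (by omega) (by omega) (by omega) (by omega),
          if_neg (by omega)]
        simp
      have h4 : cU n a η i (i + (d + 1)) = ((((-η : ℤˣ) : ℤ) ^ theta n (i + d))
          * ((-1 : ℤ) ^ (theta n i * (theta n (i + d + 1) + theta n (i + d))))) •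
          sb (theta n (i + d + 1) + theta n (i + d)) (theta n i + theta n (i + d))
            (cU n a (-η) (i + d + 1) (i + d)) (cU n a η i (i + d)) := by
        rw [cU, ← add_assoc, ← h.raise (η := -η) (i := i + d) (by omega) (by omega), sb_zsmul_right,
          sb_congr (l' := theta n (i + d + 1) + theta n (i + d) + theta n (i + d)) (Even.add_self _)
          ⟨theta n (i + d + 1) + theta n (i + d), by ring⟩, sb_sb_right, h3, sb_zero_left, zero_add,
          smul_smul]
        rfl
      rw [h4]
      refine ((h1 ξ).sb (h2 ξ)).zsmul _ |>.congr ⟨theta n (i + d + 1) + theta n (i + d) + theta n i, ?_⟩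
      rw [← add_assoc i d 1]; ring

theorem stabAt (η : ℤˣ) {i j : ℕ} (hi : 1 ≤ i ∧ i ≤ n + m) (hj : 1 ≤ j ∧ j ≤ n + m) :
    h.StabAt η i j := by
  rcases le_total i j with hij | hij
  · obtain ⟨d, rfl⟩ := Nat.exists_eq_add_of_le hij
    exact h.stabAt_add d η hi.1 hj.2
  · obtain ⟨d, rfl⟩ := Nat.exists_eq_add_of_le hij
    exact h.stabAt_symm (h.stabAt_add d (-η) hj.1 hi.2)

end IsClassicalCag

/-- The indices of the root vectors and of the Cartan elements. -/
abbrev RootIdx (n m : ℕ) : Type :=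
  {p : Fin (n + m + 1) ×ₗ Fin (n + m + 1) //
    ¬(((ofLex p).1 : ℕ) = 0 ∧ ((ofLex p).2 : ℕ) = 0)}

namespace RootIdx

/-- The first index. -/
def fst (α : RootIdx n m) : ℕ := (ofLex α.1).1
/-- The second index. -/
def snd (α : RootIdx n m) : ℕ := (ofLex α.1).2

/-- The degree. -/
def deg (α : RootIdx n m) : ℕ := theta n α.fst + theta n α.snd

/-- The index `(i, j)`. -/
def mk (i j : ℕ) (hi : i ≤ n + m) (hj : j ≤ n + m) (hij : ¬(i = 0 ∧ j = 0)) : RootIdx n m :=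
  ⟨toLex (⟨i, by omega⟩, ⟨j, by omega⟩), hij⟩

theorem fst_le (α : RootIdx n m) : α.fst ≤ n + m := Nat.le_of_lt_succ (ofLex α.1).1.2
theorem snd_le (α : RootIdx n m) : α.snd ≤ n + m := Nat.le_of_lt_succ (ofLex α.1).2.2
theorem ne (α : RootIdx n m) : ¬(α.fst = 0 ∧ α.snd = 0) := α.2

end RootIdx

/-- The root vectors. -/
def rootVec (a : ℤˣ → ℕ → C) (α : RootIdx n m) : C := cX n (a 1) (a (-1)) α.fst α.snd

theorem theta_zero (n : ℕ) : theta n 0 = 0 := by simp [theta]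

theorem exists_rootVec_eq (a : ℤˣ → ℕ → C) (ξ : ℤˣ) {k : ℕ} (hk : 1 ≤ k ∧ k ≤ n + m) :
    ∃ α : RootIdx n m, rootVec a α = a ξ k ∧ α.deg = theta n k := by
  rcases Int.units_eq_one_or ξ with rfl | rfl
  · refine ⟨RootIdx.mk k 0 hk.2 (by omega) (by omega), ?_, ?_⟩
    · rw [rootVec]; change cX n (a 1) (a (-1)) k 0 = _
      rw [cX, if_neg (by omega), if_pos rfl]
    · change theta n k + theta n 0 = _
      rw [theta_zero, add_zero]
  · refine ⟨RootIdx.mk 0 k (by omega) hk.2 (by omega), ?_, ?_⟩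
    · rw [rootVec]; change cX n (a 1) (a (-1)) 0 k = _
      rw [cX, if_pos rfl]
    · change theta n 0 + theta n k = _
      rw [theta_zero, zero_add]

theorem exists_rootVec_eq_cU (a : ℤˣ → ℕ → C) {i j : ℕ} (hi : 1 ≤ i ∧ i ≤ n + m)
    (hj : 1 ≤ j ∧ j ≤ n + m) :
    ∃ α : RootIdx n m, rootVec a α = cU n a 1 i j ∧ α.deg = theta n i + theta n j := by
  refine ⟨RootIdx.mk i j hi.2 hj.2 (by omega), ?_, rfl⟩
  rw [rootVec]; change cX n (a 1) (a (-1)) i j = _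
  rw [cX, if_neg (by omega), if_neg (by omega)]; rfl

/-- Case distinction for the root vectors. -/
theorem rootVec_cases (a : ℤˣ → ℕ → C) (α : RootIdx n m) :
    (∃ ξ k, (1 ≤ k ∧ k ≤ n + m) ∧ rootVec a α = a ξ k ∧ α.deg = theta n k) ∨
    ∃ i j, (1 ≤ i ∧ i ≤ n + m) ∧ (1 ≤ j ∧ j ≤ n + m) ∧ rootVec a α = cU n a 1 i j ∧
      α.deg = theta n i + theta n j := by
  have h1 := α.fst_le
  have h2 := α.snd_le
  have h3 := α.ne
  by_cases hi : α.fst = 0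
  · refine Or.inl ⟨-1, α.snd, by omega, ?_, ?_⟩
    · rw [rootVec, cX, if_pos hi]
    · rw [RootIdx.deg, hi, theta_zero, zero_add]
  · by_cases hj : α.snd = 0
    · refine Or.inl ⟨1, α.fst, by omega, ?_, ?_⟩
      · rw [rootVec, cX, if_neg hi, if_pos hj]
      · rw [RootIdx.deg, hj, theta_zero, add_zero]
    · refine Or.inr ⟨α.fst, α.snd, by omega, by omega, ?_, rfl⟩
      rw [rootVec, cX, if_neg hi, if_neg hj]; rfl

namespace IsClassicalCag

variable {H : ℕ → C} {a : ℤˣ → ℕ → C} (h : IsClassicalCag n m H a) [Algebra ℂ C]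

omit h in
theorem homSpan_le (ξ : ℤˣ) (k : ℕ) : homSpan (fun k : Idx n m => a ξ k) (fun k => theta n k) k
    ≤ homSpan (rootVec (n := n) (m := m) a) RootIdx.deg k := by
  rw [homSpan, Submodule.span_le]
  rintro _ ⟨l, hl, rfl⟩
  obtain ⟨α, h1, h2⟩ := exists_rootVec_eq a ξ l.2
  change a ξ l ∈ _
  rw [← h1]
  exact mem_homSpan α (by rw [h2]; exact hl)

include h

/-- Brackets of two a's of equal sign vanish and those of opposite sign are root vectors by
definition. A bracket with some ⟦a_i, a_j⟧ stays in the span of the a's by `stabAt`. -/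
theorem stabilizes_a (ξ : ℤˣ) {k : ℕ} (hk : 1 ≤ k ∧ k ≤ n + m) :
    Stabilizes (rootVec (n := n) (m := m) a) RootIdx.deg (theta n k) (a ξ k) := by
  refine stabilizes_of fun α => ?_
  rcases rootVec_cases a α with ⟨η, l, hl, h1, h2⟩ | ⟨i, j, hi, hj, h1, h2⟩
  · rw [h1, h2]
    rcases eq_or_ne η ξ with rfl | hξ
    · rw [h.comm' η hk hl]; exact zero_mem _
    · have : η = -ξ := by
        rcases Int.units_eq_one_or ξ with rfl | rfl <;> rcases Int.units_eq_one_or η with rfl | rfl <;>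
          simp_all
      rw [this]
      change cU n a ξ k l ∈ _
      rcases Int.units_eq_one_or ξ with rfl | rfl
      · obtain ⟨β, h3, h4⟩ := exists_rootVec_eq_cU a hk hl
        rw [← h3]; exact mem_homSpan β (by rw [h4]; exact Even.add_self _)
      · obtain ⟨β, h3, h4⟩ := exists_rootVec_eq_cU a hl hk
        rw [cU_symm, neg_neg, ← h3]
        exact zsmul_mem (mem_homSpan β (by rw [h4, add_comm (theta n l)]; exact Even.add_self _)) _
  · rw [h1, h2, sb_symm, add_comm]
    refine zsmul_mem (homSpan_le ξ _ (h.stabAt 1 hi hj ξ _ _ ?_)) _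
    exact mem_homSpan (⟨k, hk⟩ : Idx n m) (Even.add_self _)

/-- Every root vector is an a_k^ξ or a superbracket of two of them, and elements stabilizing the
span are closed under superbrackets. -/
theorem sb_rootVec_mem (α β : RootIdx n m) : sb α.deg β.deg (rootVec a α) (rootVec a β)
    ∈ Submodule.span ℂ (Set.range (rootVec (n := n) (m := m) a)) := by
  have key : Stabilizes (rootVec (n := n) (m := m) a) RootIdx.deg α.deg (rootVec a α) := by
    rcases rootVec_cases a α with ⟨η, l, hl, h1, h2⟩ | ⟨i, j, hi, hj, h1, h2⟩
    · rw [h1, h2]; exact h.stabilizes_a η hl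
    · rw [h1, h2]; exact (h.stabilizes_a 1 hi).sb (h.stabilizes_a (-1) hj)
  refine Submodule.span_mono (Set.image_subset_range _ _) (key β.deg _ (mem_homSpan β (Even.add_self _)))

theorem exists_isPBW (htop : Algebra.adjoin ℂ (H '' {i | 1 ≤ i ∧ i ≤ n + m} ∪
      {x | ∃ ξ i, (1 ≤ i ∧ i ≤ n + m) ∧ x = a ξ i}) = ⊤) (y : C) :
    ∃ t ∈ Submodule.span ℂ (mon '' {w | IsPBW (fun α : RootIdx n m => Odd α.deg) w}),
      FreeAlgebra.lift ℂ (rootVec a) t = y := by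
  refine exists_isPBW_of_adjoin h.sb_rootVec_mem (top_le_iff.1 ?_) y
  rw [← htop, Algebra.adjoin_le_iff]
  rintro _ (⟨i, hi, rfl⟩ | ⟨ξ, i, hi, rfl⟩)
  · obtain ⟨α, h1, h2⟩ := exists_rootVec_eq_cU a hi hi
    rw [← h.aa i hi, cU_symm, neg_neg, ← h1]
    exact zsmul_mem (Algebra.subset_adjoin (Set.mem_range_self α)) _
  · obtain ⟨α, h1, h2⟩ := exists_rootVec_eq a ξ hi
    rw [← h1]
    exact Algebra.subset_adjoin (Set.mem_range_self α)

end IsClassicalCag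

end Classical

end UqSl
end

noncomputable section

namespace UqSl

/-! ### Specialisation to `h = 0` -/

section Limit

variable {B A : Type} [Ring B] [Algebra ℂ⟦X⟧ B] [Ring A] [Algebra ℂ A]

/-- A homomorphism to a `ℂ`-algebra under which `h` becomes `0`. -/
def IsLimit (κ : B →+* A) : Prop :=
  ∀ (c : ℂ⟦X⟧) (b : B), κ (c • b) = PowerSeries.constantCoeff c • κ b

theorem constantCoeff_qpow (a : ℤ) : PowerSeries.constantCoeff (qpow a) = 1 := by
  rw [← PowerSeries.coeff_zero_eq_constantCoeff_apply, qpow, PowerSeries.coeff_mk]; simp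

variable {κ : B →+* A} (hκ : IsLimit κ)

include hκ

theorem IsLimit.qpow (a : ℤ) (b : B) : κ (qpow a • b) = κ b := by
  rw [hκ, constantCoeff_qpow, one_smul]

theorem IsLimit.X (b : B) : κ ((PowerSeries.X : ℂ⟦X⟧) • b) = 0 := by
  rw [hκ, PowerSeries.constantCoeff_X, zero_smul]

theorem IsLimit.qE [HComplete B] (x : B) : κ (qE x) = 1 := by
  rw [UqSl.qE, ext_eq, map_add, hκ.X, coeff_qs]
  simp

/-- At h = 0 the series (q^x − q^{−x})/h becomes 2x and (q − q⁻¹)/h becomes 2. -/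
theorem IsLimit.qN [HComplete B] (x : B) : κ (qN x) = κ x := by
  have h1 : PowerSeries.constantCoeff (divh (UqSl.qpow 1 - UqSl.qpow (-1)))⁻¹ = (2 : ℂ)⁻¹ := by
    rw [PowerSeries.constantCoeff_inv, ← PowerSeries.coeff_zero_eq_constantCoeff_apply, divh,
      PowerSeries.coeff_mk, map_sub, UqSl.qpow, UqSl.qpow, PowerSeries.coeff_mk, PowerSeries.coeff_mk]
    norm_num
  have h2 : PowerSeries.coeff 0 (divh (qs x - qs (-x))) = (2 : ℂ⟦X⟧) • x := by
    rw [divh, PowerSeries.coeff_mk, map_sub, coeff_qs, coeff_qs, two_smul]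
    simp
  rw [UqSl.qN, hκ, h1, ext_eq, map_add, hκ.X, h2, RingHom.id_apply, add_zero, hκ, map_ofNat, smul_smul,
    inv_mul_cancel₀ two_ne_zero, one_smul]

theorem IsLimit.rN {n : ℕ} {e : ℕ → B} {i : ℕ} : κ (rN n e i) = cN (fun i => κ (e i)) i := by
  rcases i with _ | i
  · simp [UqSl.rN, rootN, cN]
  induction i with
  | zero => rfl
  | succ i ih => rw [rN_succ (by omega), map_sub, hκ.qpow, map_mul, map_mul, ih]; rfl

theorem IsLimit.rP {n : ℕ} {f : ℕ → B} {i : ℕ} : κ (rP n f i) = cP (fun i => κ (f i)) i := by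
  rcases i with _ | i
  · simp [UqSl.rP, rootN, cP]
  induction i with
  | zero => rfl
  | succ i ih => rw [rP_succ (by omega), map_sub, hκ.qpow, map_mul, map_mul, ih]; rfl

theorem IsLimit.mapMatrix {N : ℕ} : IsLimit (κ.mapMatrix (m := Fin N)) := by
  intro c b
  ext u v
  simp only [RingHom.mapMatrix_apply, Matrix.map_apply, Matrix.smul_apply, hκ c]

theorem IsLimit.map_neg_one_pow_smul (k : ℕ) (b : B) :
    κ (((-1 : ℂ⟦X⟧) ^ k) • b) = ((-1 : ℤ) ^ k) • κ b := by
  rw [hκ, map_pow, map_neg, map_one, ← Int.cast_smul_eq_zsmul ℂ]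
  push_cast; rfl

theorem IsLimit.isClassicalCag [HComplete B] {n m : ℕ} {H : ℕ → B} {a : ℤˣ → ℕ → B}
    (h : IsCag n m H a) : IsClassicalCag n m (fun i => κ (H i)) (fun ξ i => κ (a ξ i)) := by
  have hs : ∀ ξ η i j, κ (scomm n a ξ η i j) = sb (theta n i) (theta n j) (κ (a ξ i)) (κ (a η j)) := by
    intro ξ η i j
    rw [scomm, map_sub, hκ.map_neg_one_pow_smul, map_mul, map_mul]; rfl
  refine ⟨fun ξ i j hi hj => ?_, fun i hi => ?_, fun η i j k hi hj hk hij => ?_, fun ξ hr => ?_,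
    fun ξ hr => ?_⟩
  · have h1 : H i * a ξ j = a ξ j * (H i + ((-((ξ : ℤ) * cagWt n i j) : ℤ) : B)) := h.Ha ξ i j hi hj
    rw [← map_mul, h1, mul_add, map_add, map_mul, add_sub_cancel_left, ← Int.cast_comm,
      ← zsmul_eq_mul, map_zsmul]
  · rw [cU, neg_neg, ← hs, h.aa i hi, hκ.qN]
  · obtain ⟨ξ, hξ⟩ : ∃ ξ : ℤˣ, (j : ℤ) = i + (ξ : ℤ) := by
      rcases hij with rfl | rfl
      · exact ⟨-1, by push_cast; ring⟩
      · exact ⟨1, by push_cast; ring⟩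
    have h1 := congrArg κ (h.triple ξ η i j k hi hj hk hξ)
    rw [map_sub, mul_comm ((-1 : ℂ⟦X⟧) ^ _), mul_smul, hκ.qpow, hκ.map_neg_one_pow_smul, map_mul,
      map_mul, hs] at h1
    refine Eq.trans h1 ?_
    split_ifs
    · rw [map_zsmul, map_mul, hκ.qE, one_mul]
    · exact map_zero κ
  · have h1 := congrArg κ (h.a12 ξ hr)
    rw [map_sub, mul_comm ((-1 : ℂ⟦X⟧) ^ _), mul_smul, hκ.qpow, hκ.map_neg_one_pow_smul, map_mul,
      map_mul, map_zero] at h1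
    exact h1
  · rw [← hs, h.a11 ξ hr, map_zero]

end Limit

/-! ### Reduction modulo h, and completeness of scalars and matrix algebras. -/

section Residue

variable {B : Type} [Ring B] [Algebra ℂ⟦X⟧ B]

/-- The algebra A is B/hB, with ℂ acting through constant power series. -/
theorem exists_residue (B : Type) [Ring B] [Algebra ℂ⟦X⟧ B] :
    ∃ (A : Type) (_ : Ring A) (_ : Algebra ℂ A) (κ : B →+* A), Function.Surjective κ ∧ IsLimit κ ∧
      ∀ x, κ x = 0 → ∃ y, x = (PowerSeries.X : ℂ⟦X⟧) • y := by
  let J : TwoSidedIdeal B := TwoSidedIdeal.mk' {x | ∃ y, x = (PowerSeries.X : ℂ⟦X⟧) • y}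
    ⟨0, by simp⟩ (by rintro _ _ ⟨y, rfl⟩ ⟨z, rfl⟩; exact ⟨y + z, by rw [smul_add]⟩)
    (by rintro _ ⟨y, rfl⟩; exact ⟨-y, by rw [smul_neg]⟩)
    (by rintro x _ ⟨y, rfl⟩; exact ⟨x * y, by rw [mul_smul_comm]⟩)
    (by rintro _ x ⟨y, rfl⟩; exact ⟨y * x, by rw [smul_mul_assoc]⟩)
  let κ : B →+* J.ringCon.Quotient := J.ringCon.mk'
  have hsurj : Function.Surjective κ := RingCon.mk'_surjective _
  have hker : ∀ x, κ x = 0 ↔ ∃ y, x = (PowerSeries.X : ℂ⟦X⟧) • y := by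
    intro x
    rw [← map_zero κ]
    refine (J.ringCon.eq.trans (TwoSidedIdeal.rel_iff _ _ _)).trans ?_
    rw [sub_zero]
    exact TwoSidedIdeal.mem_mk' _ _ _ _ _ _ _
  let _ : Algebra ℂ J.ringCon.Quotient :=
    RingHom.toAlgebra' ((κ.comp (algebraMap ℂ⟦X⟧ B)).comp PowerSeries.C) fun c x => by
      obtain ⟨b, rfl⟩ := hsurj x
      simp only [RingHom.comp_apply]
      rw [← map_mul, ← map_mul, Algebra.commutes]
  refine ⟨J.ringCon.Quotient, inferInstance, inferInstance, κ, hsurj, fun c b => ?_,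
    fun x => (hker x).1⟩
  have h1 : κ ((PowerSeries.X : ℂ⟦X⟧) • (divh c • b)) = 0 := (hker _).2 ⟨_, rfl⟩
  conv_lhs => rw [eq_C_add_X_mul c]
  rw [add_smul, mul_smul, map_add, h1, add_zero, Algebra.smul_def, map_mul, Algebra.smul_def,
    PowerSeries.coeff_zero_eq_constantCoeff_apply]
  rfl

instance : HComplete ℂ⟦X⟧ where
  eq_zero x hx := by
    refine PowerSeries.ext fun k => ?_
    obtain ⟨y, hy⟩ := hx (k + 1)
    rw [hy, smul_eq_mul, PowerSeries.coeff_X_pow_mul', if_neg (by omega), map_zero]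
  exists_sum f := by
    let S : ℕ → ℂ⟦X⟧ := fun n =>
      PowerSeries.mk fun k => ∑ i ∈ Finset.range (k + 1), PowerSeries.coeff (k - i) (f (n + i))
    have hS : ∀ n, S n = f n + (PowerSeries.X : ℂ⟦X⟧) • S (n + 1) := by
      intro n
      refine PowerSeries.ext fun k => ?_
      rw [map_add, smul_eq_mul]
      cases k with
      | zero => simp [S]
      | succ k =>
        rw [PowerSeries.coeff_succ_X_mul]
        simp only [S, PowerSeries.coeff_mk]
        rw [Finset.sum_range_succ', add_comm]
        simp [Nat.add_assoc, Nat.add_comm 1]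
    refine ⟨S 0, fun k => ⟨S k, ?_⟩⟩
    induction k with
    | zero => rw [pow_zero, one_smul, Finset.range_zero, Finset.sum_empty, zero_add]
    | succ k ih =>
      rw [ih, hS k, Finset.sum_range_succ, smul_add, smul_smul, ← pow_succ, add_assoc]

instance {N : ℕ} [HComplete B] : HComplete (Matrix (Fin N) (Fin N) B) where
  eq_zero x hx := by
    ext u v
    refine HComplete.eq_zero _ fun k => ?_
    obtain ⟨y, hy⟩ := hx k
    exact ⟨y u v, by rw [hy, Matrix.smul_apply]⟩
  exists_sum f := by
    refine ⟨Matrix.of fun u v => hsum fun k => f k u v, fun k => ?_⟩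
    choose y hy using fun u v => hsum_spec (fun k => f k u v) k
    refine ⟨Matrix.of y, ?_⟩
    ext u v
    rw [Matrix.of_apply, hy, Matrix.add_apply, Matrix.smul_apply, Matrix.of_apply, Matrix.sum_apply]
    rfl

end Residue

end UqSl
end

noncomputable section

namespace UqSl

/-! ### Injectivity of the homomorphism from the creation and annihilation presentation -/

section Injective

variable {n m : ℕ}

/-- The homomorphism `UqCag n m → Uq n m`. -/
def cagToUq (n m : ℕ) : UqCag n m →ₐ[ℂ⟦X⟧] Uq n m := (exists_cagToUq n m).choose

theorem cagToUq_cH {i : ℕ} (hi : 1 ≤ i ∧ i ≤ n + m) :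
    cagToUq n m (cH n m i) = hH n (uh n m) i := ((exists_cagToUq n m).choose_spec i hi).1

theorem cagToUq_ca (ξ : ℤˣ) {i : ℕ} (hi : 1 ≤ i ∧ i ≤ n + m) :
    cagToUq n m (ca n m ξ i) = ra n (ue n m) (uf n m) ξ i :=
  ((exists_cagToUq n m).choose_spec i hi).2 ξ

/-- The sign by which a root vector acts on a basis vector. -/
def rootSign (n m : ℕ) (u : Fin (n + m + 3)) (α : RootIdx n m) : ℂ :=
  (-1) ^ (vp n (n + m) u * α.deg)

/-- The root vectors in the vector representation. -/
def rootMat (n m : ℕ) (α : RootIdx n m) : Matrix (Fin (n + m + 3)) (Fin (n + m + 3)) ℂ :=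
  vX ℂ n (n + m) α.fst α.snd

theorem vX_apply (R : Type) [Ring R] (n r i j : ℕ) (u v : Fin (r + 3)) :
    vX R n r i j u v = (if (u : ℕ) = i ∧ (v : ℕ) = j then 1 else 0)
      - if i = j then ((-1 : R) ^ theta n i) * (if (u : ℕ) = 0 ∧ (v : ℕ) = 0 then 1 else 0) else 0 := by
  rw [vX, Matrix.sub_apply, vU, Matrix.of_apply]
  by_cases h : i = j
  · rw [if_pos h, if_pos h, Matrix.smul_apply, vU, Matrix.of_apply, zsmul_eq_mul]
    push_cast; rfl
  · rw [if_neg h, if_neg h, Matrix.zero_apply]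

theorem RootIdx.ext' {α β : RootIdx n m} (h1 : α.fst = β.fst) (h2 : α.snd = β.snd) : α = β := by
  refine Subtype.ext ?_
  exact ofLex.injective (Prod.ext (Fin.ext h1) (Fin.ext h2))

/-- The letter x_{ij} is detected by the matrix position (i, j). The additional multiple of E_{00}
in x_{ii} is never seen, because (0, 0) is not an index. For i = j the comparison vector is the
trivial representation of the parity of the i-th basis vector. -/
theorem isDetecting (n m : ℕ) : IsDetecting (rootSign n m) (rootMat n m) (fun α => Odd α.deg)
    (fun α => ⟨α.fst, by have := α.fst_le; omega⟩) (fun α => ⟨α.snd, by have := α.snd_le; omega⟩)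
    (fun α => ⟨n + m + 1 + theta n α.fst, by rw [theta]; split_ifs <;> omega⟩) where
  χ_ne u α := pow_ne_zero _ (by norm_num)
  π_self α := by
    rw [rootMat, vX_apply, if_pos ⟨rfl, rfl⟩, if_neg α.ne]
    simp
  π_ne α β h := by
    rw [rootMat, vX_apply, if_neg (fun h1 => h (RootIdx.ext' h1.1.symm h1.2.symm)), if_neg β.ne]
    simp
  π_c α β h := by
    have := α.fst_le
    rw [rootMat, vX_apply, if_neg (fun h1 => by have := h1.1; simp only at this; omega)]
    have h0 : ∀ k, n + m + 1 + k ≠ 0 := fun k => by omega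
    simp [h0]
  χ_c α β h := by
    have := β.fst_le
    rw [rootSign, rootSign, vp, vp, if_pos this, if_neg (by simp only; omega)]
    simp
  even β h := by
    have h1 : β.fst ≤ n + m := β.fst_le
    have h2 : β.snd ≤ n + m := β.snd_le
    have h3 : theta n β.fst = theta n β.snd := by
      by_contra h3
      refine h ?_
      rw [RootIdx.deg]
      simp only [theta] at h3 ⊢
      split_ifs at h3 ⊢ <;> first | omega | decide
    refine ⟨fun α => ?_, ?_⟩
    · rw [rootSign, rootSign, vp, vp, if_pos h1, if_pos h2, h3]
    · rw [rootSign]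
      exact ((Nat.not_odd_iff_even.1 h).mul_left _).neg_one_pow

section Coaction

variable {A : Type} [Ring A] [Algebra ℂ A]

/-- Both sides are homomorphisms in t which agree on letters: the coaction is the universal form of
the tensor product at h = 0. -/
theorem lift_coaction {a : ℤˣ → ℕ → A}
    {a' : ℤˣ → ℕ → Matrix (Fin (n + m + 3)) (Fin (n + m + 3)) A}
    (h : ∀ α : RootIdx n m, rootVec a' α = Matrix.scalar _ (rootVec a α) * vS A n (n + m) α.deg
      + vX A n (n + m) α.fst α.snd) (t : FreeAlgebra ℂ (RootIdx n m)) (u v : Fin (n + m + 3)) :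
    FreeAlgebra.lift ℂ (rootVec (n := n) (m := m) a') t u v
      = FreeAlgebra.lift ℂ (rootVec a) (coaction (rootSign n m) (rootMat n m) t u v) := by
  have key : FreeAlgebra.lift ℂ (rootVec (n := n) (m := m) a')
      = (FreeAlgebra.lift ℂ (rootVec a)).mapMatrix.comp (coaction (rootSign n m) (rootMat n m)) := by
    refine FreeAlgebra.hom_ext (funext fun α => ?_)
    simp only [Function.comp_apply, FreeAlgebra.lift_ι_apply, AlgHom.comp_apply]
    rw [h, coaction, FreeAlgebra.lift_ι_apply]
    ext u v
    rw [AlgHom.mapMatrix_apply, Matrix.map_apply, Matrix.add_apply, Matrix.add_apply, map_add,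
      Matrix.map_apply, AlgHom.commutes, vS, vD, Matrix.scalar_apply, Matrix.diagonal_mul_diagonal,
      Matrix.diagonal_apply, Matrix.diagonal_apply, rootMat, vX_apply, vX_apply]
    congr 1
    · split_ifs with huv
      · rw [map_smul, FreeAlgebra.lift_ι_apply, rootSign, ← Int.cast_comm, ← zsmul_eq_mul,
          ← Int.cast_smul_eq_zsmul ℂ]
        push_cast; rfl
      · simp
    · rw [map_sub]
      split_ifs <;> simp
  rw [key]; rfl

end Coaction

/-- `h` acts injectively. -/
def TorsionFree (M : Type) [AddCommGroup M] [Module ℂ⟦X⟧ M] : Prop :=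
  ∀ x : M, (PowerSeries.X : ℂ⟦X⟧) • x = 0 → x = 0

variable {B A : Type} [Ring B] [Algebra ℂ⟦X⟧ B] [HComplete B] [Ring A] [Algebra ℂ A]

/-- The images at `h = 0` of the generators `a_i^ξ`. -/
def limitFamily (κ : B →+* A) (F : Uq n m →ₐ[ℂ⟦X⟧] B) (ξ : ℤˣ) (i : ℕ) : A :=
  κ (F (cagToUq n m (ca n m ξ i)))

omit [HComplete B] in
theorem limitFamily_neg_one {κ : B →+* A} (hκ : IsLimit κ) (F : Uq n m →ₐ[ℂ⟦X⟧] B) {i : ℕ}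
    (hi : 1 ≤ i ∧ i ≤ n + m) :
    limitFamily κ F (-1) i = cN (fun i => κ (F (ue n m i))) i := by
  have h : IsLimit (κ.comp (F : Uq n m →+* B)) := fun c b => by
    simp only [RingHom.comp_apply, RingHom.coe_coe, map_smul, hκ c]
  rw [limitFamily, cagToUq_ca _ hi, ra_neg_one]
  exact h.rN

omit [HComplete B] in
theorem limitFamily_one {κ : B →+* A} (hκ : IsLimit κ) (F : Uq n m →ₐ[ℂ⟦X⟧] B) {i : ℕ}
    (hi : 1 ≤ i ∧ i ≤ n + m) :
    limitFamily κ F 1 i = cP (fun i => κ (F (uf n m i))) i := by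
  have h : IsLimit (κ.comp (F : Uq n m →+* B)) := fun c b => by
    simp only [RingHom.comp_apply, RingHom.coe_coe, map_smul, hκ c]
  rw [limitFamily, cagToUq_ca _ hi, ra_one]
  exact h.rP

omit [Algebra ℂ⟦X⟧ B] [HComplete B] [Algebra ℂ A] in
theorem mapMatrix_ve_vf (κ : B →+* A) (r i : ℕ) :
    κ.mapMatrix (ve B r i) = ve A r i ∧ κ.mapMatrix (vf B r i) = vf A r i := by
  rw [ve, ve, vf, vf]
  split_ifs
  · exact ⟨mapMatrix_vU _ _ _, mapMatrix_vU _ _ _⟩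
  · simp

/-- Tensoring F with the vector representation gives a homomorphism into matrices over B. At h = 0
its q-powers become 1, and the root vectors acquire the primitive form required by `lift_coaction`.
-/
theorem exists_coproduct {κ : B →+* A} (hκ : IsLimit κ) (F : Uq n m →ₐ[ℂ⟦X⟧] B) :
    ∃ F' : Uq n m →ₐ[ℂ⟦X⟧] Matrix (Fin (n + m + 3)) (Fin (n + m + 3)) B, ∀ α : RootIdx n m,
      rootVec (limitFamily κ.mapMatrix F') α
        = Matrix.scalar _ (rootVec (limitFamily κ F) α) * vS A n (n + m) α.deg
          + vX A n (n + m) α.fst α.snd := by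
  obtain ⟨Q, Q', hQ, hQ', H⟩ := ((isChev_cls n m).map F).exists_coproduct
  obtain ⟨F', hF'⟩ := H.exists_lift
  have hκ' : IsLimit (κ.mapMatrix (m := Fin (n + m + 3))) := hκ.mapMatrix
  have he : ∀ i, κ.mapMatrix (F' (ue n m i)) = Matrix.scalar _ (κ (F (ue n m i)))
      * vS A n (n + m) (chevDeg n i) + ve A (n + m) i := fun i => by
    rw [(hF' i).2.1, map_add, map_mul, map_mul, hQ, hκ'.qE, mul_one, mapMatrix_scalar, vS, vS,
      mapMatrix_vD, (mapMatrix_ve_vf κ _ i).1]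
  have hf : ∀ i, κ.mapMatrix (F' (uf n m i)) = Matrix.scalar _ (κ (F (uf n m i)))
      * vS A n (n + m) (chevDeg n i) + vf A (n + m) i := fun i => by
    rw [(hF' i).2.2, map_add, map_mul, map_mul, hQ', hκ'.qE, one_mul, mapMatrix_scalar, vS, vS,
      mapMatrix_vD, (mapMatrix_ve_vf κ _ i).2]
  refine ⟨F', fun α => cX_coproduct n (n + m) (fun i h1 h2 => ?_) (fun i h1 h2 => ?_) _ _ α.fst_le
    α.snd_le α.ne⟩
  · rw [limitFamily_one hκ' F' ⟨h1, h2⟩, limitFamily_one hκ F ⟨h1, h2⟩]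
    simp only [hf]
    exact cP_coproduct n (n + m) _ i h1 h2
  · rw [limitFamily_neg_one hκ' F' ⟨h1, h2⟩, limitFamily_neg_one hκ F ⟨h1, h2⟩]
    simp only [he]
    exact cN_coproduct n (n + m) _ i h1 h2

/-- The relations which hold between the root vectors in all specialisations at `h = 0` of
representations of `Uq n m` on torsion-free modules. -/
def limitRelations (n m : ℕ) : Submodule ℂ (FreeAlgebra ℂ (RootIdx n m)) where
  carrier := {t | ∀ (B : Type) [Ring B] [Algebra ℂ⟦X⟧ B] [HComplete B] (A : Type) [Ring A] [Algebra ℂ A]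
    (κ : B →+* A) (F : Uq n m →ₐ[ℂ⟦X⟧] B), TorsionFree B → IsLimit κ →
    FreeAlgebra.lift ℂ (rootVec (limitFamily κ F)) t = 0}
  add_mem' := fun {s t} hs ht B _ _ _ A _ _ κ F hB hκ => by
    rw [map_add, hs B A κ F hB hκ, ht B A κ F hB hκ, add_zero]
  zero_mem' := fun B _ _ _ A _ _ κ F _ _ => map_zero _
  smul_mem' := fun c t ht B _ _ _ A _ _ κ F hB hκ => by
    rw [map_smul, ht B A κ F hB hκ, smul_zero]

/-- A relation in Z holds in particular for the tensor product of F with the vector representation;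
matrices over a torsion-free complete algebra are again torsion-free and complete. Its entries are
the coaction entries evaluated at F. -/
theorem coaction_mem_limitRelations {t : FreeAlgebra ℂ (RootIdx n m)} (ht : t ∈ limitRelations n m)
    (u v : Fin (n + m + 3)) :
    coaction (rootSign n m) (rootMat n m) t u v ∈ limitRelations n m := by
  intro B _ _ _ A _ _ κ F hB hκ
  obtain ⟨F', hF'⟩ := exists_coproduct hκ F
  rw [← lift_coaction hF', ht _ _ κ.mapMatrix F' (fun x hx => ?_) hκ.mapMatrix, Matrix.zero_apply]
  ext u v
  exact hB _ (congrFun (congrFun hx u) v)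

/-- The trivial representation on ℂ[[h]] is torsion-free and does not kill 1. -/
theorem one_notMem_limitRelations : (1 : FreeAlgebra ℂ (RootIdx n m)) ∉ limitRelations n m := by
  intro h
  have H : IsChev n m (fun _ => (0 : ℂ⟦X⟧)) (fun _ => 0) (fun _ => 0) := by
    refine ⟨by simp, by simp, by simp, by simp, by simp, by simp, by simp, fun i _ => ?_, ?_, ?_⟩
    · rw [qN_zero]; simp
    · constructor <;> simp
    · constructor <;> simp
  obtain ⟨F, -⟩ := H.exists_lift
  have h1 := h ℂ⟦X⟧ ℂ (PowerSeries.constantCoeff (R := ℂ)) F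
    (fun x hx => by simpa using hx) (fun c b => by simp)
  rw [map_one] at h1
  exact one_ne_zero h1

theorem map_rootVec {R R' : Type} [Ring R] [Ring R'] (g : R →+* R') (a : ℤˣ → ℕ → R)
    (α : RootIdx n m) : g (rootVec a α) = rootVec (fun ξ i => g (a ξ i)) α := by
  rw [rootVec, rootVec, cX, cX]
  split_ifs
  · rfl
  · rfl
  · rw [map_sub, map_zsmul, map_mul, map_mul]

/-- A homomorphism under which h becomes 0 kills hU', which contains the kernel of π. -/
theorem exists_limit_factor {C : Type} [Ring C] [Algebra ℂ C] {π : UqCag n m →+* C}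
    (hπ : Function.Surjective π) (hπl : IsLimit π)
    (hπ0 : ∀ x, π x = 0 → ∃ y, x = (PowerSeries.X : ℂ⟦X⟧) • y)
    {κ : UqCag n m →+* A} (hκ : IsLimit κ) : ∃ g : C →ₐ[ℂ] A, ∀ x, g (π x) = κ x := by
  have hker : RingHom.ker π ≤ RingHom.ker κ := by
    intro x hx
    obtain ⟨y, rfl⟩ := hπ0 x hx
    exact hκ.X y
  let g : C →+* A := π.liftOfRightInverse _ (Function.rightInverse_surjInv hπ) ⟨κ, hker⟩
  have hg : ∀ x, g (π x) = κ x :=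
    π.liftOfRightInverse_comp_apply _ (Function.rightInverse_surjInv hπ) ⟨κ, hker⟩
  refine ⟨{ g with commutes' := fun c => ?_ }, hg⟩
  have h1 := hπl (PowerSeries.C c) 1
  have h2 := hκ (PowerSeries.C c) 1
  rw [PowerSeries.constantCoeff_C, map_one, ← Algebra.algebraMap_eq_smul_one] at h1 h2
  change g (algebraMap ℂ C c) = _
  rw [Algebra.algebraMap_eq_smul_one, ← h1, hg, h2, Algebra.algebraMap_eq_smul_one]

theorem adjoin_limit_eq_top {C : Type} [Ring C] [Algebra ℂ C] {π : UqCag n m →+* C}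
    (hπ : Function.Surjective π) (hπl : IsLimit π) :
    Algebra.adjoin ℂ ((fun i => π (cH n m i)) '' {i | 1 ≤ i ∧ i ≤ n + m} ∪
      {x | ∃ ξ i, (1 ≤ i ∧ i ≤ n + m) ∧ x = π (ca n m ξ i)}) = ⊤ := by
  rw [eq_top_iff]
  rintro y -
  obtain ⟨x, rfl⟩ := hπ y
  obtain ⟨z, rfl⟩ := cls_surjective x
  rw [HFree.eq_const_add z, map_add, map_smul, map_add, hπl.X, add_zero]
  generalize PowerSeries.coeff 0 (HFree.ser z) = w
  rw [← HFree.constHom_apply]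
  induction w using FreeAlgebra.induction with
  | grade0 c =>
    rw [HFree.constHom_apply, HFree.const_algebraMap, AlgHom.commutes,
      Algebra.algebraMap_eq_smul_one, hπl, map_one, PowerSeries.constantCoeff_C,
      ← Algebra.algebraMap_eq_smul_one]
    exact Subalgebra.algebraMap_mem _ c
  | grade1 g =>
    refine Algebra.subset_adjoin ?_
    rcases g with i | ⟨ξ, i⟩
    · refine Or.inl ⟨i, i.2, ?_⟩
      simp only [cH, cagH, cagH0, dif_pos i.2]
      rfl
    · refine Or.inr ⟨ξ, i, i.2, ?_⟩
      simp only [ca, caga, dif_pos i.2]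
      rfl
  | mul a b ha hb => rw [map_mul, map_mul, map_mul]; exact mul_mem ha hb
  | add a b ha hb => rw [map_add, map_add, map_add]; exact add_mem ha hb

/-- The key step: the representations pulled back from U_q[sl(n+1|m)] to U' separate the points of
U'. Spanning by ordered monomials in U'/hU' meets their independence over all specialisations. -/
theorem eq_zero_of_forall_hom {x : UqCag n m}
    (hx : ∀ (B : Type) [Ring B] [Algebra ℂ⟦X⟧ B] [HComplete B] (A : Type) [Ring A] [Algebra ℂ A]
      (κ : B →+* A) (F : Uq n m →ₐ[ℂ⟦X⟧] B), TorsionFree B → IsLimit κ → F (cagToUq n m x) = 0) :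
    x = 0 := by
  obtain ⟨C, _, _, π, hπ, hπl, hπ0⟩ := exists_residue (UqCag n m)
  -- The family consists of all elements killed by every such representation. If hy belongs to it
  -- then so does y, since the targets have no h-torsion; so it suffices that each member vanishes
  -- modulo h.
  refine eq_zero_of_forall_eq_X_smul (ι := {x : UqCag n m // ∀ (B : Type) [Ring B]
    [Algebra ℂ⟦X⟧ B] [HComplete B] (A : Type) [Ring A] [Algebra ℂ A]
    (κ : B →+* A) (F : Uq n m →ₐ[ℂ⟦X⟧] B), TorsionFree B → IsLimit κ → F (cagToUq n m x) = 0})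
    (fun x => x.1) (fun x => ?_) ⟨x, hx⟩
  obtain ⟨x, hx⟩ := x
  suffices h0 : π x = 0 by
    obtain ⟨y, rfl⟩ := hπ0 x h0
    refine ⟨⟨y, fun B _ _ _ A _ _ κ F hB hκ => hB _ ?_⟩, rfl⟩
    rw [← map_smul, ← map_smul]; exact hx B A κ F hB hκ
  obtain ⟨t, ht, htx⟩ := (hπl.isClassicalCag (isCag_cls n m)).exists_isPBW
    (adjoin_limit_eq_top hπ hπl) (π x)
  -- Each specialisation factors through U'/hU', where t represents the class of x; as F kills the
  -- image of x, it satisfies the relation t.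
  have hZ : t ∈ limitRelations n m := by
    intro B _ _ _ A _ _ κ F hB hκ
    have hκ' : IsLimit (κ.comp ((F : Uq n m →+* B).comp (cagToUq n m : UqCag n m →+* Uq n m))) :=
      fun c b => by simp only [RingHom.comp_apply, RingHom.coe_coe, map_smul, hκ c]
    obtain ⟨g, hg⟩ := exists_limit_factor hπ hπl hπ0 hκ'
    have h1 : FreeAlgebra.lift ℂ (rootVec (limitFamily κ F))
        = g.comp (FreeAlgebra.lift ℂ (rootVec (n := n) (m := m) fun ξ i => π (ca n m ξ i))) := by
      refine FreeAlgebra.hom_ext (funext fun α => ?_)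
      simp only [Function.comp_apply, FreeAlgebra.lift_ι_apply, AlgHom.comp_apply]
      refine Eq.trans ?_ (map_rootVec (g : C →+* A) _ α).symm
      simp only [RingHom.coe_coe, hg]; rfl
    rw [h1, AlgHom.comp_apply, htx, hg]
    simp only [RingHom.comp_apply, RingHom.coe_coe, hx B A κ F hB hκ, map_zero]
  rw [← htx, eq_zero_of_mem_span_isPBW (isDetecting n m) (limitRelations n m)
    (fun z hz u v => coaction_mem_limitRelations hz u v) one_notMem_limitRelations ht hZ, map_zero]

theorem cagToUq_injective (n m : ℕ) : Function.Injective (cagToUq n m) := by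
  refine (injective_iff_map_eq_zero _).2 fun x hx => eq_zero_of_forall_hom ?_
  intro B _ _ _ A _ _ κ F _ _
  rw [hx, map_zero]

/-- If hx = 0, then hF(x) = 0 and so F(x) = 0 in every torsion-free target; no torsion-freeness of
U_q[sl(n+1|m)] is presupposed. -/
theorem torsionFree_uqCag (n m : ℕ) : TorsionFree (UqCag n m) := by
  refine fun x hx => eq_zero_of_forall_hom ?_
  intro B _ _ _ A _ _ κ F hB _
  refine hB _ ?_
  rw [← map_smul, ← map_smul, hx, map_zero, map_zero]

end Injective

end UqSl
end

noncomputable section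

namespace UqSl

/-! ### Surjectivity, and the inverse on the Chevalley generators -/

section Inverse

variable {n m : ℕ}

theorem cagToUq_cls (x : HFree (CagGen n m)) :
    cagToUq n m (cls (CagRel n m) x) = ((cagToUq n m).comp (cls (CagRel n m))) x := rfl

theorem cagToUq_scomm (ξ η : ℤˣ) {i j : ℕ} (hi : 1 ≤ i ∧ i ≤ n + m) (hj : 1 ≤ j ∧ j ≤ n + m) :
    cagToUq n m (cls (CagRel n m) (cagsbr n m ξ η i j))
      = scomm n (ra n (ue n m) (uf n m)) ξ η i j := by
  rw [cagToUq_cls, map_cagsbr, scomm, scomm]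
  simp only [AlgHom.comp_apply]
  rw [← cagToUq_ca ξ hi, ← cagToUq_ca η hj]; rfl

theorem cagToUq_cagL (c : ℤ) {i : ℕ} (hi : 1 ≤ i ∧ i ≤ n + m) :
    cagToUq n m (cls (CagRel n m) (cagL n m c i)) = qE (c • hH n (uh n m) i) := by
  rw [cagToUq_cls, map_cagL, AlgHom.comp_apply, ← cagToUq_cH hi]; rfl

theorem cagToUq_h_succ {l : ℕ} (hl : 1 ≤ l) (hlr : l + 1 ≤ n + m) :
    cagToUq n m (cls (CagRel n m) (((-1 : ℤ) ^ theta n l) • (cagH n m (l + 1) - cagH n m l)))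
      = uh n m (l + 1) := by
  have h1 := cagToUq_cH (n := n) (m := m) (i := l + 1) ⟨by omega, hlr⟩
  have h2 := cagToUq_cH (n := n) (m := m) (i := l) ⟨hl, by omega⟩
  rw [cH] at h1 h2
  rw [map_zsmul, map_zsmul, map_sub, map_sub, h1, h2, hH_succ, add_sub_cancel_left, ← sg_eq_pow,
    smul_smul, sg_mul_self, one_smul]

theorem sg_smul_sg_smul {B : Type} [Ring B] [Algebra ℂ⟦X⟧ B] (n l : ℕ) (x : B) :
    (-(-1 : ℤ) ^ theta n l) • (-(sg n l : ℂ⟦X⟧) • x) = x := by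
  rw [← Int.cast_smul_eq_zsmul ℂ⟦X⟧, smul_smul, ← sg_eq_pow, Int.cast_neg, neg_mul_neg,
    sg_cast_mul_self, one_smul]

theorem cagToUq_e_succ {l : ℕ} (hl : 1 ≤ l) (hlr : l + 1 ≤ n + m) :
    cagToUq n m (cls (CagRel n m) ((-(-1 : ℤ) ^ theta n l) •
      (cagsbr n m (-1) 1 (l + 1) l * cagL n m 1 l))) = ue n m (l + 1) := by
  rw [map_zsmul, map_zsmul, map_mul, map_mul, cagToUq_scomm _ _ ⟨by omega, hlr⟩ ⟨hl, by omega⟩,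
    cagToUq_cagL _ ⟨hl, by omega⟩, (isChev_cls n m).scomm_N_succ hl hlr,
    smul_mul_assoc, one_smul, mul_assoc, qE_neg_mul_self, mul_one, sg_smul_sg_smul]

theorem cagToUq_f_succ {l : ℕ} (hl : 1 ≤ l) (hlr : l + 1 ≤ n + m) :
    cagToUq n m (cls (CagRel n m) ((-(-1 : ℤ) ^ theta n l) •
      (cagL n m (-1) l * cagsbr n m (-1) 1 l (l + 1)))) = uf n m (l + 1) := by
  rw [map_zsmul, map_zsmul, map_mul, map_mul, cagToUq_scomm _ _ ⟨hl, by omega⟩ ⟨by omega, hlr⟩,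
    cagToUq_cagL _ ⟨hl, by omega⟩, (isChev_cls n m).scomm_N_pred hl hlr,
    mul_smul_comm, neg_one_zsmul, ← mul_assoc, qE_neg_mul_self, one_mul, sg_smul_sg_smul]

theorem cls_gen_h (i : Idx n m) : cls (ChevRel n m) (HFree.gen (.h i)) = uh n m i := by
  rw [uh, chevh, chevh0, dif_pos i.2]; rfl

theorem cls_gen_e (i : Idx n m) : cls (ChevRel n m) (HFree.gen (.e i)) = ue n m i := by
  rw [ue, cheve, dif_pos i.2]

theorem cls_gen_f (i : Idx n m) : cls (ChevRel n m) (HFree.gen (.f i)) = uf n m i := by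
  rw [uf, chevf, dif_pos i.2]

theorem cagToUq_h_one (h : 1 ≤ n + m) : cagToUq n m (cls (CagRel n m) (cagH n m 1)) = uh n m 1 := by
  refine (cagToUq_cH ⟨le_rfl, h⟩).trans ?_
  simp [hH, theta]

theorem cagToUq_e_one (h : 1 ≤ n + m) :
    cagToUq n m (cls (CagRel n m) (caga n m (-1) 1)) = ue n m 1 := by
  refine (cagToUq_ca _ ⟨le_rfl, h⟩).trans ?_
  rw [ra_neg_one]; rfl

theorem cagToUq_f_one (h : 1 ≤ n + m) :
    cagToUq n m (cls (CagRel n m) (caga n m 1 1)) = uf n m 1 := by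
  refine (cagToUq_ca _ ⟨le_rfl, h⟩).trans ?_
  rw [ra_one]; rfl

theorem cagToUq_surjective (n m : ℕ) : Function.Surjective (cagToUq n m) := by
  have key : ∀ g : ChevGen n m, ∃ x, cagToUq n m x = cls (ChevRel n m) (HFree.gen g) := by
    rintro (⟨i, hi⟩ | ⟨i, hi⟩ | ⟨i, hi⟩)
    · rw [cls_gen_h]
      obtain rfl | ⟨l, hl, rfl⟩ : i = 1 ∨ ∃ l, 1 ≤ l ∧ i = l + 1 := by
        rcases eq_or_ne i 1 with h | h
        exacts [Or.inl h, Or.inr ⟨i - 1, by omega, by omega⟩]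
      exacts [⟨_, cagToUq_h_one hi.2⟩, ⟨_, cagToUq_h_succ hl hi.2⟩]
    · rw [cls_gen_e]
      obtain rfl | ⟨l, hl, rfl⟩ : i = 1 ∨ ∃ l, 1 ≤ l ∧ i = l + 1 := by
        rcases eq_or_ne i 1 with h | h
        exacts [Or.inl h, Or.inr ⟨i - 1, by omega, by omega⟩]
      exacts [⟨_, cagToUq_e_one hi.2⟩, ⟨_, cagToUq_e_succ hl hi.2⟩]
    · rw [cls_gen_f]
      obtain rfl | ⟨l, hl, rfl⟩ : i = 1 ∨ ∃ l, 1 ≤ l ∧ i = l + 1 := by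
        rcases eq_or_ne i 1 with h | h
        exacts [Or.inl h, Or.inr ⟨i - 1, by omega, by omega⟩]
      exacts [⟨_, cagToUq_f_one hi.2⟩, ⟨_, cagToUq_f_succ hl hi.2⟩]
  choose x hx using key
  -- Preimages of the generators are extended to the completed free algebra only, so no relation has
  -- to be checked; the composite with `cagToUq` is the quotient map, which is surjective.
  obtain ⟨Ψ, hΨ⟩ := HFree.exists_lift x
  have h : (cagToUq n m).comp Ψ = cls (ChevRel n m) := HFree.hom_ext fun g => by
    rw [AlgHom.comp_apply, hΨ, hx]
  intro y
  obtain ⟨z, rfl⟩ := cls_surjective y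
  exact ⟨Ψ z, DFunLike.congr_fun h z⟩

/-- The isomorphism `UqCag n m ≃ Uq n m`. -/
def cagEquivUq (n m : ℕ) : UqCag n m ≃ₐ[ℂ⟦X⟧] Uq n m :=
  AlgEquiv.ofBijective (cagToUq n m) ⟨cagToUq_injective n m, cagToUq_surjective n m⟩

theorem torsionFree_uq (n m : ℕ) : TorsionFree (Uq n m) := by
  intro y hy
  obtain ⟨x, rfl⟩ := cagToUq_surjective n m y
  rw [← map_smul, ← map_zero (cagToUq n m)] at hy
  rw [torsionFree_uqCag n m x (cagToUq_injective n m hy), map_zero]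

theorem cls_chevH (i : ℕ) : cls (ChevRel n m) (chevH n m i) = hH n (uh n m) i := by
  rw [chevH, map_sum, hH]
  refine Finset.sum_congr rfl fun p _ => ?_
  rw [map_zsmul]; rfl

theorem cls_chevaMinus : ∀ i, cls (ChevRel n m) (chevaMinus n m i) = rN n (ue n m) i
  | 0 => map_zero _
  | 1 => rfl
  | i + 2 => by
    rw [chevaMinus, br, map_sub, map_smul, map_mul, map_mul, cls_chevaMinus (i + 1)]; rfl

theorem cls_chevaPlus : ∀ i, cls (ChevRel n m) (chevaPlus n m i) = rP n (uf n m) i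
  | 0 => map_zero _
  | 1 => rfl
  | i + 2 => by
    rw [chevaPlus, br, map_sub, map_smul, map_mul, map_mul, cls_chevaPlus (i + 1),
      rP_succ (i := i + 1) (by omega)]; rfl

end Inverse

end UqSl
end

noncomputable section

namespace UqSl

/-! ### Complete torsion-free algebras are topologically free -/

section TopologicallyFree

theorem mem_span_X_pow_smul_top {M : Type} [AddCommGroup M] [Module ℂ⟦X⟧ M] (k : ℕ) (x : M) :
    x ∈ (Ideal.span {(PowerSeries.X : ℂ⟦X⟧)} ^ k • ⊤ : Submodule ℂ⟦X⟧ M)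
      ↔ ∃ y : M, x = (PowerSeries.X ^ k : ℂ⟦X⟧) • y := by
  rw [Ideal.span_singleton_pow, Submodule.ideal_span_singleton_smul,
    Submodule.mem_smul_pointwise_iff_exists]
  simp [eq_comm]

variable {B : Type} [Ring B] [Algebra ℂ⟦X⟧ B]

theorem isAdicComplete_of_hComplete [HComplete B] :
    IsAdicComplete (Ideal.span {(PowerSeries.X : ℂ⟦X⟧)}) B where
  haus' x hx := HComplete.eq_zero x fun k =>
    (mem_span_X_pow_smul_top k x).1 ((SModEq.zero).1 (hx k))
  prec' f hf := by
    have h : ∀ k, ∃ y : B, f (k + 1) - f k = (PowerSeries.X ^ k : ℂ⟦X⟧) • y := fun k =>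
      (mem_span_X_pow_smul_top k _).1 (SModEq.sub_mem.1 (hf (Nat.le_succ k)).symm)
    choose g hg using h
    refine ⟨f 0 + hsum g, fun k => ?_⟩
    rw [SModEq.comm, SModEq.sub_mem, mem_span_X_pow_smul_top]
    obtain ⟨y, hy⟩ := hsum_spec g k
    refine ⟨y, ?_⟩
    rw [hy, ← Finset.sum_congr rfl fun i _ => hg i, Finset.sum_range_sub]
    abel

theorem finsupp_eq_X_smul {ι : Type} {y : ι →₀ ℂ⟦X⟧} (hy : ∀ i, PowerSeries.coeff 0 (y i) = 0) :
    ∃ z : ι →₀ ℂ⟦X⟧, y = (PowerSeries.X : ℂ⟦X⟧) • z := by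
  refine ⟨y.mapRange divh (by ext; simp [divh]), Finsupp.ext fun i => ?_⟩
  rw [Finsupp.smul_apply, Finsupp.mapRange_apply, smul_eq_mul, X_mul_divh _ (hy i)]

/-- Lifts of a ℂ-basis of B/hB define a map F from a free module to B. It is surjective modulo h
and, by torsion-freeness, injective modulo every h^k, so it becomes an isomorphism after completion,
and B is its own completion. -/
theorem isTopologicallyFree_of_torsionFree [HComplete B] (hB : TorsionFree B) :
    IsTopologicallyFree B := by
  obtain ⟨C, _, _, π, hπ, hπl, hπ0⟩ := exists_residue B
  let b := Module.Basis.ofVectorSpace ℂ C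
  choose v hv using fun i => hπ (b i)
  let F := Finsupp.linearCombination ℂ⟦X⟧ v
  have hF : ∀ y, π (F y) = y.sum fun i c => PowerSeries.constantCoeff c • b i := fun y => by
    rw [Finsupp.linearCombination_apply, Finsupp.sum, map_sum]
    exact Finset.sum_congr rfl fun i _ => by rw [hπl, hv]
  have hsurj : Function.Surjective
      ((Ideal.span {(PowerSeries.X : ℂ⟦X⟧)} • ⊤ : Submodule ℂ⟦X⟧ B).mkQ ∘ₗ F) := by
    intro x
    obtain ⟨x, rfl⟩ := Submodule.mkQ_surjective _ x
    let y := (b.repr (π x)).mapRange (PowerSeries.C (R := ℂ)) (map_zero _)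
    refine ⟨y, ?_⟩
    have h0 : π (F y) = π x := by
      rw [hF, Finsupp.sum_mapRange_index (by simp)]
      simp only [PowerSeries.constantCoeff_C]
      exact b.linearCombination_repr (π x)
    obtain ⟨z, hz⟩ := hπ0 (F y - x) (by rw [map_sub, h0, sub_self])
    rw [LinearMap.comp_apply, ← sub_eq_zero, ← map_sub, Submodule.mkQ_apply,
      Submodule.Quotient.mk_eq_zero, ← pow_one (Ideal.span _), mem_span_X_pow_smul_top]
    exact ⟨z, by rw [hz, pow_one]⟩
  -- Divisibility by h^k is reflected by F. Independence modulo h makes y divisible by h once, and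
  -- torsion-freeness cancels that h on both sides.
  have hinj : ∀ k y x, F y = (PowerSeries.X ^ k : ℂ⟦X⟧) • x →
      ∃ z, y = (PowerSeries.X ^ k : ℂ⟦X⟧) • z := by
    intro k
    induction k with
    | zero => exact fun y x _ => ⟨y, by simp⟩
    | succ k ih =>
      intro y x hy
      have h0 : π (F y) = 0 := by rw [hy, pow_succ', mul_smul, hπl.X]
      rw [hF, ← Finsupp.sum_mapRange_index (f := PowerSeries.constantCoeff (R := ℂ))
        (hf := map_zero _) (h := fun i c => c • b i) (by simp)] at h0
      have h1 := (linearIndependent_iff.1 b.linearIndependent) _ h0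
      obtain ⟨z, rfl⟩ := finsupp_eq_X_smul (y := y) fun i => by
        simpa using DFunLike.congr_fun h1 i
      have h2 : F z = (PowerSeries.X ^ k : ℂ⟦X⟧) • x := by
        rw [← sub_eq_zero]
        refine hB _ ?_
        rw [smul_sub, ← map_smul, hy, smul_smul, pow_succ', sub_self]
      obtain ⟨w, rfl⟩ := ih z x h2
      exact ⟨w, by rw [smul_smul, pow_succ']⟩
  let I := Ideal.span {(PowerSeries.X : ℂ⟦X⟧)}
  have _ : IsAdicComplete I B := isAdicComplete_of_hComplete
  -- Surjectivity modulo h suffices for surjectivity of the completed map; injectivity is checked at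
  -- each level k with `hinj`.
  have hbij : Function.Bijective (AdicCompletion.map I F) := by
    refine ⟨(injective_iff_map_eq_zero _).2 fun x hx => AdicCompletion.ext fun k => ?_,
      AdicCompletion.map_surjective_of_mkQ_comp_surjective hsurj⟩
    obtain ⟨y, hy⟩ := Submodule.mkQ_surjective _ (x.val k)
    have h1 : (AdicCompletion.map I F x).val k = 0 := by rw [hx]; rfl
    rw [AdicCompletion.map_val_apply, ← hy, Submodule.mkQ_apply, LinearMap.reduceModIdeal_apply,
      Submodule.Quotient.mk_eq_zero, mem_span_X_pow_smul_top] at h1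
    obtain ⟨z, hz⟩ := h1
    rw [← hy, Submodule.mkQ_apply]
    exact (Submodule.Quotient.mk_eq_zero _).2 ((mem_span_X_pow_smul_top k y).2 (hinj k y z hz))
  exact ⟨_, ⟨(AdicCompletion.ofLinearEquiv I B).trans
    (LinearEquiv.ofBijective ((AdicCompletion.map I F).restrictScalars ℂ⟦X⟧) hbij).symm⟩⟩

end TopologicallyFree

end UqSl
end
theorem mainTheorem1 (n m : ℕ) :
    UqSl.IsTopologicallyFree (UqSl.Uq n m) ∧
    ∃ Φ : UqSl.UqCag n m ≃ₐ[ℂ⟦X⟧] UqSl.Uq n m,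
      (∀ i : ℕ, 1 ≤ i → i ≤ n + m →
        Φ (UqSl.cls (UqSl.CagRel n m) (UqSl.cagH n m i))
            = UqSl.cls (UqSl.ChevRel n m) (UqSl.chevH n m i) ∧
        Φ (UqSl.cls (UqSl.CagRel n m) (UqSl.caga n m (-1) i))
            = UqSl.cls (UqSl.ChevRel n m) (UqSl.chevaMinus n m i) ∧
        Φ (UqSl.cls (UqSl.CagRel n m) (UqSl.caga n m 1 i))
            = UqSl.cls (UqSl.ChevRel n m) (UqSl.chevaPlus n m i)) ∧
      (1 ≤ n + m →
        Φ.symm (UqSl.cls (UqSl.ChevRel n m) (UqSl.chevh n m 1))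
            = UqSl.cls (UqSl.CagRel n m) (UqSl.cagH n m 1) ∧
        Φ.symm (UqSl.cls (UqSl.ChevRel n m) (UqSl.cheve n m 1))
            = UqSl.cls (UqSl.CagRel n m) (UqSl.caga n m (-1) 1) ∧
        Φ.symm (UqSl.cls (UqSl.ChevRel n m) (UqSl.chevf n m 1))
            = UqSl.cls (UqSl.CagRel n m) (UqSl.caga n m 1 1)) ∧
      (∀ i : ℕ, 1 ≤ i → i + 1 ≤ n + m →
        Φ.symm (UqSl.cls (UqSl.ChevRel n m) (UqSl.chevh n m (i + 1)))
            = UqSl.cls (UqSl.CagRel n m)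
                (((-1 : ℤ) ^ UqSl.theta n i) • (UqSl.cagH n m (i + 1) - UqSl.cagH n m i)) ∧
        Φ.symm (UqSl.cls (UqSl.ChevRel n m) (UqSl.cheve n m (i + 1)))
            = UqSl.cls (UqSl.CagRel n m)
                ((-(-1 : ℤ) ^ UqSl.theta n i) •
                  (UqSl.cagsbr n m (-1) 1 (i + 1) i * UqSl.cagL n m 1 i)) ∧
        Φ.symm (UqSl.cls (UqSl.ChevRel n m) (UqSl.chevf n m (i + 1)))
            = UqSl.cls (UqSl.CagRel n m)
                ((-(-1 : ℤ) ^ UqSl.theta n i) •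
                  (UqSl.cagL n m (-1) i * UqSl.cagsbr n m (-1) 1 i (i + 1)))) := by
  refine ⟨UqSl.isTopologicallyFree_of_torsionFree (UqSl.torsionFree_uq n m),
    UqSl.cagEquivUq n m, fun i h1 h2 => ⟨?_, ?_, ?_⟩, fun h => ⟨?_, ?_, ?_⟩,
    fun i h1 h2 => ⟨?_, ?_, ?_⟩⟩
  · exact (UqSl.cagToUq_cH ⟨h1, h2⟩).trans (UqSl.cls_chevH i).symm
  · exact ((UqSl.cagToUq_ca (-1) ⟨h1, h2⟩).trans (UqSl.ra_neg_one i)).trans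
      (UqSl.cls_chevaMinus i).symm
  · exact ((UqSl.cagToUq_ca 1 ⟨h1, h2⟩).trans (UqSl.ra_one i)).trans (UqSl.cls_chevaPlus i).symm
  · exact (AlgEquiv.symm_apply_eq _).2 (UqSl.cagToUq_h_one h).symm
  · exact (AlgEquiv.symm_apply_eq _).2 (UqSl.cagToUq_e_one h).symm
  · exact (AlgEquiv.symm_apply_eq _).2 (UqSl.cagToUq_f_one h).symm
  · exact (AlgEquiv.symm_apply_eq _).2 (UqSl.cagToUq_h_succ h1 h2).symm
  · exact (AlgEquiv.symm_apply_eq _).2 (UqSl.cagToUq_e_succ h1 h2).symm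
  · exact (AlgEquiv.symm_apply_eq _).2 (UqSl.cagToUq_f_succ h1 h2).symm
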